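/- Let $G$ be a biconnected graph on $n\ge 3$ vertices (connected, without cut vertices), with adjacency lists and vertex weights $\mathrm{Pen}\colon V(G)\to\mathbb N$ as input, and let $k$ be its feedback edge number, i.e. the minimum number of edges whose deletion turns $G$ into a forest. For $s,t,v\in V(G)$ let $\sigma_{st}$ be the number of shortest $s$-$t$-paths, let $\sigma_{st}(v)$ be the number of those that contain $v$, with $\sigma_{st}(v):=0$ if $v\in\{s,t\}$, and put $$\gamma(s,t,v):=\mathrm{Pen}[s]\cdot\mathrm{Pen}[t]\cdot\frac{\sigma_{st}(v)}{\sigma_{st}} .$$ A maximal induced path of $G$ is a path $v_0v_1\dots v_\ell$ in $G$ with $\ell\ge 2$, $\deg_G(v_i)=2$ for $0<i<\ell$, and $\deg_G(v_0)\ne 2\ne\deg_G(v_\ell)$; a path and its reversal are regarded as the same path. Let $\mathcal P^{\max}$ be the set of all maximal induced paths of $G$ and, for $P\in\mathcal P^{\max}$, let $V^{=2}(P)$ be the set of vertices of $P$ that have degree two in $G$. Then the values $$\sum_{\substack{P_1,P_2\in\mathcal P^{\max}\\ P_1\ne P_2}}\ \sum_{s\in V^{=2}(P_1),\ t\in V^{=2}(P_2)}\gamma(s,t,v)\qquad\text{for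 all } v\in V(G)$$ (the outer sum runs over ordered pairs) can be computed in $O(kn)$ total time. That is, there are one program and one constant $C$ such that on every such input the program halts after at most $C\cdot k\cdot n$ steps with these values as output. Time is measured on a unit-cost random access machine whose index registers and arrays hold natural numbers (with addition, subtraction and comparison) and whose number registers and arrays hold rational numbers (with $+,-,\cdot,/$). -/

import Mathlib

/-! ### Graph notions -/

namespace BetwCent

/-- A biconnected graph: at least three vertices, connected, and no vertex whose removal
disconnects the graph. -/
structure IsBiconnected {V : Type*} [Fintype V] (G : SimpleGraph V) : Prop where
  three_le_card : 3 ≤ Fintype.card V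
  connected : G.Connected
  no_cut_vertex : ∀ v : V, (G.induce {w | w ≠ v}).Connected

/-- The feedback edge number: the least number of edges whose deletion leaves a forest. -/
noncomputable def feedbackEdgeNumber {V : Type*} (G : SimpleGraph V) : ℕ :=
  sInf {k | ∃ F : Finset (Sym2 V), (F : Set (Sym2 V)) ⊆ G.edgeSet ∧ F.card = k ∧
    (G.deleteEdges (F : Set (Sym2 V))).IsAcyclic}

/-- `σ_{st}`: the number of shortest paths from `s` to `t`. -/
noncomputable def sigma {V : Type*} (G : SimpleGraph V) (s t : V) : ℕ :=
  {p : G.Walk s t | p.IsPath ∧ p.length = G.dist s t}.ncard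

open scoped Classical in
/-- `σ_{st}(v)`: the number of shortest paths from `s` to `t` that visit `v`,
set to `0` if `v = s` or `v = t`. -/
noncomputable def sigmaThrough {V : Type*} (G : SimpleGraph V) (s t v : V) : ℕ :=
  if v = s ∨ v = t then 0
  else {p : G.Walk s t | p.IsPath ∧ p.length = G.dist s t ∧ v ∈ p.support}.ncard

/-- `γ(s,t,v) = Pen[s] · Pen[t] · σ_{st}(v) / σ_{st}`. -/
noncomputable def gamma {V : Type*} (G : SimpleGraph V) (pen : V → ℕ) (s t v : V) : ℚ :=
  (pen s : ℚ) * (pen t : ℚ) * (sigmaThrough G s t v : ℚ) / (sigma G s t : ℚ)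

open scoped Classical in
/-- A subgraph `P` of `G` is a maximal induced path: it consists of the vertices and edges of a
path of length at least two whose inner vertices have degree two in `G` and whose two endpoints
do not.  (As a subgraph, a path and its reversal are the same object.) -/
def IsMaxInducedPath {V : Type*} [Fintype V] (G : SimpleGraph V) (P : G.Subgraph) : Prop :=
  ∃ (a b : V) (p : G.Walk a b), p.IsPath ∧ 2 ≤ p.length ∧
    G.degree a ≠ 2 ∧ G.degree b ≠ 2 ∧
    (∀ w ∈ p.support, w ≠ a → w ≠ b → G.degree w = 2) ∧
    P = p.toSubgraph

open scoped Classical in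
/-- The finite set of all maximal induced paths of `G`. -/
noncomputable def maxInducedPaths {V : Type*} [Fintype V] (G : SimpleGraph V) :
    Finset G.Subgraph :=
  Finset.univ.filter (IsMaxInducedPath G)

open scoped Classical in
/-- The vertices of `P` that have degree two in `G`. -/
noncomputable def degTwoVerts {V : Type*} [Fintype V] (G : SimpleGraph V) (P : G.Subgraph) :
    Finset V :=
  Finset.univ.filter (fun v => v ∈ P.verts ∧ G.degree v = 2)

open scoped Classical in
/-- The sum of `γ(s,t,v)` over all ordered pairs of different maximal induced paths `P₁`, `P₂` and
all degree-two vertices `s` of `P₁` and `t` of `P₂`. -/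
noncomputable def pairSum {V : Type*} [Fintype V] (G : SimpleGraph V) (pen : V → ℕ) (v : V) : ℚ :=
  ∑ P₁ ∈ maxInducedPaths G, ∑ P₂ ∈ (maxInducedPaths G).erase P₁,
    ∑ s ∈ degTwoVerts G P₁, ∑ t ∈ degTwoVerts G P₂, gamma G pen s t v

end BetwCent

/-! ### The machine model

A unit-cost random access machine, programmed in a structured while-language.  It has index
registers and index arrays holding natural numbers (used for addresses, vertex names, counters and
distances; operations: addition, truncated subtraction, comparison) and number registers and number
arrays holding rationals (operations: `+`, `-`, `*`, `/`; no comparison, no rounding, no conversion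
to indices).  Arrays are addressed by indices.  Every operation, memory access, constant, test and
control step is charged at least one time unit. -/

namespace RAM

/-- Memory contents. -/
structure State where
  ireg : ℕ → ℕ
  iarr : ℕ → ℕ → ℕ
  qreg : ℕ → ℚ
  qarr : ℕ → ℕ → ℚ

/-- Index expressions. -/
inductive IExp where
  | const (c : ℕ)
  | reg (x : ℕ)
  | arr (a : ℕ) (i : IExp)
  | add (e₁ e₂ : IExp)
  | sub (e₁ e₂ : IExp)

/-- Number expressions. -/
inductive QExp where
  | const (c : ℚ)
  | reg (x : ℕ)
  | arr (a : ℕ) (i : IExp)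
  | add (e₁ e₂ : QExp)
  | sub (e₁ e₂ : QExp)
  | mul (e₁ e₂ : QExp)
  | div (e₁ e₂ : QExp)

/-- Tests. -/
inductive BExp where
  | lt (e₁ e₂ : IExp)
  | eq (e₁ e₂ : IExp)
  | not (b : BExp)
  | and (b₁ b₂ : BExp)

/-- Programs. -/
inductive Prog where
  | skip
  | setI (x : ℕ) (e : IExp)
  | storeI (a : ℕ) (i e : IExp)
  | setQ (x : ℕ) (e : QExp)
  | storeQ (a : ℕ) (i : IExp) (e : QExp)
  | seq (p₁ p₂ : Prog)
  | ite (b : BExp) (p₁ p₂ : Prog)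
  | loop (b : BExp) (p : Prog)

def IExp.eval (S : State) : IExp → ℕ
  | .const c => c
  | .reg x => S.ireg x
  | .arr a i => S.iarr a (i.eval S)
  | .add e₁ e₂ => e₁.eval S + e₂.eval S
  | .sub e₁ e₂ => e₁.eval S - e₂.eval S

def QExp.eval (S : State) : QExp → ℚ
  | .const c => c
  | .reg x => S.qreg x
  | .arr a i => S.qarr a (i.eval S)
  | .add e₁ e₂ => e₁.eval S + e₂.eval S
  | .sub e₁ e₂ => e₁.eval S - e₂.eval S
  | .mul e₁ e₂ => e₁.eval S * e₂.eval S
  | .div e₁ e₂ => e₁.eval S / e₂.eval S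

def BExp.eval (S : State) : BExp → Bool
  | .lt e₁ e₂ => decide (e₁.eval S < e₂.eval S)
  | .eq e₁ e₂ => decide (e₁.eval S = e₂.eval S)
  | .not b => !b.eval S
  | .and b₁ b₂ => b₁.eval S && b₂.eval S

/-- The time to evaluate an index expression: its number of nodes. -/
def IExp.cost : IExp → ℕ
  | .const _ => 1
  | .reg _ => 1
  | .arr _ i => i.cost + 1
  | .add e₁ e₂ => e₁.cost + e₂.cost + 1
  | .sub e₁ e₂ => e₁.cost + e₂.cost + 1

/-- The time to evaluate a number expression: its number of nodes. -/
def QExp.cost : QExp → ℕ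
  | .const _ => 1
  | .reg _ => 1
  | .arr _ i => i.cost + 1
  | .add e₁ e₂ => e₁.cost + e₂.cost + 1
  | .sub e₁ e₂ => e₁.cost + e₂.cost + 1
  | .mul e₁ e₂ => e₁.cost + e₂.cost + 1
  | .div e₁ e₂ => e₁.cost + e₂.cost + 1

/-- The time to evaluate a test: its number of nodes. -/
def BExp.cost : BExp → ℕ
  | .lt e₁ e₂ => e₁.cost + e₂.cost + 1
  | .eq e₁ e₂ => e₁.cost + e₂.cost + 1
  | .not b => b.cost + 1
  | .and b₁ b₂ => b₁.cost + b₂.cost + 1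

def State.setI (S : State) (x v : ℕ) : State :=
  { S with ireg := Function.update S.ireg x v }

def State.storeI (S : State) (a i v : ℕ) : State :=
  { S with iarr := Function.update S.iarr a (Function.update (S.iarr a) i v) }

def State.setQ (S : State) (x : ℕ) (v : ℚ) : State :=
  { S with qreg := Function.update S.qreg x v }

def State.storeQ (S : State) (a i : ℕ) (v : ℚ) : State :=
  { S with qarr := Function.update S.qarr a (Function.update (S.qarr a) i v) }

/-- `Exec p S T S'`: started in memory `S`, the program `p` halts after exactly `T` time units with
memory `S'`. -/
inductive Exec : Prog → State → ℕ → State → Prop where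
  | skip (S : State) : Exec .skip S 1 S
  | setI (S : State) (x : ℕ) (e : IExp) :
      Exec (.setI x e) S (e.cost + 1) (S.setI x (e.eval S))
  | storeI (S : State) (a : ℕ) (i e : IExp) :
      Exec (.storeI a i e) S (i.cost + e.cost + 1) (S.storeI a (i.eval S) (e.eval S))
  | setQ (S : State) (x : ℕ) (e : QExp) :
      Exec (.setQ x e) S (e.cost + 1) (S.setQ x (e.eval S))
  | storeQ (S : State) (a : ℕ) (i : IExp) (e : QExp) :
      Exec (.storeQ a i e) S (i.cost + e.cost + 1) (S.storeQ a (i.eval S) (e.eval S))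
  | seq {p₁ p₂ : Prog} {S S' S'' : State} {T₁ T₂ : ℕ} :
      Exec p₁ S T₁ S' → Exec p₂ S' T₂ S'' → Exec (.seq p₁ p₂) S (T₁ + T₂) S''
  | iteTrue {b : BExp} {p₁ p₂ : Prog} {S S' : State} {T : ℕ} :
      b.eval S = true → Exec p₁ S T S' → Exec (.ite b p₁ p₂) S (b.cost + 1 + T) S'
  | iteFalse {b : BExp} {p₁ p₂ : Prog} {S S' : State} {T : ℕ} :
      b.eval S = false → Exec p₂ S T S' → Exec (.ite b p₁ p₂) S (b.cost + 1 + T) S'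
  | loopDone {b : BExp} {p : Prog} {S : State} :
      b.eval S = false → Exec (.loop b p) S (b.cost + 1) S
  | loopStep {b : BExp} {p : Prog} {S S' S'' : State} {T₁ T₂ : ℕ} :
      b.eval S = true → Exec p S T₁ S' → Exec (.loop b p) S' T₂ S'' →
      Exec (.loop b p) S (b.cost + 1 + T₁ + T₂) S''

end RAM

/-! ### Input format -/

namespace BetwCent

/-- `nb` is a system of adjacency lists of `G`: the list `nb v` enumerates the neighbours of `v`
without repetition, in an arbitrary order. -/
def IsAdjLists {n : ℕ} (G : SimpleGraph (Fin n)) (nb : Fin n → List (Fin n)) : Prop :=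
  ∀ v, (nb v).Nodup ∧ ∀ w, w ∈ nb v ↔ G.Adj v w

/-- The initial memory for a vertex-weighted graph on the vertices `0, …, n - 1`.
Index register `0` holds `n`.  Index array `1` holds the concatenation of the adjacency lists of
`0, …, n - 1`; entry `v` of index array `0` is the position at which the list of `v` starts (and
entry `n` the total length).  Number array `0` holds the vertex weights.  All other memory cells
are zero. -/
def inputState {n : ℕ} (nb : Fin n → List (Fin n)) (pen : Fin n → ℕ) : RAM.State where
  ireg := fun x => if x = 0 then n else 0
  iarr := fun a i =>
    if a = 0 then (((List.ofFn nb).take i).map List.length).sum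
    else if a = 1 then (((List.ofFn nb).flatten[i]?).map Fin.val).getD 0
    else 0
  qreg := fun _ => 0
  qarr := fun a i => if a = 0 then (if h : i < n then (pen ⟨i, h⟩ : ℚ) else 0) else 0

end BetwCent

/-! Call a vertex branching if its degree is not two. All degrees are at least two, and a spanning
tree together with a minimum feedback edge set covers all edges, so Σ(deg − 2) ≤ 2k − 2
(`sum_sub_two_le`). Hence there are O(k) branching vertices, their degrees add up to O(k), and there
are O(k) maximal induced paths. If a branching vertex exists, every vertex of degree two lies inside
exactly one of these paths; otherwise there are no paths and all sums are zero. A breadth-first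
search costs O(n + k); since at most min(n, 2k) vertices branch, searching from all of them costs
O(kn), even if k exceeds n.

Let t be the r-th vertex of a path with ends a, b and length l, and let s be outside its interior. A
shortest path from s to t enters at a or at b and is then forced, so σ_st is σ_sa, σ_sb or their
sum, depending on how d(s,a) + r compares with d(s,b) + l − r; σ_st(v) splits in the same way for v
outside the interior (`IsSeg.sigma_eq`, `IsSeg.through_eq`). For fixed s the inner vertices
therefore form three consecutive blocks, and the sum of Pen[s]·Pen[t]/σ_st over all t entered
through a given end comes from prefix sums of Pen in constant time (`PathCover.share_eq`). Adding
this over all paths other than that of s gives a `weight` for each pair of a branching vertex y and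
a vertex s; all weights together cost O(kn).

For fixed y, the sums over s of `weight` times the number of shortest s-y-paths through v are found
for all v by one sweep in order of decreasing distance from y, as in Brandes' dependency
accumulation (`load_rec`). This accounts for all pairs (s, t) except those with v inside the path of
t. As γ is symmetric in s and t, the missing sum equals the sum over the pairs with v inside the
path of s. There v is outside the path of t, so the same weights apply, with s restricted to the
path of v. The restricted sums obey a similar recursion, because a shortest path from y does not
leave a path between two of its inner vertices (`PathCover.ownLoad_rec`).
`PathCover.pairSum_eq_sum_load` combines both parts.

Each phase of the program is verified against a time bound in the logic of `Ends`, and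
`ends_mainProg` composes the phases. -/

set_option linter.unusedSectionVars false

/-! ### A time-bounded program logic for the machine. -/

namespace RAM

/-! ### Reasoning about programs -/

/-- Started in `S`, the program `p` halts within `c` time units in a state satisfying `Q`. -/
def Ends (p : Prog) (S : State) (c : ℕ) (Q : State → Prop) : Prop :=
  ∃ T S', Exec p S T S' ∧ T ≤ c ∧ Q S'

theorem Ends.mono {p : Prog} {S : State} {c c' : ℕ} {Q Q' : State → Prop}
    (h : Ends p S c Q) (hc : c ≤ c') (hQ : ∀ S', Q S' → Q' S') : Ends p S c' Q' := by
  obtain ⟨T, S', h₁, h₂, h₃⟩ := h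
  exact ⟨T, S', h₁, h₂.trans hc, hQ _ h₃⟩

theorem Ends.seq {p q : Prog} {S : State} {c₁ c₂ c : ℕ} {Q : State → Prop}
    (h : Ends p S c₁ (fun S' => Ends q S' c₂ Q)) (hc : c₁ + c₂ ≤ c) : Ends (.seq p q) S c Q := by
  obtain ⟨T, S', h₁, h₂, T', S'', h₃, h₄, h₅⟩ := h
  exact ⟨T + T', S'', .seq h₁ h₃, by omega, h₅⟩

theorem Ends.ite {b : BExp} {p q : Prog} {S : State} {c₁ c₂ c : ℕ} {Q : State → Prop}
    (h₁ : b.eval S = true → Ends p S c₁ Q) (h₂ : b.eval S = false → Ends q S c₂ Q)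
    (hc₁ : b.eval S = true → b.cost + 1 + c₁ ≤ c)
    (hc₂ : b.eval S = false → b.cost + 1 + c₂ ≤ c) : Ends (.ite b p q) S c Q := by
  cases hb : b.eval S
  · obtain ⟨T, S', h, hT, hQ⟩ := h₂ hb
    exact ⟨_, S', .iteFalse hb h, by have := hc₂ hb; omega, hQ⟩
  · obtain ⟨T, S', h, hT, hQ⟩ := h₁ hb
    exact ⟨_, S', .iteTrue hb h, by have := hc₁ hb; omega, hQ⟩

/-- The invariant of a loop refers to the time that is left; this time is also the variant. -/
theorem Ends.loop {b : BExp} {p : Prog} {Q : State → Prop} (Inv : ℕ → State → Prop)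
    (h : ∀ c S, Inv c S →
      (b.eval S = false ∧ b.cost + 1 ≤ c ∧ Q S) ∨
      (b.eval S = true ∧ ∃ c₁ c₂, b.cost + 1 + c₁ + c₂ ≤ c ∧ Ends p S c₁ (Inv c₂)))
    {c : ℕ} {S : State} (hS : Inv c S) : Ends (.loop b p) S c Q := by
  induction c using Nat.strong_induction_on generalizing S with
  | _ c ih =>
    rcases h c S hS with ⟨hb, hc, hQ⟩ | ⟨hb, c₁, c₂, hc, T, S', hE, hT, hI⟩
    · exact ⟨_, S, .loopDone hb, hc, hQ⟩
    · obtain ⟨T', S'', hE', hT', hQ⟩ := ih c₂ (by omega) hI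
      exact ⟨_, S'', .loopStep hb hE hE', by omega, hQ⟩

/-! ### Loop-free programs -/

/-- Whether a program contains no loop. -/
def Prog.loopFree : Prog → Bool
  | .seq p q => p.loopFree && q.loopFree
  | .ite _ p q => p.loopFree && q.loopFree
  | .loop _ _ => false
  | _ => true

/-- A bound on the running time of a loop-free program. -/
def Prog.maxTime : Prog → ℕ
  | .skip => 1
  | .setI _ e => e.cost + 1
  | .storeI _ i e => i.cost + e.cost + 1
  | .setQ _ e => e.cost + 1
  | .storeQ _ i e => i.cost + e.cost + 1
  | .seq p q => p.maxTime + q.maxTime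
  | .ite b p q => b.cost + 1 + (p.maxTime + q.maxTime)
  | .loop _ _ => 0

/-- The effect of a loop-free program. -/
def Prog.run : Prog → State → State
  | .skip, S => S
  | .setI x e, S => S.setI x (e.eval S)
  | .storeI a i e, S => S.storeI a (i.eval S) (e.eval S)
  | .setQ x e, S => S.setQ x (e.eval S)
  | .storeQ a i e, S => S.storeQ a (i.eval S) (e.eval S)
  | .seq p q, S => q.run (p.run S)
  | .ite b p q, S => if b.eval S = true then p.run S else q.run S
  | .loop _ _, S => S

/-- Turns straight-line code into a computation: the final state is the value of the function `run`,
which `simp` can evaluate. The time bound charges both branches of a conditional, which loses only a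
constant. -/
theorem Ends.block {p : Prog} {S : State} {c : ℕ} {Q : State → Prop} (hp : p.loopFree = true)
    (hQ : Q (p.run S)) (hc : p.maxTime ≤ c) : Ends p S c Q := by
  suffices h : Ends p S p.maxTime (fun S' => S' = p.run S) from
    h.mono hc fun S' hS' => hS' ▸ hQ
  clear hQ hc
  induction p generalizing S with
  | skip => exact ⟨_, _, .skip S, le_rfl, rfl⟩
  | setI x e => exact ⟨_, _, .setI S x e, le_rfl, rfl⟩
  | storeI a i e => exact ⟨_, _, .storeI S a i e, le_rfl, rfl⟩
  | setQ x e => exact ⟨_, _, .setQ S x e, le_rfl, rfl⟩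
  | storeQ a i e => exact ⟨_, _, .storeQ S a i e, le_rfl, rfl⟩
  | seq p q ihp ihq =>
    simp only [Prog.loopFree, Bool.and_eq_true] at hp
    exact Ends.seq ((ihp hp.1).mono le_rfl fun S' hS' => hS' ▸ ihq hp.2) le_rfl
  | ite b p q ihp ihq =>
    simp only [Prog.loopFree, Bool.and_eq_true] at hp
    refine Ends.ite (c₁ := p.maxTime) (c₂ := q.maxTime)
      (fun hb => (ihp hp.1).mono le_rfl fun S' hS' => ?_)
      (fun hb => (ihq hp.2).mono le_rfl fun S' hS' => ?_) ?_ ?_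
    · simp [hS', Prog.run, hb]
    · simp [hS', Prog.run, hb]
    · intro; simp only [Prog.maxTime]; omega
    · intro; simp only [Prog.maxTime]; omega
  | loop b p => simp [Prog.loopFree] at hp

/-! ### Memory updates -/

section Updates

variable (S : State) (x y i j a b v : ℕ) (q : ℚ)

@[simp] theorem State.setI_ireg : (S.setI x v).ireg y = if y = x then v else S.ireg y := by
  simp [State.setI, Function.update_apply]
@[simp] theorem State.setI_iarr : (S.setI x v).iarr = S.iarr := rfl
@[simp] theorem State.setI_qreg : (S.setI x v).qreg = S.qreg := rfl
@[simp] theorem State.setI_qarr : (S.setI x v).qarr = S.qarr := rfl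
@[simp] theorem State.setQ_qreg : (S.setQ x q).qreg y = if y = x then q else S.qreg y := by
  simp [State.setQ, Function.update_apply]
@[simp] theorem State.setQ_ireg : (S.setQ x q).ireg = S.ireg := rfl
@[simp] theorem State.setQ_iarr : (S.setQ x q).iarr = S.iarr := rfl
@[simp] theorem State.setQ_qarr : (S.setQ x q).qarr = S.qarr := rfl
@[simp] theorem State.storeI_iarr :
    (S.storeI a i v).iarr b j = if b = a then (if j = i then v else S.iarr b j)
      else S.iarr b j := by
  by_cases h : b = a
  · subst h; simp [State.storeI, Function.update_apply]
  · simp [State.storeI, h]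
@[simp] theorem State.storeI_ireg : (S.storeI a i v).ireg = S.ireg := rfl
@[simp] theorem State.storeI_qreg : (S.storeI a i v).qreg = S.qreg := rfl
@[simp] theorem State.storeI_qarr : (S.storeI a i v).qarr = S.qarr := rfl
@[simp] theorem State.storeQ_qarr :
    (S.storeQ a i q).qarr b j = if b = a then (if j = i then q else S.qarr b j)
      else S.qarr b j := by
  by_cases h : b = a
  · subst h; simp [State.storeQ, Function.update_apply]
  · simp [State.storeQ, h]
@[simp] theorem State.storeQ_ireg : (S.storeQ a i q).ireg = S.ireg := rfl
@[simp] theorem State.storeQ_iarr : (S.storeQ a i q).iarr = S.iarr := rfl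
@[simp] theorem State.storeQ_qreg : (S.storeQ a i q).qreg = S.qreg := rfl

@[simp] theorem State.ite_ireg (c : Prop) [Decidable c] (S' : State) :
    (if c then S else S').ireg x = if c then S.ireg x else S'.ireg x := by split_ifs <;> rfl
@[simp] theorem State.ite_iarr (c : Prop) [Decidable c] (S' : State) :
    (if c then S else S').iarr a i = if c then S.iarr a i else S'.iarr a i := by split_ifs <;> rfl
@[simp] theorem State.ite_qreg (c : Prop) [Decidable c] (S' : State) :
    (if c then S else S').qreg x = if c then S.qreg x else S'.qreg x := by split_ifs <;> rfl
@[simp] theorem State.ite_qarr (c : Prop) [Decidable c] (S' : State) :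
    (if c then S else S').qarr a i = if c then S.qarr a i else S'.qarr a i := by split_ifs <;> rfl

end Updates

/-! ### Frames -/

/-- Whether a program contains an assignment to the index register `x`. -/
def Prog.writesIreg (x : ℕ) : Prog → Bool
  | .setI y _ => y == x
  | .seq p q => p.writesIreg x || q.writesIreg x
  | .ite _ p q => p.writesIreg x || q.writesIreg x
  | .loop _ p => p.writesIreg x
  | _ => false

/-- Whether a program contains an assignment to the index array `a`. -/
def Prog.writesIarr (a : ℕ) : Prog → Bool
  | .storeI b _ _ => b == a
  | .seq p q => p.writesIarr a || q.writesIarr a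
  | .ite _ p q => p.writesIarr a || q.writesIarr a
  | .loop _ p => p.writesIarr a
  | _ => false

/-- Whether a program contains an assignment to the number register `x`. -/
def Prog.writesQreg (x : ℕ) : Prog → Bool
  | .setQ y _ => y == x
  | .seq p q => p.writesQreg x || q.writesQreg x
  | .ite _ p q => p.writesQreg x || q.writesQreg x
  | .loop _ p => p.writesQreg x
  | _ => false

/-- Whether a program contains an assignment to the number array `a`. -/
def Prog.writesQarr (a : ℕ) : Prog → Bool
  | .storeQ b _ _ => b == a
  | .seq p q => p.writesQarr a || q.writesQarr a
  | .ite _ p q => p.writesQarr a || q.writesQarr a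
  | .loop _ p => p.writesQarr a
  | _ => false

/-- `S` and `S'` differ at most in registers and arrays to which `p` assigns. -/
structure Frame (p : Prog) (S S' : State) : Prop where
  ireg : ∀ x, p.writesIreg x = false → S'.ireg x = S.ireg x
  iarr : ∀ a, p.writesIarr a = false → S'.iarr a = S.iarr a
  qreg : ∀ x, p.writesQreg x = false → S'.qreg x = S.qreg x
  qarr : ∀ a, p.writesQarr a = false → S'.qarr a = S.qarr a

theorem Frame.refl (p : Prog) (S : State) : Frame p S S :=
  ⟨fun _ _ => rfl, fun _ _ => rfl, fun _ _ => rfl, fun _ _ => rfl⟩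

theorem Frame.trans {p : Prog} {S S' S'' : State} (h : Frame p S S') (h' : Frame p S' S'') :
    Frame p S S'' :=
  ⟨fun x hx => (h'.ireg x hx).trans (h.ireg x hx), fun x hx => (h'.iarr x hx).trans (h.iarr x hx),
    fun x hx => (h'.qreg x hx).trans (h.qreg x hx), fun x hx => (h'.qarr x hx).trans (h.qarr x hx)⟩

theorem Frame.seq_left {p q : Prog} {S S' : State} (h : Frame p S S') : Frame (.seq p q) S S' :=
  ⟨fun x hx => h.ireg x (by simp_all [Prog.writesIreg]),
    fun x hx => h.iarr x (by simp_all [Prog.writesIarr]),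
    fun x hx => h.qreg x (by simp_all [Prog.writesQreg]),
    fun x hx => h.qarr x (by simp_all [Prog.writesQarr])⟩

theorem Frame.seq_right {p q : Prog} {S S' : State} (h : Frame q S S') : Frame (.seq p q) S S' :=
  ⟨fun x hx => h.ireg x (by simp_all [Prog.writesIreg]),
    fun x hx => h.iarr x (by simp_all [Prog.writesIarr]),
    fun x hx => h.qreg x (by simp_all [Prog.writesQreg]),
    fun x hx => h.qarr x (by simp_all [Prog.writesQarr])⟩

theorem Frame.loop {b : BExp} {p : Prog} {S S' : State} (h : Frame p S S') :
    Frame (.loop b p) S S' :=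
  ⟨fun x hx => h.ireg x hx, fun x hx => h.iarr x hx, fun x hx => h.qreg x hx,
    fun x hx => h.qarr x hx⟩

/-- Which cells a program may change is read off its text by a Boolean function. For a concrete
program the side conditions of `Frame` are thus closed by `rfl`, and invariants need to mention only
what changes. -/
theorem Exec.frame {p : Prog} {S S' : State} {T : ℕ} (h : Exec p S T S') : Frame p S S' := by
  induction h with
  | skip => exact .refl _ _
  | setI S x e =>
    refine ⟨fun y hy => ?_, fun _ _ => rfl, fun _ _ => rfl, fun _ _ => rfl⟩
    simp only [Prog.writesIreg, beq_eq_false_iff_ne] at hy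
    simp [hy.symm]
  | storeI S a i e =>
    refine ⟨fun _ _ => rfl, fun y hy => ?_, fun _ _ => rfl, fun _ _ => rfl⟩
    simp only [Prog.writesIarr, beq_eq_false_iff_ne] at hy
    funext j
    simp [hy.symm]
  | setQ S x e =>
    refine ⟨fun _ _ => rfl, fun _ _ => rfl, fun y hy => ?_, fun _ _ => rfl⟩
    simp only [Prog.writesQreg, beq_eq_false_iff_ne] at hy
    simp [hy.symm]
  | storeQ S a i e =>
    refine ⟨fun _ _ => rfl, fun _ _ => rfl, fun _ _ => rfl, fun y hy => ?_⟩
    simp only [Prog.writesQarr, beq_eq_false_iff_ne] at hy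
    funext j
    simp [hy.symm]
  | seq _ _ ih₁ ih₂ => exact ih₁.seq_left.trans ih₂.seq_right
  | iteTrue _ _ ih =>
    exact ⟨fun x hx => ih.ireg x (by simp_all [Prog.writesIreg]),
      fun x hx => ih.iarr x (by simp_all [Prog.writesIarr]),
      fun x hx => ih.qreg x (by simp_all [Prog.writesQreg]),
      fun x hx => ih.qarr x (by simp_all [Prog.writesQarr])⟩
  | iteFalse _ _ ih =>
    exact ⟨fun x hx => ih.ireg x (by simp_all [Prog.writesIreg]),
      fun x hx => ih.iarr x (by simp_all [Prog.writesIarr]),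
      fun x hx => ih.qreg x (by simp_all [Prog.writesQreg]),
      fun x hx => ih.qarr x (by simp_all [Prog.writesQarr])⟩
  | loopDone => exact .refl _ _
  | loopStep _ _ _ ih₁ ih₂ => exact ih₁.loop.trans ih₂

theorem Ends.frame {p : Prog} {S : State} {c : ℕ} {Q : State → Prop} (h : Ends p S c Q) :
    Ends p S c (fun S' => Frame p S S' ∧ Q S') := by
  obtain ⟨T, S', h₁, h₂, h₃⟩ := h
  exact ⟨T, S', h₁, h₂, h₁.frame, h₃⟩

theorem frame_setI {p : Prog} {x : ℕ} (h : p.writesIreg x = true) (S : State) (v : ℕ) :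
    Frame p S (S.setI x v) := by
  refine ⟨fun y hy => ?_, fun _ _ => rfl, fun _ _ => rfl, fun _ _ => rfl⟩
  have : y ≠ x := by rintro rfl; simp [h] at hy
  simp [this]

/-! ### Counting loops -/

/-- `for x = 0, …, hi - 1 do body`. -/
def Prog.forTo (x hi : ℕ) (body : Prog) : Prog :=
  .seq (.setI x (.const 0)) (.loop (.lt (.reg x) (.reg hi))
    (.seq body (.setI x (.add (.reg x) (.const 1)))))

/-- The invariant of a counting loop may refer to the time that is left. -/
theorem Ends.forTo_budget {x hi : ℕ} {body : Prog} {S : State} {N c c₀ : ℕ} {Q : State → Prop}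
    (Inv : ℕ → ℕ → State → Prop) (hN : S.ireg hi = N)
    (hx : body.writesIreg x = false) (hhi : body.writesIreg hi = false) (hne : hi ≠ x)
    (hInv : ∀ i c S v, Inv i c S → Inv i c (S.setI x v)) (h0 : Inv 0 c₀ S)
    (hstep : ∀ i c S', i < N → S'.ireg x = i → Frame (Prog.forTo x hi body) S S' → Inv i c S' →
      ∃ c₁ c₂, c₁ + c₂ + 8 ≤ c ∧ Ends body S' c₁ (Inv (i + 1) c₂))
    (hQ : ∀ c S', Frame (Prog.forTo x hi body) S S' → Inv N c S' → Q S') (hc : c₀ + 6 ≤ c) :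
    Ends (Prog.forTo x hi body) S c Q := by
  have hwx : (Prog.forTo x hi body).writesIreg x = true := by simp [Prog.forTo, Prog.writesIreg]
  have hwhi : (Prog.forTo x hi body).writesIreg hi = false := by
    simp [Prog.forTo, Prog.writesIreg, hhi, hne.symm]
  refine Ends.seq (c₁ := 2) (c₂ := c₀ + 4) (Ends.block rfl ?_ le_rfl) (by omega)
  refine Ends.loop (fun c S' => ∃ i c', i ≤ N ∧ S'.ireg x = i ∧
    Frame (Prog.forTo x hi body) S S' ∧ Inv i c' S' ∧ c' + 4 = c) ?_
    ⟨0, c₀, Nat.zero_le _, by simp [Prog.run, IExp.eval], frame_setI hwx _ _, hInv _ _ _ _ h0, rfl⟩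
  rintro c' S' ⟨i, c'', hi', hxi, hF, hI, hc'⟩
  have hhi' : S'.ireg hi = N := (hF.ireg _ hwhi).trans hN
  rcases hi'.eq_or_lt with rfl | hlt
  · exact Or.inl ⟨by simp [BExp.eval, IExp.eval, hxi, hhi'],
      by simp [BExp.cost, IExp.cost]; omega, hQ _ _ hF hI⟩
  · right
    obtain ⟨c₁, c₂, hcc, hE⟩ := hstep i c'' S' hlt hxi hF hI
    refine ⟨by simp [BExp.eval, IExp.eval, hxi, hhi', hlt], c₁ + 4, c₂ + 4,
      by simp only [BExp.cost, IExp.cost]; omega, ?_⟩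
    refine Ends.seq (c₁ := c₁) (c₂ := 4)
      (hE.frame.mono le_rfl fun S'' ⟨hF', hI'⟩ => ?_) le_rfl
    have hxi' : S''.ireg x = i := (hF'.ireg _ hx).trans hxi
    have hev : (Prog.setI x (.add (.reg x) (.const 1))).run S'' = S''.setI x (i + 1) := by
      simp [Prog.run, IExp.eval, hxi']
    refine Ends.block rfl ?_ (by simp [Prog.maxTime, IExp.cost])
    rw [hev]
    exact ⟨i + 1, c₂, hlt, by simp,
      hF.trans ((hF'.seq_left.loop.seq_right).trans (frame_setI hwx _ _)), hInv _ _ _ _ hI', by rfl⟩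

theorem Ends.forTo {x hi : ℕ} {body : Prog} {S : State} {N c : ℕ} {Q : State → Prop}
    (Inv : ℕ → State → Prop) (cost : ℕ → ℕ) (hN : S.ireg hi = N)
    (hx : body.writesIreg x = false) (hhi : body.writesIreg hi = false) (hne : hi ≠ x)
    (hInv : ∀ i S v, Inv i S → Inv i (S.setI x v)) (h0 : Inv 0 S)
    (hstep : ∀ i S', i < N → S'.ireg x = i → Frame (Prog.forTo x hi body) S S' → Inv i S' →
      Ends body S' (cost i) (Inv (i + 1)))
    (hQ : ∀ S', Frame (Prog.forTo x hi body) S S' → Inv N S' → Q S')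
    (hc : ∑ i ∈ Finset.range N, (cost i + 8) + 6 ≤ c) :
    Ends (Prog.forTo x hi body) S c Q := by
  -- The time left is the cost of the iterations still to come. Each has an overhead of 8: 4 for the
  -- test and 4 for the increment; initialisation and the final test account for the 6.
  refine Ends.forTo_budget (c₀ := ∑ i ∈ Finset.range N, (cost i + 8))
    (fun i c S' => Inv i S' ∧ ∑ k ∈ Finset.Ico i N, (cost k + 8) ≤ c) hN hx hhi hne
    (fun i c S v h => ⟨hInv i S v h.1, h.2⟩) ⟨h0, by simp⟩ ?_
    (fun c S' hF h => hQ S' hF h.1) hc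
  rintro i c S' hi hxi hF ⟨hI, hc'⟩
  rw [Finset.sum_eq_sum_Ico_succ_bot hi] at hc'
  exact ⟨cost i, ∑ k ∈ Finset.Ico (i + 1) N, (cost k + 8), by omega,
    (hstep i S' hi hxi hF hI).mono le_rfl fun S'' h => ⟨h, le_rfl⟩⟩

/-- `for j = lo, …, hi - 1 do (w := a[j]; body)`. -/
def Prog.forSlice (j w a : ℕ) (lo hi : IExp) (body : Prog) : Prog :=
  .seq (.setI j lo) (.loop (.lt (.reg j) hi)
    (.seq (.setI w (.arr a (.reg j))) (.seq body (.setI j (.add (.reg j) (.const 1))))))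

/-- The array slice is read as a list, and the invariant is indexed by the prefix already seen. The
upper bound is evaluated anew at each test, so its value is required in every state that the loop
can reach; the overhead `hi.cost + 10` pays for the test, the load and the increment. -/
theorem Ends.forSlice {n j w a : ℕ} {lo hi : IExp} {body : Prog} {S : State} {b c : ℕ}
    {Q : State → Prop} (l : List (Fin n)) (Inv : List (Fin n) → State → Prop) (cost : Fin n → ℕ)
    (hlo : lo.eval S = b)
    (hhi : ∀ S', Frame (Prog.forSlice j w a lo hi body) S S' → hi.eval S' = b + l.length)
    (ha : body.writesIarr a = false)
    (hl : ∀ k (hk : k < l.length), S.iarr a (b + k) = (l[k] : ℕ))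
    (hj : body.writesIreg j = false) (hne : w ≠ j)
    (hInv : ∀ l' S x v, x = j ∨ x = w → Inv l' S → Inv l' (S.setI x v)) (h0 : Inv [] S)
    (hstep : ∀ l₁ (u : Fin n) l₂ S', l = l₁ ++ u :: l₂ → S'.ireg w = (u : ℕ) →
      Frame (Prog.forSlice j w a lo hi body) S S' → Inv l₁ S' →
      Ends body S' (cost u) (Inv (l₁ ++ [u])))
    (hQ : ∀ S', Frame (Prog.forSlice j w a lo hi body) S S' → Inv l S' → Q S')
    (hc : (l.map (fun u => cost u + (hi.cost + 10))).sum + (lo.cost + hi.cost + 4) ≤ c) :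
    Ends (Prog.forSlice j w a lo hi body) S c Q := by
  have hwj : (Prog.forSlice j w a lo hi body).writesIreg j = true := by
    simp [Prog.forSlice, Prog.writesIreg]
  have hww : (Prog.forSlice j w a lo hi body).writesIreg w = true := by
    simp [Prog.forSlice, Prog.writesIreg]
  have hwa : (Prog.forSlice j w a lo hi body).writesIarr a = false := by
    simp [Prog.forSlice, Prog.writesIarr, ha]
  refine Ends.seq (c₁ := lo.cost + 1)
    (c₂ := (l.map (fun u => cost u + (hi.cost + 10))).sum + (hi.cost + 3))
    (Ends.block rfl ?_ le_rfl) (by omega)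
  refine Ends.loop (fun c S' => ∃ l₁ l₂, l = l₁ ++ l₂ ∧ S'.ireg j = b + l₁.length ∧
    Frame (Prog.forSlice j w a lo hi body) S S' ∧ Inv l₁ S' ∧
    (l₂.map (fun u => cost u + (hi.cost + 10))).sum + (hi.cost + 3) = c) ?_
    ⟨[], l, rfl, by simp [Prog.run, hlo], frame_setI hwj _ _, hInv _ _ _ _ (.inl rfl) h0, by simp⟩
  rintro c' S' ⟨l₁, l₂, rfl, hj', hF, hI, hc'⟩
  have hhi' := hhi S' hF
  cases l₂ with
  | nil =>
    simp only [List.append_nil] at *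
    exact Or.inl ⟨by simp [BExp.eval, IExp.eval, hj', hhi'],
      by simp only [BExp.cost, IExp.cost, List.map_nil, List.sum_nil] at hc' ⊢; omega, hQ _ hF hI⟩
  | cons u l₂ =>
    right
    simp only [List.map_cons, List.sum_cons] at hc'
    refine ⟨by simp [BExp.eval, IExp.eval, hj', hhi'], cost u + 7,
      (l₂.map (fun u => cost u + (hi.cost + 10))).sum + (hi.cost + 3),
      by simp only [BExp.cost, IExp.cost]; omega, ?_⟩
    have hu : S'.iarr a (b + l₁.length) = u := by
      rw [hF.iarr a hwa, hl l₁.length (by simp)]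
      simp
    refine Ends.seq (c₁ := 3) (c₂ := cost u + 4) (Ends.block rfl ?_ le_rfl) (by omega)
    have hev : (Prog.setI w (.arr a (.reg j))).run S' = S'.setI w u := by
      simp [Prog.run, IExp.eval, hj', hu]
    rw [hev]
    have hF₁ := hF.trans (frame_setI hww S' u)
    refine Ends.seq (c₁ := cost u) (c₂ := 4)
      ((hstep l₁ u l₂ _ rfl (by simp) hF₁ (hInv _ _ _ _ (.inr rfl) hI)).frame.mono le_rfl
        fun S'' ⟨hF', hI'⟩ => ?_) le_rfl
    have hj'' : S''.ireg j = b + l₁.length := by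
      rw [hF'.ireg _ hj]; simp [hne.symm, hj']
    have hev : (Prog.setI j (.add (.reg j) (.const 1))).run S'' =
        S''.setI j (b + l₁.length + 1) := by
      simp [Prog.run, IExp.eval, hj'']
    refine Ends.block rfl ?_ (by simp [Prog.maxTime, IExp.cost])
    rw [hev]
    exact ⟨l₁ ++ [u], l₂, by simp, by simp [add_assoc],
      hF₁.trans ((hF'.seq_left.seq_right.loop.seq_right).trans (frame_setI hwj _ _)),
      hInv _ _ _ _ (.inl rfl) hI', by rfl⟩

/-- `for j = hi - 1, …, lo do (w := a[j]; body)`. -/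
def Prog.forSliceRev (j w a : ℕ) (lo hi : IExp) (body : Prog) : Prog :=
  .seq (.setI j hi) (.loop (.lt lo (.reg j))
    (.seq (.setI j (.sub (.reg j) (.const 1))) (.seq (.setI w (.arr a (.reg j))) body)))

theorem Ends.forSliceRev {n j w a : ℕ} {lo hi : IExp} {body : Prog} {S : State} {b c : ℕ}
    {Q : State → Prop} (l : List (Fin n)) (Inv : List (Fin n) → State → Prop) (cost : Fin n → ℕ)
    (hlo : ∀ S', Frame (Prog.forSliceRev j w a lo hi body) S S' → lo.eval S' = b)
    (hhi : hi.eval S = b + l.length)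
    (ha : body.writesIarr a = false)
    (hl : ∀ k (hk : k < l.length), S.iarr a (b + k) = (l[k] : ℕ))
    (hj : body.writesIreg j = false) (hne : w ≠ j)
    (hInv : ∀ l' S x v, x = j ∨ x = w → Inv l' S → Inv l' (S.setI x v)) (h0 : Inv [] S)
    (hstep : ∀ l₁ (u : Fin n) l₂ S', l = l₁ ++ u :: l₂ → S'.ireg w = (u : ℕ) →
      Frame (Prog.forSliceRev j w a lo hi body) S S' → Inv l₂ S' →
      Ends body S' (cost u) (Inv (u :: l₂)))
    (hQ : ∀ S', Frame (Prog.forSliceRev j w a lo hi body) S S' → Inv l S' → Q S')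
    (hc : (l.map (fun u => cost u + (lo.cost + 10))).sum + (lo.cost + hi.cost + 4) ≤ c) :
    Ends (Prog.forSliceRev j w a lo hi body) S c Q := by
  have hwj : (Prog.forSliceRev j w a lo hi body).writesIreg j = true := by
    simp [Prog.forSliceRev, Prog.writesIreg]
  have hww : (Prog.forSliceRev j w a lo hi body).writesIreg w = true := by
    simp [Prog.forSliceRev, Prog.writesIreg]
  have hwa : (Prog.forSliceRev j w a lo hi body).writesIarr a = false := by
    simp [Prog.forSliceRev, Prog.writesIarr, ha]
  refine Ends.seq (c₁ := hi.cost + 1)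
    (c₂ := (l.map (fun u => cost u + (lo.cost + 10))).sum + (lo.cost + 3))
    (Ends.block rfl ?_ le_rfl) (by omega)
  refine Ends.loop (fun c S' => ∃ l₁ l₂, l = l₁ ++ l₂ ∧ S'.ireg j = b + l₁.length ∧
    Frame (Prog.forSliceRev j w a lo hi body) S S' ∧ Inv l₂ S' ∧
    (l₁.map (fun u => cost u + (lo.cost + 10))).sum + (lo.cost + 3) = c) ?_
    ⟨l, [], by simp, by simp [Prog.run, hhi], frame_setI hwj _ _, hInv _ _ _ _ (.inl rfl) h0,
      by simp⟩
  rintro c' S' ⟨l₁, l₂, rfl, hj', hF, hI, hc'⟩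
  have hlo' := hlo S' hF
  rcases List.eq_nil_or_concat l₁ with rfl | ⟨l₁, u, rfl⟩
  · simp only [List.nil_append] at *
    exact Or.inl ⟨by simp [BExp.eval, IExp.eval, hj', hlo'],
      by simp only [BExp.cost, IExp.cost, List.map_nil, List.sum_nil] at hc' ⊢; omega, hQ _ hF hI⟩
  · right
    simp only [List.concat_eq_append, List.append_assoc, List.singleton_append, List.map_append,
      List.map_cons, List.map_nil, List.sum_append, List.sum_cons, List.sum_nil, List.length_append,
      List.length_cons, List.length_nil] at *
    refine ⟨by simp [BExp.eval, IExp.eval, hj', hlo'], cost u + 7,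
      (l₁.map (fun u => cost u + (lo.cost + 10))).sum + (lo.cost + 3),
      by simp only [BExp.cost, IExp.cost]; omega, ?_⟩
    have hu : S'.iarr a (b + l₁.length) = u := by
      rw [hF.iarr a hwa, hl l₁.length (by simp)]
      simp
    refine Ends.seq (c₁ := 4) (c₂ := cost u + 3) (Ends.block rfl ?_ le_rfl) (by omega)
    have hev : (Prog.setI j (.sub (.reg j) (.const 1))).run S' = S'.setI j (b + l₁.length) := by
      simp [Prog.run, IExp.eval, hj', ← add_assoc]
    rw [hev]
    refine Ends.seq (c₁ := 3) (c₂ := cost u) (Ends.block rfl ?_ le_rfl) (by omega)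
    have hev : (Prog.setI w (.arr a (.reg j))).run (S'.setI j (b + l₁.length)) =
        (S'.setI j (b + l₁.length)).setI w u := by
      simp [Prog.run, IExp.eval, hu]
    rw [hev]
    have hF₁ := (hF.trans (frame_setI hwj S' (b + l₁.length))).trans (frame_setI hww _ u)
    refine (hstep l₁ u l₂ _ rfl (by simp) hF₁
        (hInv _ _ _ _ (.inr rfl) (hInv _ _ _ _ (.inl rfl) hI))).frame.mono le_rfl
        fun S'' ⟨hF', hI'⟩ => ?_
    refine ⟨l₁, u :: l₂, rfl, ?_,
      hF₁.trans (hF'.seq_right.seq_right.loop.seq_right), hI', by rfl⟩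
    rw [hF'.ireg _ hj]; simp [hne.symm]

end RAM

/-! ### The combinatorics of shortest paths and maximal induced paths. -/

namespace BetwCent

/-! ### Counting shortest paths -/

section Counting

open scoped Classical

variable {V : Type*} [Fintype V] [DecidableEq V] {G : SimpleGraph V}

theorem sigma_eq_ncard (s t : V) :
    sigma G s t = ({p : G.Walk s t | p.length = G.dist s t}).ncard := by
  rw [sigma]
  congr 1
  ext p
  exact ⟨fun h => h.2, fun h => ⟨p.isPath_of_length_eq_dist h, h⟩⟩

/-- A walk as short as the distance is automatically a path, so shortest paths are counted by a
power of the adjacency matrix. Symmetry and the recursion over predecessors then become matrix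
identities. -/
theorem sigma_eq_pow (s t : V) : sigma G s t = (G.adjMatrix ℕ ^ G.dist s t) s t := by
  rw [SimpleGraph.adjMatrix_pow_apply_eq_card_walk, Nat.cast_id, sigma_eq_ncard,
    Set.ncard_eq_toFinset_card', Set.toFinset_card]

theorem adjMatrix_pow_eq_zero {k : ℕ} {s t : V} (h : k < G.dist s t) :
    (G.adjMatrix ℕ ^ k) s t = 0 := by
  rw [SimpleGraph.adjMatrix_pow_apply_eq_card_walk, Nat.cast_id, Fintype.card_eq_zero_iff]
  refine ⟨fun p => ?_⟩
  have h₁ := p.2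
  have := SimpleGraph.dist_le p.1
  simp only [Set.mem_ofPred_eq] at h₁
  omega

theorem sigma_comm (s t : V) : sigma G s t = sigma G t s := by
  rw [sigma_eq_pow, sigma_eq_pow, SimpleGraph.dist_comm, ← Matrix.transpose_apply (_ ^ _),
    Matrix.transpose_pow, SimpleGraph.transpose_adjMatrix]

theorem sigma_self (s : V) : sigma G s s = 1 := by
  simp [sigma_eq_pow]

theorem sigma_pos (hG : G.Connected) (s t : V) : 0 < sigma G s t := by
  rw [sigma_eq_pow, SimpleGraph.adjMatrix_pow_apply_eq_card_walk, Nat.cast_id, Fintype.card_pos_iff]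
  obtain ⟨p, hp⟩ := hG.exists_walk_length_eq_dist s t
  exact ⟨⟨p, hp⟩⟩

theorem dist_le_dist_add_one (hG : G.Connected) {u w : V} (h : G.Adj u w) (x : V) :
    G.dist x w ≤ G.dist x u + 1 := by
  have := hG.dist_triangle (u := x) (v := u) (w := w)
  rwa [SimpleGraph.dist_eq_one_iff_adj.mpr h] at this

/-- Expanding one factor of the matrix power sums over the last vertex before `v`. -/
theorem sigma_rec (hG : G.Connected) {x v : V} (h : x ≠ v) :
    sigma G x v = ∑ u, if G.Adj v u ∧ G.dist x u + 1 = G.dist x v then sigma G x u else 0 := by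
  have hpos := hG.pos_dist_of_ne h
  obtain ⟨k, hk⟩ : ∃ k, G.dist x v = k + 1 := ⟨G.dist x v - 1, by omega⟩
  rw [sigma_eq_pow, hk, pow_succ, Matrix.mul_apply]
  refine Finset.sum_congr rfl fun u _ => ?_
  rw [SimpleGraph.adjMatrix_apply]
  by_cases hA : G.Adj v u
  · have h₁ := dist_le_dist_add_one hG hA.symm x
    by_cases hd : G.dist x u = k
    · simp [hA, hA.symm, hd, sigma_eq_pow]
    -- A neighbour `u` of `v` that is not a predecessor has distance greater than `k`, so no walk of
    -- length `k` reaches it.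
    · rw [adjMatrix_pow_eq_zero (by omega)]
      simp [hd]
  · have : ¬ G.Adj u v := fun h => hA h.symm
    simp [hA, this]

theorem exists_adj_dist_add_one (hG : G.Connected) {x v : V} (h : x ≠ v) :
    ∃ u, G.Adj v u ∧ G.dist x u + 1 = G.dist x v := by
  by_contra! hcon
  have h₁ := sigma_rec hG h
  have h₂ := sigma_pos hG x v
  rw [Finset.sum_eq_zero] at h₁
  · omega
  · intro u _
    rw [if_neg]
    exact fun hu => hcon u hu.1 hu.2

/-- The number of shortest paths from `s` to `t` that contain `v`, endpoints included. -/
noncomputable def through (G : SimpleGraph V) (s t v : V) : ℕ :=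
  if G.dist s v + G.dist v t = G.dist s t then sigma G s v * sigma G v t else 0

theorem through_comm (s t v : V) : through G s t v = through G t s v := by
  rw [through, through, sigma_comm s v, sigma_comm v t, G.dist_comm (u := s) (v := v),
    G.dist_comm (u := v) (v := t), G.dist_comm (u := s) (v := t), add_comm, mul_comm]

theorem sigmaThrough_eq (s t v : V) :
    sigmaThrough G s t v = if v = s ∨ v = t then 0 else
      ({p : G.Walk s t | p.length = G.dist s t ∧ v ∈ p.support}).ncard := by
  rw [sigmaThrough]
  split_ifs
  · rfl
  · congr 1
    ext p
    exact ⟨fun h => h.2, fun h => ⟨p.isPath_of_length_eq_dist h.1, h⟩⟩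

/-- Cutting at `v` and concatenating are inverse bijections between shortest paths through `v` and
pairs of shortest paths. Unlike `sigmaThrough`, `through` also counts at endpoints; this is needed
when a path is entered at an end that is `v` itself. -/
theorem sigmaThrough_eq_through (hG : G.Connected) (s t v : V) :
    sigmaThrough G s t v = if v = s ∨ v = t then 0 else through G s t v := by
  rw [sigmaThrough_eq]
  split_ifs with h
  · rfl
  rw [through]
  have key : ∀ p : G.Walk s t, p.length = G.dist s t → v ∈ p.support →
      ∃ (p₁ : G.Walk s v) (p₂ : G.Walk v t), p₁.length = G.dist s v ∧ p₂.length = G.dist v t ∧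
        p = p₁.append p₂ ∧ G.dist s v + G.dist v t = G.dist s t := by
    intro p hp hv
    have h₁ := congrArg SimpleGraph.Walk.length (p.take_spec hv)
    rw [SimpleGraph.Walk.length_append] at h₁
    have h₂ := SimpleGraph.dist_le (p.takeUntil v hv)
    have h₃ := SimpleGraph.dist_le (p.dropUntil v hv)
    have h₄ := hG.dist_triangle (u := s) (v := v) (w := t)
    exact ⟨p.takeUntil v hv, p.dropUntil v hv, by omega, by omega, (p.take_spec hv).symm, by omega⟩
  split_ifs with hd
  · rw [sigma_eq_ncard, sigma_eq_ncard, ← Set.ncard_prod]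
    symm
    refine Set.ncard_congr (fun p _ => p.1.append p.2) ?_ ?_ ?_
    · rintro ⟨p₁, p₂⟩ ⟨h₁, h₂⟩
      simp only [Set.mem_ofPred_eq] at h₁ h₂
      simp [h₁, h₂, hd]
    · rintro ⟨p₁, p₂⟩ ⟨q₁, q₂⟩ ⟨h₁, h₂⟩ ⟨h₃, h₄⟩ he
      simp only [Set.mem_ofPred_eq] at h₁ h₂ h₃ h₄ he
      have hs := congrArg SimpleGraph.Walk.support he
      rw [SimpleGraph.Walk.support_append, SimpleGraph.Walk.support_append] at hs
      -- The first parts have equal length, so equal supports split at the same place.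
      have hs' := List.append_inj hs (by simp [h₁, h₃])
      have e₁ : p₁ = q₁ := SimpleGraph.Walk.ext_support hs'.1
      have e₂ : p₂ = q₂ := by
        refine SimpleGraph.Walk.ext_support ?_
        rw [← SimpleGraph.Walk.cons_tail_support p₂, ← SimpleGraph.Walk.cons_tail_support q₂, hs'.2]
      rw [e₁, e₂]
    · rintro p ⟨hp, hv⟩
      obtain ⟨p₁, p₂, h₁, h₂, rfl, -⟩ := key p hp hv
      exact ⟨(p₁, p₂), ⟨h₁, h₂⟩, rfl⟩
  · have : {p : G.Walk s t | p.length = G.dist s t ∧ v ∈ p.support} = ∅ := by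
      ext p
      simp only [Set.mem_ofPred_eq, Set.mem_empty_iff_false, iff_false]
      rintro ⟨hp, hv⟩
      obtain ⟨p₁, p₂, -, -, -, h₁⟩ := key p hp hv
      exact hd h₁
    rw [this, Set.ncard_empty]

theorem gamma_eq (hG : G.Connected) (pen : V → ℕ) (s t v : V) :
    gamma G pen s t v = if v = s ∨ v = t then 0 else
      (pen s : ℚ) * pen t * through G s t v / sigma G s t := by
  rw [gamma, sigmaThrough_eq_through hG]
  split_ifs <;> simp

theorem gamma_comm (hG : G.Connected) (pen : V → ℕ) (s t v : V) :
    gamma G pen s t v = gamma G pen t s v := by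
  rw [gamma_eq hG, gamma_eq hG, through_comm, sigma_comm, mul_comm (pen s : ℚ)]
  simp only [or_comm]

/-- The number of shortest paths from `v` to `s` if these extend a shortest path from `y` to `v`
to one from `y` to `s`. -/
noncomputable def onward (G : SimpleGraph V) (y v s : V) : ℕ :=
  if G.dist y v + G.dist v s = G.dist y s then sigma G v s else 0

/-- If `v` lies on a shortest path from `y` to `s`, the neighbours of `v` nearer to `s` are the
neighbours farther from `y` that lie on such a path themselves; if `v` does not, no successor of `v`
does either. -/
theorem onward_rec (hG : G.Connected) (y v s : V) :
    onward G y v s = (if v = s then 1 else 0) +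
      ∑ w, if G.Adj v w ∧ G.dist y w = G.dist y v + 1 then onward G y w s else 0 := by
  by_cases hvs : v = s
  · subst hvs
    rw [Finset.sum_eq_zero]
    · simp [onward, sigma_self]
    · intro w _
      rw [onward]
      split_ifs with h₁ h₂
      · omega
      · rfl
      · rfl
  · rw [if_neg hvs, zero_add, onward]
    split_ifs with hd
    · rw [sigma_comm, sigma_rec hG (Ne.symm hvs)]
      refine Finset.sum_congr rfl fun w _ => ?_
      by_cases hA : G.Adj v w
      · have h₁ := dist_le_dist_add_one hG hA y
        have h₂ := hG.dist_triangle (u := y) (v := w) (w := s)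
        rw [G.dist_comm (u := s), G.dist_comm (u := s)]
        simp only [hA, true_and, onward]
        split_ifs
        · exact sigma_comm _ _
        all_goals omega
      · simp [hA]
    · symm
      refine Finset.sum_eq_zero fun w _ => ?_
      rw [onward]
      split_ifs with h₁ h₂
      · have h₃ := hG.dist_triangle (u := y) (v := v) (w := s)
        have h₄ := dist_le_dist_add_one hG h₁.1.symm s
        rw [G.dist_comm (u := s), G.dist_comm (u := s)] at h₄
        omega
      · rfl
      · rfl

theorem through_eq_onward (y s v : V) : through G s y v = sigma G y v * onward G y v s := by
  rw [through_comm, through, onward]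
  split_ifs <;> simp

end Counting

end BetwCent

namespace BetwCent

/-! ### Distances and shortest paths along segments -/

section Segments

open scoped Classical

variable {V : Type*} [Fintype V] [DecidableEq V] {G : SimpleGraph V}

/-- The vertices `p 0, …, p l` form a walk that never turns back and can be left at its ends only. -/
structure IsSeg (G : SimpleGraph V) (p : ℕ → V) (l : ℕ) : Prop where
  adj : ∀ i, i < l → G.Adj (p i) (p (i + 1))
  nbr : ∀ i, i + 1 < l → ∀ w, G.Adj (p (i + 1)) w → w = p i ∨ w = p (i + 2)
  ne : ∀ i, i + 1 < l → p i ≠ p (i + 2)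

variable {p : ℕ → V} {l : ℕ}

theorem IsSeg.reverse (h : IsSeg G p l) : IsSeg G (fun i => p (l - i)) l where
  adj i hi := by
    have := (h.adj (l - (i + 1)) (by omega)).symm
    rwa [show l - (i + 1) + 1 = l - i by omega] at this
  nbr i hi w hw := by
    have := h.nbr (l - (i + 2)) (by omega) w
    rw [show l - (i + 2) + 1 = l - (i + 1) by omega, show l - (i + 2) + 2 = l - i by omega] at this
    exact (this hw).symm
  ne i hi := by
    have := h.ne (l - (i + 2)) (by omega)
    rw [show l - (i + 2) + 2 = l - i by omega] at this
    exact this.symm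

theorem IsSeg.dist_le_left (hG : G.Connected) (h : IsSeg G p l) (y : V) {i : ℕ} (hi : i ≤ l) :
    G.dist y (p i) ≤ G.dist y (p 0) + i := by
  induction i with
  | zero => simp
  | succ i ih =>
    have := dist_le_dist_add_one hG (h.adj i (by omega)) y
    have := ih (by omega)
    omega

theorem IsSeg.dist_le_right (hG : G.Connected) (h : IsSeg G p l) (y : V) {i : ℕ} (hi : i ≤ l) :
    G.dist y (p i) ≤ G.dist y (p l) + (l - i) := by
  have := h.reverse.dist_le_left hG y (i := l - i) (by omega)
  simpa [show l - (l - i) = i by omega] using this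

/-- The interior of the segment avoids `y`. -/
def Avoids (p : ℕ → V) (l : ℕ) (y : V) : Prop := ∀ i, 0 < i → i < l → p i ≠ y

theorem Avoids.reverse {y : V} (h : Avoids p l y) : Avoids (fun i => p (l - i)) l y :=
  fun i h₁ h₂ => h (l - i) (by omega) (by omega)

/-- Induction on the distance: an inner vertex differs from `y`, so it has a neighbour nearer to
`y`. This neighbour is again on the segment, which traces an optimal route back to an end. -/
theorem IsSeg.dist_cases (hG : G.Connected) (h : IsSeg G p l) {y : V} (hy : Avoids p l y) {i : ℕ}
    (hi : i ≤ l) : G.dist y (p i) = G.dist y (p 0) + i ∨ G.dist y (p i) = G.dist y (p l) + (l - i) := by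
  induction hm : G.dist y (p i) using Nat.strong_induction_on generalizing i with
  | _ m ih =>
    have h₁ := h.dist_le_left hG y hi
    have h₂ := h.dist_le_right hG y hi
    rcases Nat.eq_zero_or_pos i with rfl | hpos
    · omega
    rcases hi.eq_or_lt with rfl | hlt
    · omega
    obtain ⟨u, hu, hd⟩ := exists_adj_dist_add_one hG (hy i hpos hlt).symm
    have hn := h.nbr (i - 1) (by omega) u (by rwa [show i - 1 + 1 = i by omega])
    rw [show i - 1 + 2 = i + 1 by omega] at hn
    rcases hn with rfl | rfl
    · have := ih _ (by omega) (i := i - 1) (by omega) rfl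
      omega
    · have := ih _ (by omega) (i := i + 1) (by omega) rfl
      omega

theorem IsSeg.sigma_step (hG : G.Connected) (h : IsSeg G p l) {y : V} (hy : Avoids p l y) {i : ℕ}
    (h0 : 0 < i) (hi : i < l) : sigma G y (p i) =
      (if G.dist y (p (i - 1)) + 1 = G.dist y (p i) then sigma G y (p (i - 1)) else 0) +
      (if G.dist y (p (i + 1)) + 1 = G.dist y (p i) then sigma G y (p (i + 1)) else 0) := by
  obtain ⟨j, rfl⟩ : ∃ j, i = j + 1 := ⟨i - 1, by omega⟩
  rw [sigma_rec hG (hy _ h0 hi).symm]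
  simp only [Nat.add_sub_cancel]
  have hne := h.ne j hi
  have hsub : ∀ u, G.Adj (p (j + 1)) u ↔ u ∈ ({p j, p (j + 2)} : Finset V) := by
    intro u
    simp only [Finset.mem_insert, Finset.mem_singleton]
    refine ⟨h.nbr j hi u, ?_⟩
    rintro (rfl | rfl)
    · exact (h.adj j (by omega)).symm
    · exact h.adj (j + 1) hi
  simp only [hsub, ite_and]
  rw [Finset.sum_ite_mem, Finset.univ_inter, Finset.sum_pair hne]

/-- Inside the segment a shortest path runs straight from the end at which it entered. In the
induction on the distance, an inner predecessor on the left is reached optimally only from the left,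
so only the count of `p 0` passes on; likewise on the right. -/
theorem IsSeg.sigma_eq (hG : G.Connected) (h : IsSeg G p l) {y : V} (hy : Avoids p l y) {i : ℕ}
    (h0 : 0 < i) (hi : i < l) : sigma G y (p i) =
      (if G.dist y (p i) = G.dist y (p 0) + i then sigma G y (p 0) else 0) +
      (if G.dist y (p i) = G.dist y (p l) + (l - i) then sigma G y (p l) else 0) := by
  induction hm : G.dist y (p i) using Nat.strong_induction_on generalizing i with
  | _ m ih =>
    subst hm
    have c₁ := h.dist_cases hG hy (i := i) (by omega)
    have c₂ := h.dist_cases hG hy (i := i - 1) (by omega)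
    have c₃ := h.dist_cases hG hy (i := i + 1) (by omega)
    have b₁ := h.dist_le_left hG y (i := i) (by omega)
    have b₂ := h.dist_le_right hG y (i := i) (by omega)
    have b₃ := h.dist_le_left hG y (i := i - 1) (by omega)
    have b₄ := h.dist_le_right hG y (i := i - 1) (by omega)
    have b₅ := h.dist_le_left hG y (i := i + 1) (by omega)
    have b₆ := h.dist_le_right hG y (i := i + 1) (by omega)
    have e₁ : (if G.dist y (p (i - 1)) + 1 = G.dist y (p i) then sigma G y (p (i - 1)) else 0) =
        if G.dist y (p i) = G.dist y (p 0) + i then sigma G y (p 0) else 0 := by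
      by_cases hd : G.dist y (p (i - 1)) + 1 = G.dist y (p i)
      · rw [if_pos hd, if_pos (by omega)]
        rcases Nat.eq_zero_or_pos (i - 1) with h1 | h1
        · rw [h1]
        · rw [ih _ (by omega) h1 (by omega) rfl, if_pos (by omega), if_neg (by omega), add_zero]
      · rw [if_neg hd, if_neg (by omega)]
    have e₂ : (if G.dist y (p (i + 1)) + 1 = G.dist y (p i) then sigma G y (p (i + 1)) else 0) =
        if G.dist y (p i) = G.dist y (p l) + (l - i) then sigma G y (p l) else 0 := by
      by_cases hd : G.dist y (p (i + 1)) + 1 = G.dist y (p i)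
      · rw [if_pos hd, if_pos (by omega)]
        rcases (show i + 1 ≤ l by omega).eq_or_lt with h1 | h1
        · rw [h1]
        · rw [ih _ (by omega) (by omega) h1 rfl, if_neg (by omega), if_pos (by omega), zero_add]
      · rw [if_neg hd, if_neg (by omega)]
    rw [h.sigma_step hG hy h0 hi, e₁, e₂]

/-- A shortest path to an interior vertex enters the segment at one of its ends. -/
theorem IsSeg.through_eq (hG : G.Connected) (h : IsSeg G p l) {s v : V} (hs : Avoids p l s)
    (hv : Avoids p l v) {r : ℕ} (h0 : 0 < r) (hr : r < l) : through G s (p r) v =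
      (if G.dist s (p r) = G.dist s (p 0) + r then through G s (p 0) v else 0) +
      (if G.dist s (p r) = G.dist s (p l) + (l - r) then through G s (p l) v else 0) := by
  have c₁ := h.dist_cases hG hs (i := r) (by omega)
  have c₂ := h.dist_cases hG hv (i := r) (by omega)
  have b₁ := h.dist_le_left hG s (i := r) (by omega)
  have b₂ := h.dist_le_right hG s (i := r) (by omega)
  have b₃ := h.dist_le_left hG v (i := r) (by omega)
  have b₄ := h.dist_le_right hG v (i := r) (by omega)
  have t₁ := hG.dist_triangle (u := s) (v := v) (w := p 0)
  have t₂ := hG.dist_triangle (u := s) (v := v) (w := p l)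
  have t₃ := hG.dist_triangle (u := s) (v := v) (w := p r)
  simp only [through]
  by_cases hd : G.dist s v + G.dist v (p r) = G.dist s (p r)
  -- The segment is entered after `v`, so the paths from `v` to `p r` are split. By the triangle
  -- inequality, an end that is optimal for `v` is also optimal for `s` and is reached from `s`
  -- through `v`.
  · rw [if_pos hd, h.sigma_eq hG hv h0 hr, mul_add]
    congr 1
    · by_cases hb : G.dist v (p r) = G.dist v (p 0) + r
      · rw [if_pos hb, if_pos (by omega), if_pos (by omega)]
      · rw [if_neg hb, mul_zero]
        split_ifs
        · omega
        · rfl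
        · rfl
    · by_cases hb : G.dist v (p r) = G.dist v (p l) + (l - r)
      · rw [if_pos hb, if_pos (by omega), if_pos (by omega)]
      · rw [if_neg hb, mul_zero]
        split_ifs
        · omega
        · rfl
        · rfl
  · rw [if_neg hd]
    symm
    rw [Nat.add_eq_zero_iff]
    constructor
    · split_ifs
      · omega
      · rfl
      · rfl
    · split_ifs
      · omega
      · rfl
      · rfl

/-- A shortest path that enters the segment at an end does not traverse the segment before. -/
theorem IsSeg.through_left_eq_zero (hG : G.Connected) (h : IsSeg G p l) {s : V}
    (hs : Avoids p l s) (h0' : Avoids p l (p 0)) {r j : ℕ} (h0 : 0 < r) (hr : r < l) (hj : 0 < j)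
    (hjl : j < l) (hd : G.dist s (p r) = G.dist s (p 0) + r) : through G s (p 0) (p j) = 0 := by
  rw [through, if_neg]
  intro hthr
  -- A shortest path to `p 0` through `p j` would come from `p l`. Turning back to `p l` contradicts
  -- the triangle inequality, and running through the whole segment would make `p r` nearer from `p
  -- l` than `hd` allows.
  have c₁ := h.dist_cases hG hs (i := j) (by omega)
  have c₂ := h.dist_cases hG h0' (i := j) (by omega)
  have b₁ := h.dist_le_right hG s (i := r) (by omega)
  have t₁ := hG.dist_triangle (u := s) (v := p l) (w := p 0)
  rw [G.dist_comm (u := p j)] at hthr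
  rw [SimpleGraph.dist_self, G.dist_comm (u := p 0) (v := p l)] at c₂
  omega

theorem IsSeg.through_right_eq_zero (hG : G.Connected) (h : IsSeg G p l) {s : V}
    (hs : Avoids p l s) (hl' : Avoids p l (p l)) {r j : ℕ} (h0 : 0 < r) (hr : r < l) (hj : 0 < j)
    (hjl : j < l) (hd : G.dist s (p r) = G.dist s (p l) + (l - r)) :
    through G s (p l) (p j) = 0 := by
  have := h.reverse.through_left_eq_zero hG hs.reverse (by simpa using hl'.reverse)
    (r := l - r) (j := l - j)
  simp only [Nat.sub_zero, show l - (l - r) = r by omega, show l - (l - j) = j by omega] at this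
  exact this (by omega) (by omega) (by omega) (by omega) hd

/-- A shortest path starting outside does not leave the segment between two interior vertices. -/
theorem IsSeg.onward_eq_zero (hG : G.Connected) (h : IsSeg G p l) {y : V} (hy : Avoids p l y)
    {i r : ℕ} (hi : 0 < i) (hil : i < l) (h0 : 0 < r) (hr : r < l) {w : V} (hw : G.Adj (p i) w)
    (hw' : Avoids p l w) (hd : G.dist y w = G.dist y (p i) + 1) : onward G y w (p r) = 0 := by
  rw [onward, if_neg]
  intro hthr
  have hn := h.nbr (i - 1) (by omega) w (by rwa [show i - 1 + 1 = i by omega])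
  rw [show i - 1 + 2 = i + 1 by omega] at hn
  have c₁ := h.dist_cases hG hy (i := i) (by omega)
  have b₁ := h.dist_le_left hG y (i := r) (by omega)
  have b₂ := h.dist_le_right hG y (i := r) (by omega)
  -- The path leaves the segment at an end after crossing from the other end. At that moment the
  -- distance from `y` already exceeds the distance of every inner vertex.
  rcases hn with rfl | rfl
  · have : i = 1 := by
      by_contra hne
      exact hw' (i - 1) (by omega) (by omega) rfl
    subst this
    simp only [Nat.sub_self] at hd hthr
    omega
  · have : i + 1 = l := by
      by_contra hne
      exact hw' (i + 1) (by omega) (by omega) rfl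
    subst this
    omega

end Segments

end BetwCent

namespace BetwCent

/-! ### Degrees in biconnected graphs -/

theorem mem_of_reachable {V : Type*} {G : SimpleGraph V} {P : V → Prop}
    (hP : ∀ u v, P u → G.Adj u v → P v) {u v : V} (h : G.Reachable u v) (hu : P u) : P v := by
  obtain ⟨p⟩ := h
  induction p with
  | nil => exact hu
  | cons hadj _ ih => exact ih (hP _ _ hu hadj)

section AdjLists

variable {n : ℕ} {G : SimpleGraph (Fin n)} {nb : Fin n → List (Fin n)}

theorem degree_eq_length (hnb : IsAdjLists G nb) (v : Fin n) [Fintype (G.neighborSet v)] :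
    G.degree v = (nb v).length := by
  rw [← List.toFinset_card_of_nodup (hnb v).1, ← SimpleGraph.card_neighborFinset_eq_degree]
  congr 1
  ext w
  simp [(hnb v).2]

/-- Otherwise deleting `u` would isolate `v` from a third vertex. Applied twice, this yields minimum
degree two. -/
theorem exists_adj_ne (hB : IsBiconnected G) {u v : Fin n} (huv : v ≠ u) :
    ∃ w, G.Adj v w ∧ w ≠ u := by
  obtain ⟨x, hxu, hxv⟩ : ∃ x, x ≠ u ∧ x ≠ v := by
    by_contra! hcon
    have : (Finset.univ : Finset (Fin n)) ⊆ {u, v} := fun x _ => by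
      by_cases hx : x = u
      · simp [hx]
      · simp [hcon x hx]
    have := Finset.card_le_card this
    have h2 := Finset.card_le_two (a := u) (b := v)
    have h3 := hB.three_le_card
    rw [Fintype.card] at h3
    omega
  by_contra! hcon
  have hr := (hB.no_cut_vertex u).preconnected ⟨v, huv⟩ ⟨x, hxu⟩
  have := mem_of_reachable (P := fun z : {w | w ≠ u} => (z : Fin n) = v)
    (fun a b ha hab => by
    have h₁ : G.Adj a b := hab
    rw [ha] at h₁
    exact absurd (hcon _ h₁) b.2) hr rfl
  exact hxv this

theorem two_le_length (hB : IsBiconnected G) (hnb : IsAdjLists G nb) (v : Fin n) :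
    2 ≤ (nb v).length := by
  obtain ⟨u, huv⟩ : ∃ u, v ≠ u := by
    by_contra! hcon
    have h3 := hB.three_le_card
    have : Subsingleton (Fin n) := ⟨fun a b => (hcon a).symm.trans (hcon b)⟩
    have := Fintype.card_le_one_iff_subsingleton.mpr this
    omega
  obtain ⟨x, hx, -⟩ := exists_adj_ne hB huv
  obtain ⟨y, hy, hyx⟩ := exists_adj_ne hB hx.ne
  rw [← List.toFinset_card_of_nodup (hnb v).1, ← Finset.card_pair hyx]
  refine Finset.card_le_card fun z hz => ?_
  simp only [Finset.mem_insert, Finset.mem_singleton] at hz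
  rcases hz with rfl | rfl <;> simpa [(hnb v).2]

theorem eq_or_eq_of_adj (hnb : IsAdjLists G nb) {v x y : Fin n} (hv : (nb v).length = 2)
    (hx : G.Adj v x) (hy : G.Adj v y) (hxy : x ≠ y) {w : Fin n} (hw : G.Adj v w) :
    w = x ∨ w = y := by
  have hc : (nb v).toFinset.card = 2 := by rw [List.toFinset_card_of_nodup (hnb v).1, hv]
  have hsub : ({x, y} : Finset (Fin n)) ⊆ (nb v).toFinset := fun z hz => by
    simp only [Finset.mem_insert, Finset.mem_singleton] at hz
    rcases hz with rfl | rfl <;> simpa [(hnb v).2]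
  have heq := Finset.eq_of_subset_of_card_le hsub (by rw [hc, Finset.card_pair hxy])
  have : w ∈ (nb v).toFinset := by simpa [(hnb v).2]
  rw [← heq] at this
  simpa using this

/-! ### Following a path of vertices of degree two -/

/-- The first neighbour of `v` other than `u`. -/
def nextVert (nb : Fin n → List (Fin n)) (u v : Fin n) : Fin n :=
  if (nb v).getD 0 v = u then (nb v).getD 1 v else (nb v).getD 0 v

/-- The walk that starts with `a`, `w` and never turns back at a vertex of degree two. -/
def walkSeq (nb : Fin n → List (Fin n)) (a w : Fin n) : ℕ → Fin n
  | 0 => a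
  | 1 => w
  | i + 2 => nextVert nb (walkSeq nb a w i) (walkSeq nb a w (i + 1))

theorem nextVert_spec (hnb : IsAdjLists G nb) {u v : Fin n} (hv : (nb v).length = 2)
    (hu : G.Adj v u) : G.Adj v (nextVert nb u v) ∧ u ≠ nextVert nb u v := by
  obtain ⟨x, y, hxy⟩ := List.length_eq_two.mp hv
  have h₁ := (hnb v).1
  have h₂ := (hnb v).2
  rw [hxy] at h₁ h₂
  have hu' := (h₂ u).mpr hu
  simp only [List.nodup_cons, List.mem_cons, List.not_mem_nil, or_false] at *
  rw [nextVert, hxy]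
  simp only [List.getD_cons_zero, List.getD_cons_succ]
  rw [← h₂]
  split_ifs with h
  · subst h
    exact ⟨.inr rfl, h₁.1⟩
  · exact ⟨.inl rfl, Ne.symm h⟩

/-- `w` is a vertex of degree two next to a vertex `a` of another degree. -/
structure IsStart (G : SimpleGraph (Fin n)) (nb : Fin n → List (Fin n)) (a w : Fin n) : Prop where
  branch : (nb a).length ≠ 2
  adj : G.Adj a w
  two : (nb w).length = 2

variable {a w : Fin n}

theorem isSeg_walkSeq (hnb : IsAdjLists G nb) (hs : IsStart G nb a w) {M : ℕ}
    (hM : ∀ r, 0 < r → r < M → (nb (walkSeq nb a w r)).length = 2) :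
    IsSeg G (walkSeq nb a w) M := by
  have hadj : ∀ i, i < M → G.Adj (walkSeq nb a w i) (walkSeq nb a w (i + 1)) := by
    intro i
    induction i with
    | zero => exact fun _ => hs.adj
    | succ i ih =>
      intro hi
      exact (nextVert_spec hnb (hM (i + 1) (by omega) hi) (ih (by omega)).symm).1
  have hne : ∀ i, i + 1 < M → walkSeq nb a w i ≠ walkSeq nb a w (i + 2) := fun i hi =>
    (nextVert_spec hnb (hM (i + 1) (by omega) hi) (hadj i (by omega)).symm).2
  exact ⟨hadj, fun i hi w' hw' => eq_or_eq_of_adj hnb (hM (i + 1) (by omega) hi)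
    (hadj i (by omega)).symm (hadj (i + 1) hi) (hne i hi) hw', hne⟩

/-- From a coincidence of positions `i < j`, the vertex at `j - 1` is a neighbour of the one at `i`,
hence the one at `i - 1` or `i + 1`. This gives an earlier coincidence, a return to `a` at a
position of degree two, an immediate turn back, or a loop. The end `M` is included, so the walk
cannot run on for more than `n` steps. -/
theorem walkSeq_ne (hnb : IsAdjLists G nb) (hs : IsStart G nb a w) {M : ℕ}
    (hM : ∀ r, 0 < r → r < M → (nb (walkSeq nb a w r)).length = 2) {i j : ℕ} (hi : 0 < i)
    (hij : i < j) (hj : j ≤ M) : walkSeq nb a w i ≠ walkSeq nb a w j := by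
  have hseg := isSeg_walkSeq hnb hs hM
  induction j using Nat.strong_induction_on generalizing i with
  | _ j ih =>
    intro he
    have hadj : G.Adj (walkSeq nb a w j) (walkSeq nb a w (j - 1)) := by
      have := (hseg.adj (j - 1) (by omega)).symm
      rwa [show j - 1 + 1 = j by omega] at this
    rw [← he] at hadj
    have := hseg.nbr (i - 1) (by omega) (walkSeq nb a w (j - 1))
    rw [show i - 1 + 1 = i by omega, show i - 1 + 2 = i + 1 by omega] at this
    rcases this hadj with h | h
    · rcases Nat.eq_zero_or_pos (i - 1) with h1 | h1
      · rw [h1] at h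
        have h2 := hM (j - 1) (by omega) (by omega)
        rw [h] at h2
        exact hs.branch h2
      · exact ih (j - 1) (by omega) h1 (by omega) (by omega) h.symm
    · rcases lt_trichotomy (i + 1) (j - 1) with h1 | h1 | h1
      · exact ih (j - 1) (by omega) (by omega) h1 (by omega) h.symm
      · have h2 := hseg.ne i (by omega)
        rw [show i + 2 = j by omega] at h2
        exact h2 he
      · have h2 := hseg.adj (j - 1) (by omega)
        rw [show j - 1 + 1 = j by omega, ← he, show j - 1 = i by omega] at h2
        exact h2.ne rfl

theorem le_of_forall_two (hnb : IsAdjLists G nb) (hs : IsStart G nb a w) {M : ℕ}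
    (hM : ∀ r, 0 < r → r < M → (nb (walkSeq nb a w r)).length = 2) : M ≤ n := by
  have : (Finset.Icc 1 M).card ≤ (Finset.univ : Finset (Fin n)).card := by
    refine Finset.card_le_card_of_injOn (walkSeq nb a w) (fun _ _ => Finset.mem_univ _) ?_
    intro i hi j hj hij
    simp only [Finset.coe_Icc, Set.mem_Icc] at hi hj
    by_contra hne
    rcases Nat.lt_or_gt_of_ne hne with h | h
    · exact walkSeq_ne hnb hs hM (by omega) h hj.2 hij
    · exact walkSeq_ne hnb hs hM (by omega) h hi.2 hij.symm
  simpa using this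

/-- The length of the path that starts with `a`, `w` and ends at the next vertex whose degree is
not two. -/
noncomputable def pathLen (nb : Fin n → List (Fin n)) (a w : Fin n) : ℕ :=
  sInf {l | 0 < l ∧ (nb (walkSeq nb a w l)).length ≠ 2}

theorem pathLen_spec (hnb : IsAdjLists G nb) (hs : IsStart G nb a w) :
    0 < pathLen nb a w ∧ (nb (walkSeq nb a w (pathLen nb a w))).length ≠ 2 := by
  apply Nat.sInf_mem (s := {l | 0 < l ∧ (nb (walkSeq nb a w l)).length ≠ 2})
  by_contra hcon
  have := le_of_forall_two hnb hs (M := n + 1) fun r h0 _ => by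
    by_contra h
    exact hcon ⟨r, h0, h⟩
  omega

theorem two_of_lt_pathLen {r : ℕ} (h0 : 0 < r) (hr : r < pathLen nb a w) :
    (nb (walkSeq nb a w r)).length = 2 := by
  by_contra h
  exact Nat.notMem_of_lt_sInf hr ⟨h0, h⟩

theorem one_lt_pathLen (hnb : IsAdjLists G nb) (hs : IsStart G nb a w) : 1 < pathLen nb a w := by
  have h := pathLen_spec hnb hs
  by_contra hlt
  have : pathLen nb a w = 1 := by omega
  rw [this] at h
  exact h.2 hs.two

theorem pathLen_le (hnb : IsAdjLists G nb) (hs : IsStart G nb a w) : pathLen nb a w ≤ n :=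
  le_of_forall_two hnb hs fun _ => two_of_lt_pathLen

theorem IsStart.isSeg (hnb : IsAdjLists G nb) (hs : IsStart G nb a w) :
    IsSeg G (walkSeq nb a w) (pathLen nb a w) :=
  isSeg_walkSeq hnb hs fun _ => two_of_lt_pathLen

theorem IsStart.avoids {v : Fin n} (hv : (nb v).length ≠ 2) :
    Avoids (walkSeq nb a w) (pathLen nb a w) v := by
  rintro i h0 hi rfl
  exact hv (two_of_lt_pathLen h0 hi)

/-- If the walk returned to `a`, then `a` would be a cut vertex: it has a third neighbour `z`, and
without `a` the inner vertices form a closed set that does not contain `z`. -/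
theorem IsStart.end_ne (hB : IsBiconnected G) (hnb : IsAdjLists G nb) (hs : IsStart G nb a w) :
    walkSeq nb a w (pathLen nb a w) ≠ a := by
  intro he
  set l := pathLen nb a w
  have hl : 1 < l := one_lt_pathLen hnb hs
  have hseg := hs.isSeg hnb
  have h2 : 2 < l := by
    by_contra h
    have h' := hseg.ne 0 hl
    rw [show 0 + 2 = l by omega, he] at h'
    exact h' rfl
  have hlast : G.Adj a (walkSeq nb a w (l - 1)) := by
    have := (hseg.adj (l - 1) (by omega)).symm
    rwa [show l - 1 + 1 = l by omega, he] at this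
  have hne : walkSeq nb a w 1 ≠ walkSeq nb a w (l - 1) :=
    walkSeq_ne hnb hs (fun _ => two_of_lt_pathLen) (by omega) (by omega) (by omega)
  obtain ⟨z, hz, hz₁, hz₂⟩ : ∃ z, G.Adj a z ∧ z ≠ walkSeq nb a w 1 ∧ z ≠ walkSeq nb a w (l - 1) := by
    by_contra! hcon
    have hsub : (nb a).toFinset ⊆ {walkSeq nb a w 1, walkSeq nb a w (l - 1)} := fun z hz => by
      simp only [List.mem_toFinset, (hnb a).2] at hz
      by_cases hz₁ : z = walkSeq nb a w 1
      · simp [hz₁]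
      · simp [hcon z hz hz₁]
    have h3 := Finset.card_le_card hsub
    rw [List.toFinset_card_of_nodup (hnb a).1] at h3
    have h4 := Finset.card_le_two (a := walkSeq nb a w 1) (b := walkSeq nb a w (l - 1))
    have h5 := two_le_length hB hnb a
    exact hs.branch (by omega)
  have hclosed : ∀ u v : {x | x ≠ a}, (∃ r, 0 < r ∧ r < l ∧ walkSeq nb a w r = u) →
      (G.induce {x | x ≠ a}).Adj u v → ∃ r, 0 < r ∧ r < l ∧ walkSeq nb a w r = v := by
    rintro ⟨u, hu⟩ ⟨v, hv⟩ ⟨r, h0, hr, rfl⟩ huv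
    have huv' : G.Adj (walkSeq nb a w r) v := huv
    have := hseg.nbr (r - 1) (by omega) v
    rw [show r - 1 + 1 = r by omega, show r - 1 + 2 = r + 1 by omega] at this
    rcases this huv' with rfl | rfl
    · refine ⟨r - 1, ?_, by omega, rfl⟩
      by_contra h
      rw [show r - 1 = 0 by omega] at hv
      exact hv rfl
    · refine ⟨r + 1, by omega, ?_, rfl⟩
      by_contra h
      rw [show r + 1 = l by omega] at hv
      exact hv he
  have hr := (hB.no_cut_vertex a).preconnected ⟨w, hs.adj.ne'⟩ ⟨z, hz.ne'⟩
  obtain ⟨r, h0, hr, hrz⟩ := mem_of_reachable hclosed hr ⟨1, by omega, by omega, rfl⟩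
  simp only at hrz
  have hadj : G.Adj (walkSeq nb a w r) a := by rw [hrz]; exact hz.symm
  have := hseg.nbr (r - 1) (by omega) a
  rw [show r - 1 + 1 = r by omega, show r - 1 + 2 = r + 1 by omega] at this
  rcases this hadj with h | h
  · rcases Nat.eq_zero_or_pos (r - 1) with h1 | h1
    · rw [show r = 1 by omega] at hrz
      exact hz₁ hrz.symm
    · have := two_of_lt_pathLen (nb := nb) (a := a) (w := w) h1 (by omega)
      rw [← h] at this
      exact hs.branch this
  · rcases (show r + 1 ≤ l by omega).eq_or_lt with h1 | h1
    · rw [show r = l - 1 by omega] at hrz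
      exact hz₂ hrz.symm
    · have := two_of_lt_pathLen (nb := nb) (a := a) (w := w) (r := r + 1) (by omega) (by omega)
      rw [← h] at this
      exact hs.branch this

theorem IsStart.injOn (hB : IsBiconnected G) (hnb : IsAdjLists G nb) (hs : IsStart G nb a w)
    {i j : ℕ} (hi : i ≤ pathLen nb a w) (hj : j ≤ pathLen nb a w)
    (h : walkSeq nb a w i = walkSeq nb a w j) : i = j := by
  wlog hij : i < j generalizing i j
  · by_contra hne
    exact hne (this hj hi h.symm (by omega)).symm
  exfalso
  rcases Nat.eq_zero_or_pos i with rfl | h0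
  · rcases hj.eq_or_lt with rfl | hlt
    · exact hs.end_ne hB hnb h.symm
    · have := two_of_lt_pathLen (nb := nb) (a := a) (w := w) hij hlt
      rw [← h] at this
      exact hs.branch this
  · exact walkSeq_ne hnb hs (fun _ => two_of_lt_pathLen) h0 hij hj h

/-! ### Systems of paths -/

/-- `v` is an interior vertex of the path that starts with `a`, `w`. -/
def InPath (nb : Fin n → List (Fin n)) (a w v : Fin n) : Prop :=
  ∃ r, 0 < r ∧ r < pathLen nb a w ∧ walkSeq nb a w r = v

theorem InPath.two {v : Fin n} (h : InPath nb a w v) : (nb v).length = 2 := by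
  obtain ⟨r, h0, hr, rfl⟩ := h
  exact two_of_lt_pathLen h0 hr

theorem IsStart.inPath (hnb : IsAdjLists G nb) (hs : IsStart G nb a w) : InPath nb a w w :=
  ⟨1, one_pos, one_lt_pathLen hnb hs, rfl⟩

theorem InPath.closed (hnb : IsAdjLists G nb) (hs : IsStart G nb a w) {u v : Fin n}
    (hu : InPath nb a w u) (huv : G.Adj u v) (hv : (nb v).length = 2) : InPath nb a w v := by
  obtain ⟨r, h0, hr, rfl⟩ := hu
  have := (hs.isSeg hnb).nbr (r - 1) (by omega) v
  rw [show r - 1 + 1 = r by omega, show r - 1 + 2 = r + 1 by omega] at this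
  rcases this huv with rfl | rfl
  · refine ⟨r - 1, ?_, by omega, rfl⟩
    by_contra h
    rw [show r - 1 = 0 by omega] at hv
    exact hs.branch hv
  · refine ⟨r + 1, by omega, ?_, rfl⟩
    by_contra h
    rw [show r + 1 = pathLen nb a w by omega] at hv
    exact (pathLen_spec hnb hs).2 hv

/-- Walking back from the common vertex stays inside both paths until `w`. It is therefore enough to
inspect the mark of `w` to know whether a new path is disjoint from those already recorded, in
particular to avoid recording a path again from its other end. -/
theorem InPath.start_inPath (hnb : IsAdjLists G nb) (hs : IsStart G nb a w) {a' w' v : Fin n}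
    (hs' : IsStart G nb a' w') (hv : InPath nb a w v) (hv' : InPath nb a' w' v) :
    InPath nb a' w' w := by
  obtain ⟨r, h0, hr, rfl⟩ := hv
  induction r with
  | zero => omega
  | succ r ih =>
    rcases Nat.eq_zero_or_pos r with rfl | h1
    · exact hv'
    · exact ih h1 (by omega) (hv'.closed hnb hs' ((hs.isSeg hnb).adj r (by omega)).symm
        (two_of_lt_pathLen h1 (by omega)))

/-- A family of paths with pairwise disjoint interiors, each given by its second vertex `w` and its
first vertex `α w`. -/
structure PathSys (G : SimpleGraph (Fin n)) (nb : Fin n → List (Fin n)) (ws : List (Fin n))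
    (α : Fin n → Fin n) : Prop where
  nodup : ws.Nodup
  start : ∀ w ∈ ws, IsStart G nb (α w) w
  disj : ∀ w ∈ ws, ∀ w' ∈ ws, ∀ v, InPath nb (α w) w v → InPath nb (α w') w' v → w = w'

theorem PathSys.nil (α : Fin n → Fin n) : PathSys G nb [] α :=
  ⟨List.nodup_nil, by simp, by simp⟩

theorem PathSys.append (hnb : IsAdjLists G nb) {ws : List (Fin n)} {α : Fin n → Fin n}
    (h : PathSys G nb ws α) (hs : IsStart G nb a w)
    (hw : ∀ w' ∈ ws, ¬ InPath nb (α w') w' w) :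
    PathSys G nb (ws ++ [w]) (Function.update α w a) := by
  have hmem : w ∉ ws := fun hmem => hw w hmem ((h.start w hmem).inPath hnb)
  have hα : ∀ w' ∈ ws, Function.update α w a w' = α w' := fun w' hw' =>
    Function.update_of_ne (by rintro rfl; exact hmem hw') _ _
  refine ⟨List.nodup_append.mpr ⟨h.nodup, List.nodup_singleton _, ?_⟩, ?_, ?_⟩
  · rintro x hx y hy rfl
    simp only [List.mem_singleton] at hy
    exact hmem (hy ▸ hx)
  · intro w' hw'
    rcases List.mem_append.mp hw' with h1 | h1
    · rw [hα w' h1]; exact h.start w' h1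
    · simp only [List.mem_singleton] at h1
      subst h1
      simpa using hs
  · intro w₁ hw₁ w₂ hw₂ v h₁ h₂
    rcases List.mem_append.mp hw₁ with m₁ | m₁ <;> rcases List.mem_append.mp hw₂ with m₂ | m₂
    · rw [hα _ m₁] at h₁
      rw [hα _ m₂] at h₂
      exact h.disj _ m₁ _ m₂ v h₁ h₂
    · simp only [List.mem_singleton] at m₂
      subst m₂
      rw [hα _ m₁] at h₁
      rw [Function.update_self] at h₂
      exact absurd (h₂.start_inPath hnb hs (h.start _ m₁) h₁) (hw _ m₁)
    · simp only [List.mem_singleton] at m₁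
      subst m₁
      rw [hα _ m₂] at h₂
      rw [Function.update_self] at h₁
      exact absurd (h₁.start_inPath hnb hs (h.start _ m₂) h₂) (hw _ m₂)
    · simp only [List.mem_singleton] at m₁ m₂
      rw [m₁, m₂]

/-- Every vertex of degree two lies in one of the paths once all starting points are covered. -/
theorem PathSys.cover (hB : IsBiconnected G) (hnb : IsAdjLists G nb) {ws : List (Fin n)}
    {α : Fin n → Fin n} (h : PathSys G nb ws α)
    (hall : ∀ a w, IsStart G nb a w → ∃ w' ∈ ws, InPath nb (α w') w' w)
    {b : Fin n} (hb : (nb b).length ≠ 2) {v : Fin n} (hv : (nb v).length = 2) :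
    ∃ w ∈ ws, InPath nb (α w) w v := by
  -- Coverage spreads along edges from the branching vertex `b`: a vertex of degree two is entered
  -- either from a branching vertex, and then is a starting point, or from an inner vertex of a
  -- recorded path.
  refine mem_of_reachable (P := fun v => (nb v).length = 2 → ∃ w ∈ ws, InPath nb (α w) w v)
    (fun u v hu huv hv => ?_) (hB.connected.preconnected b v) (fun h => absurd h hb) hv
  by_cases h2 : (nb u).length = 2
  · obtain ⟨w, hw, hin⟩ := hu h2
    exact ⟨w, hw, hin.closed hnb (h.start w hw) huv hv⟩
  · exact hall u v ⟨h2, huv, hv⟩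

end AdjLists

end BetwCent

namespace BetwCent

/-! ### Maximal induced paths -/

theorem exists_walk_getVert {V : Type*} {G : SimpleGraph V} {l : ℕ} {p : ℕ → V}
    (h : ∀ i, i < l → G.Adj (p i) (p (i + 1))) :
    ∃ q : G.Walk (p 0) (p l), q.length = l ∧ ∀ i, i ≤ l → q.getVert i = p i := by
  induction l generalizing p with
  | zero => exact ⟨.nil, rfl, fun i hi => by simp [show i = 0 by omega]⟩
  | succ l ih =>
    obtain ⟨q, hq, hq'⟩ := ih (p := fun i => p (i + 1)) (fun i hi => h (i + 1) (by omega))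
    refine ⟨.cons (h 0 (by omega)) q, by simp [hq], fun i hi => ?_⟩
    cases i with
    | zero => simp
    | succ i => simpa using hq' i (by omega)

section MaxPaths

variable {n : ℕ} {G : SimpleGraph (Fin n)} {nb : Fin n → List (Fin n)}

theorem IsMaxInducedPath.adj_of_two (hnb : IsAdjLists G nb) {P : G.Subgraph}
    (hP : IsMaxInducedPath G P) {u v : Fin n} (hu : u ∈ P.verts) (h2 : (nb u).length = 2)
    (huv : G.Adj u v) : P.Adj u v := by
  obtain ⟨a, b, p, hp, hl, ha, hb, -, rfl⟩ := hP
  rw [degree_eq_length hnb] at ha hb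
  rw [SimpleGraph.Walk.mem_verts_toSubgraph,
    SimpleGraph.Walk.mem_support_iff_exists_getVert] at hu
  obtain ⟨i, rfl, hi⟩ := hu
  have h0 : 0 < i := by
    by_contra h
    rw [show i = 0 by omega, SimpleGraph.Walk.getVert_zero] at h2
    exact ha h2
  have hlt : i < p.length := by
    by_contra h
    rw [show i = p.length by omega, SimpleGraph.Walk.getVert_length] at h2
    exact hb h2
  have hne : p.getVert (i - 1) ≠ p.getVert (i + 1) := fun he => by
    have := hp.getVert_injOn (show i - 1 ≤ p.length by omega) (show i + 1 ≤ p.length by omega) he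
    omega
  have h₁ : p.toSubgraph.Adj (p.getVert i) (p.getVert (i - 1)) := by
    have := (p.toSubgraph_adj_getVert (i := i - 1) (by omega)).symm
    rwa [show i - 1 + 1 = i by omega] at this
  have h₂ := p.toSubgraph_adj_getVert hlt
  rcases eq_or_eq_of_adj hnb h2 h₁.adj_sub h₂.adj_sub hne huv with rfl | rfl
  · exact h₁
  · exact h₂

/-- A maximal induced path contains both edges at each of its vertices of degree two. Starting from
the shared vertex, the edges of `P` are thus forced into `Q` one after another in both directions.
By symmetry the two paths are equal. -/
theorem IsMaxInducedPath.le (hnb : IsAdjLists G nb) {P Q : G.Subgraph}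
    (hP : IsMaxInducedPath G P) (hQ : IsMaxInducedPath G Q) {x : Fin n} (hxP : x ∈ P.verts)
    (hxQ : x ∈ Q.verts) (hx : (nb x).length = 2) : P ≤ Q := by
  obtain ⟨a, b, p, hp, hl, ha, hb, hdeg, rfl⟩ := hP
  rw [degree_eq_length hnb] at ha hb
  have hdeg' : ∀ i, 0 < i → i < p.length → (nb (p.getVert i)).length = 2 := by
    intro i h0 hi
    have := hdeg _ (p.getVert_mem_support i) (fun he => ?_) (fun he => ?_)
    · rwa [degree_eq_length hnb] at this
    · have := hp.getVert_injOn (show i ≤ p.length by omega) (show 0 ≤ p.length by omega)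
        (by rw [he, p.getVert_zero])
      omega
    · have := hp.getVert_injOn (show i ≤ p.length by omega) (show p.length ≤ p.length by omega)
        (by rw [he, p.getVert_length])
      omega
  rw [SimpleGraph.Walk.mem_verts_toSubgraph,
    SimpleGraph.Walk.mem_support_iff_exists_getVert] at hxP
  obtain ⟨i, rfl, hi⟩ := hxP
  have h0 : 0 < i := by
    by_contra h
    rw [show i = 0 by omega, SimpleGraph.Walk.getVert_zero] at hx
    exact ha hx
  have hlt : i < p.length := by
    by_contra h
    rw [show i = p.length by omega, SimpleGraph.Walk.getVert_length] at hx
    exact hb hx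
  have hup : ∀ k, i + k < p.length → Q.Adj (p.getVert (i + k)) (p.getVert (i + k + 1)) := by
    intro k
    induction k with
    | zero => exact fun h => hQ.adj_of_two hnb hxQ hx (p.adj_getVert_succ h)
    | succ k ih =>
      intro h
      exact hQ.adj_of_two hnb (Q.edge_vert (ih (by omega)).symm) (hdeg' _ (by omega) h)
        (p.adj_getVert_succ h)
  have hdown : ∀ k, k < i → Q.Adj (p.getVert (i - k)) (p.getVert (i - k - 1)) := by
    intro k
    have hadj : ∀ k, k < i → G.Adj (p.getVert (i - k)) (p.getVert (i - k - 1)) := fun k hk => by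
      have := (p.adj_getVert_succ (i := i - k - 1) (by omega)).symm
      rwa [show i - k - 1 + 1 = i - k by omega] at this
    induction k with
    | zero => exact fun h => hQ.adj_of_two hnb hxQ hx (hadj 0 h)
    | succ k ih =>
      intro h
      have := Q.edge_vert (ih (by omega)).symm
      rw [show i - k - 1 = i - (k + 1) by omega] at this
      exact hQ.adj_of_two hnb this (hdeg' _ (by omega) (by omega)) (hadj _ h)
  have hall : ∀ j, j < p.length → Q.Adj (p.getVert j) (p.getVert (j + 1)) := by
    intro j hj
    rcases le_or_gt i j with h | h
    · have := hup (j - i) (by omega)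
      rwa [show i + (j - i) = j by omega] at this
    · have := (hdown (i - j - 1) (by omega)).symm
      rwa [show i - (i - j - 1) = j + 1 by omega, Nat.add_sub_cancel] at this
  constructor
  · intro v hv
    rw [SimpleGraph.Walk.mem_verts_toSubgraph,
      SimpleGraph.Walk.mem_support_iff_exists_getVert] at hv
    obtain ⟨j, rfl, hj⟩ := hv
    rcases hj.eq_or_lt with rfl | h
    · have := Q.edge_vert (hall (p.length - 1) (by omega)).symm
      rwa [show p.length - 1 + 1 = p.length by omega] at this
    · exact Q.edge_vert (hall j h)
  · intro u v huv
    rw [SimpleGraph.Walk.toSubgraph_adj_iff] at huv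
    obtain ⟨j, he, hj⟩ := huv
    have := hall j hj
    rw [← SimpleGraph.Subgraph.mem_edgeSet, he] at this
    exact this

theorem IsStart.exists_isMaxInducedPath (hB : IsBiconnected G) (hnb : IsAdjLists G nb)
    {a w : Fin n} (hs : IsStart G nb a w) :
    ∃ P : G.Subgraph, IsMaxInducedPath G P ∧
      ∀ v, v ∈ P.verts ∧ (nb v).length = 2 ↔ InPath nb a w v := by
  obtain ⟨q, hq, hq'⟩ := exists_walk_getVert (hs.isSeg hnb).adj
  have hl := one_lt_pathLen hnb hs
  have hend := (pathLen_spec hnb hs).2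
  have hmem : ∀ v, v ∈ q.support ↔ ∃ i, i ≤ pathLen nb a w ∧ walkSeq nb a w i = v := by
    intro v
    rw [SimpleGraph.Walk.mem_support_iff_exists_getVert]
    constructor
    · rintro ⟨i, rfl, hi⟩
      exact ⟨i, by omega, (hq' i (by omega)).symm⟩
    · rintro ⟨i, hi, rfl⟩
      exact ⟨i, hq' i hi, by omega⟩
  refine ⟨q.toSubgraph, ⟨_, _, q, ?_, by omega, ?_, ?_, ?_, rfl⟩, ?_⟩
  · rw [← SimpleGraph.Walk.IsPath.getVert_injOn_iff]
    intro i hi j hj hij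
    simp only [Set.mem_ofPred_eq] at hi hj
    rw [hq' i (by omega), hq' j (by omega)] at hij
    exact hs.injOn hB hnb (by omega) (by omega) hij
  · rw [degree_eq_length hnb]; exact hs.branch
  · rw [degree_eq_length hnb]; exact hend
  · intro v hv h₁ h₂
    rw [degree_eq_length hnb]
    obtain ⟨i, hi, rfl⟩ := (hmem v).mp hv
    refine two_of_lt_pathLen (Nat.pos_of_ne_zero ?_) (lt_of_le_of_ne hi ?_)
    · rintro rfl; exact h₁ rfl
    · rintro rfl; exact h₂ rfl
  · intro v
    rw [SimpleGraph.Walk.mem_verts_toSubgraph, hmem]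
    constructor
    · rintro ⟨⟨i, hi, rfl⟩, h2⟩
      refine ⟨i, Nat.pos_of_ne_zero ?_, lt_of_le_of_ne hi ?_, rfl⟩
      · rintro rfl; exact hs.branch h2
      · rintro rfl; exact hend h2
    · rintro ⟨i, h0, hi, rfl⟩
      exact ⟨⟨i, hi.le, rfl⟩, two_of_lt_pathLen h0 hi⟩

-- Distinct paths share no vertex of degree two, so the sum over pairs of paths is a sum over pairs
-- of such vertices with different names. This is the form in which the algorithm's sums are
-- compared with `pairSum`.
open scoped Classical in
theorem pairSum_eq (hB : IsBiconnected G) (hnb : IsAdjLists G nb) {ws : List (Fin n)}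
    {α pid : Fin n → Fin n} (h : PathSys G nb ws α)
    (hpid : ∀ v, (nb v).length = 2 → pid v ∈ ws ∧ InPath nb (α (pid v)) (pid v) v)
    (pen : Fin n → ℕ) (v : Fin n) :
    pairSum G pen v = ∑ s, ∑ t, if (nb s).length = 2 ∧ (nb t).length = 2 ∧ pid s ≠ pid t then
      gamma G pen s t v else 0 := by
  have hex : ∀ s, ∃ P : G.Subgraph, (nb s).length = 2 → IsMaxInducedPath G P ∧
      ∀ v, v ∈ P.verts ∧ (nb v).length = 2 ↔ InPath nb (α (pid s)) (pid s) v := by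
    intro s
    by_cases hs : (nb s).length = 2
    · obtain ⟨P, hP⟩ := (h.start _ (hpid s hs).1).exists_isMaxInducedPath hB hnb
      exact ⟨P, fun _ => hP⟩
    · exact ⟨⊥, fun h => absurd h hs⟩
  choose P hP using hex
  have hmem : ∀ s (Q : G.Subgraph), s ∈ degTwoVerts G Q ↔ s ∈ Q.verts ∧ (nb s).length = 2 := by
    intro s Q
    simp [degTwoVerts, degree_eq_length hnb]
  have hself : ∀ s, (nb s).length = 2 → s ∈ (P s).verts := fun s hs =>
    (((hP s hs).2 s).mpr (hpid s hs).2).1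
  have hmax : ∀ Q, Q ∈ maxInducedPaths G ↔ IsMaxInducedPath G Q := fun Q => by
    simp [maxInducedPaths]
  have huniq : ∀ Q, IsMaxInducedPath G Q → ∀ s ∈ degTwoVerts G Q, Q = P s := by
    intro Q hQ s hs
    rw [hmem] at hs
    exact le_antisymm (hQ.le hnb (hP s hs.2).1 hs.1 (hself s hs.2) hs.2)
      ((hP s hs.2).1.le hnb hQ (hself s hs.2) hs.1 hs.2)
  have hPeq : ∀ s t, (nb s).length = 2 → (nb t).length = 2 → (P s = P t ↔ pid s = pid t) := by
    intro s t hs ht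
    constructor
    · intro he
      have h₁ := ((hP t ht).2 s).mp ⟨he ▸ hself s hs, hs⟩
      exact h.disj _ (hpid s hs).1 _ (hpid t ht).1 s (hpid s hs).2 h₁
    · intro he
      have h₁ := ((hP t ht).2 s).mpr (he ▸ (hpid s hs).2)
      exact (huniq _ (hP t ht).1 s ((hmem _ _).mpr h₁)).symm
  -- `P s` is the only maximal induced path with `s` among its vertices of degree two, so a sum over
  -- paths and their vertices collapses to a sum over vertices. It is used once for each of the two
  -- outer sums.
  have hsum : ∀ (M : Finset G.Subgraph) (F : G.Subgraph → Fin n → ℚ), M ⊆ maxInducedPaths G →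
      ∑ Q ∈ M, ∑ s ∈ degTwoVerts G Q, F Q s =
        ∑ s, if (nb s).length = 2 ∧ P s ∈ M then F (P s) s else 0 := by
    intro M F hM
    have : ∀ Q ∈ M, ∑ s ∈ degTwoVerts G Q, F Q s =
        ∑ s, if (nb s).length = 2 ∧ Q = P s then F Q s else 0 := by
      intro Q hQ
      rw [← Finset.sum_filter]
      refine Finset.sum_congr ?_ fun _ _ => rfl
      ext s
      simp only [Finset.mem_filter, Finset.mem_univ, true_and]
      constructor
      · intro hs
        exact ⟨((hmem s Q).mp hs).2, huniq Q ((hmax Q).mp (hM hQ)) s hs⟩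
      · rintro ⟨hs, rfl⟩
        exact (hmem _ _).mpr ⟨hself s hs, hs⟩
    rw [Finset.sum_congr rfl this, Finset.sum_comm]
    refine Finset.sum_congr rfl fun s _ => ?_
    by_cases hs : (nb s).length = 2
    · simp only [hs, true_and]
      rw [Finset.sum_ite_eq']
    · simp [hs]
  have h₁ : ∀ Q ∈ maxInducedPaths G, (∑ P₂ ∈ (maxInducedPaths G).erase Q,
      ∑ s ∈ degTwoVerts G Q, ∑ t ∈ degTwoVerts G P₂, gamma G pen s t v) =
      ∑ s ∈ degTwoVerts G Q, ∑ t, if (nb t).length = 2 ∧ P t ∈ (maxInducedPaths G).erase Q then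
        gamma G pen s t v else 0 := by
    intro Q _
    rw [Finset.sum_comm]
    exact Finset.sum_congr rfl fun s _ =>
      hsum ((maxInducedPaths G).erase Q) (fun _ t => gamma G pen s t v) (Finset.erase_subset _ _)
  rw [pairSum, Finset.sum_congr rfl h₁, hsum _ _ subset_rfl]
  refine Finset.sum_congr rfl fun s _ => ?_
  by_cases hs : (nb s).length = 2
  · rw [if_pos ⟨hs, (hmax _).mpr (hP s hs).1⟩]
    refine Finset.sum_congr rfl fun t _ => ?_
    by_cases ht : (nb t).length = 2
    · have : P t ∈ (maxInducedPaths G).erase (P s) ↔ pid s ≠ pid t := by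
        rw [Finset.mem_erase, hmax, ne_eq, eq_comm, hPeq s t hs ht]
        simp [(hP t ht).1]
      simp [hs, ht, this]
    · simp [ht]
  · simp [hs]

theorem pairSum_eq_zero (hnb : IsAdjLists G nb) (h : ∀ v, (nb v).length = 2) (pen : Fin n → ℕ)
    (v : Fin n) : pairSum G pen v = 0 := by
  have : maxInducedPaths G = ∅ := by
    refine Finset.eq_empty_of_forall_notMem fun P hP => ?_
    simp only [maxInducedPaths, Finset.mem_filter] at hP
    obtain ⟨-, a, b, p, -, -, ha, -⟩ := hP
    rw [degree_eq_length hnb] at ha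
    exact ha (h a)
  rw [pairSum, this, Finset.sum_empty]

end MaxPaths

end BetwCent

namespace BetwCent

/-! ### The sums computed by the algorithm -/

section Formula

open scoped Classical

variable {n : ℕ} {G : SimpleGraph (Fin n)} {nb : Fin n → List (Fin n)} {ws : List (Fin n)}
  {α pid : Fin n → Fin n}

/-- A system of paths that covers all vertices of degree two; `pid v` names the path of `v`. -/
structure PathCover (G : SimpleGraph (Fin n)) (nb : Fin n → List (Fin n)) (ws : List (Fin n))
    (α pid : Fin n → Fin n) : Prop extends PathSys G nb ws α where
  mem : ∀ v, (nb v).length = 2 → pid v ∈ ws ∧ InPath nb (α (pid v)) (pid v) v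

/-- The `r`-th vertex of the path `w`. -/
def pathVert (nb : Fin n → List (Fin n)) (α : Fin n → Fin n) (w : Fin n) : ℕ → Fin n :=
  walkSeq nb (α w) w

/-- The length of the path `w`. -/
noncomputable def len (nb : Fin n → List (Fin n)) (α : Fin n → Fin n) (w : Fin n) : ℕ :=
  pathLen nb (α w) w

theorem PathCover.pid_eq (h : PathCover G nb ws α pid) {w v : Fin n} (hw : w ∈ ws)
    (hv : InPath nb (α w) w v) : pid v = w :=
  h.disj _ (h.mem v hv.two).1 _ hw v (h.mem v hv.two).2 hv

theorem PathCover.inPath_iff (h : PathCover G nb ws α pid) {w v : Fin n} (hw : w ∈ ws) :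
    InPath nb (α w) w v ↔ (nb v).length = 2 ∧ pid v = w := by
  refine ⟨fun hv => ⟨hv.two, h.pid_eq hw hv⟩, ?_⟩
  rintro ⟨hv, rfl⟩
  exact (h.mem v hv).2

/-- The positions inside the paths enumerate the vertices of degree two once each: the paths are
disjoint, and none repeats a vertex. -/
theorem PathCover.sum_two (hB : IsBiconnected G) (hnb : IsAdjLists G nb)
    (h : PathCover G nb ws α pid) (f : Fin n → ℚ) :
    (∑ t, if (nb t).length = 2 then f t else 0) =
      ∑ w ∈ ws.toFinset, ∑ r ∈ Finset.Ioo 0 (len nb α w), f (pathVert nb α w r) := by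
  rw [← Finset.sum_filter, Finset.sum_sigma']
  symm
  refine Finset.sum_bij (fun x _ => pathVert nb α x.1 x.2) ?_ ?_ ?_ (fun _ _ => rfl)
  · rintro ⟨w, r⟩ hx
    simp only [Finset.mem_sigma, Finset.mem_Ioo] at hx
    exact Finset.mem_filter.mpr ⟨Finset.mem_univ _, two_of_lt_pathLen hx.2.1 hx.2.2⟩
  · rintro ⟨w, r⟩ hx ⟨w', r'⟩ hx' he
    simp only [Finset.mem_sigma, Finset.mem_Ioo, List.mem_toFinset] at hx hx' he
    have hww : w = w' := by
      refine h.disj _ hx.1 _ hx'.1 (pathVert nb α w r) ⟨r, hx.2.1, hx.2.2, rfl⟩ ?_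
      rw [he]
      exact ⟨r', hx'.2.1, hx'.2.2, rfl⟩
    subst hww
    rw [(h.start _ hx.1).injOn hB hnb hx.2.2.le hx'.2.2.le he]
  · intro t ht
    simp only [Finset.mem_filter, Finset.mem_univ, true_and] at ht
    obtain ⟨hm, r, h0, hr, he⟩ := h.mem t ht
    exact ⟨⟨pid t, r⟩, by simp [hm, h0, len, hr], he⟩

/-- The number of ends of the path `w` that equal `y` and lie on a shortest path from `s` to the
`r`-th vertex of the path. -/
noncomputable def entry (G : SimpleGraph (Fin n)) (nb : Fin n → List (Fin n)) (α : Fin n → Fin n)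
    (y s w : Fin n) (r : ℕ) : ℚ :=
  (if y = pathVert nb α w 0 ∧
    G.dist s (pathVert nb α w r) = G.dist s (pathVert nb α w 0) + r then 1 else 0) +
  (if y = pathVert nb α w (len nb α w) ∧ G.dist s (pathVert nb α w r) =
    G.dist s (pathVert nb α w (len nb α w)) + (len nb α w - r) then 1 else 0)

/-- The contribution of the path `w` to the weight of the pair `y`, `s`. -/
noncomputable def share (G : SimpleGraph (Fin n)) (nb : Fin n → List (Fin n)) (pen : Fin n → ℕ)
    (α : Fin n → Fin n) (y s w : Fin n) : ℚ :=
  ∑ r ∈ Finset.Ioo 0 (len nb α w), (pen s : ℚ) * pen (pathVert nb α w r) /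
    sigma G s (pathVert nb α w r) * entry G nb α y s w r

/-- The weight with which `s` contributes to the vertices on shortest paths from `s` to `y`. -/
noncomputable def weight (G : SimpleGraph (Fin n)) (nb : Fin n → List (Fin n)) (pen : Fin n → ℕ)
    (ws : List (Fin n)) (α pid : Fin n → Fin n) (y s : Fin n) : ℚ :=
  if (nb s).length = 2 then
    ∑ w ∈ ws.toFinset, if w ≠ pid s then share G nb pen α y s w else 0
  else 0

theorem PathCover.avoids (h : PathCover G nb ws α pid) {w s : Fin n} (hw : w ∈ ws)
    (hs : ¬ ((nb s).length = 2 ∧ pid s = w)) : Avoids (pathVert nb α w) (len nb α w) s := by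
  rintro i h0 hi he
  exact hs ((h.inPath_iff hw).mp ⟨i, h0, hi, he⟩)

/-- Only the two ends of the path contribute. For `v` outside, this is the split of shortest paths
by their entry. For `v` inside, both terms vanish because a shortest path does not meet the interior
before the end at which it optimally enters. -/
theorem PathCover.sum_entry (hB : IsBiconnected G) (hnb : IsAdjLists G nb)
    (h : PathCover G nb ws α pid) {w s v : Fin n} (hw : w ∈ ws)
    (hs : ¬ ((nb s).length = 2 ∧ pid s = w)) {r : ℕ} (h0 : 0 < r) (hr : r < len nb α w) :
    (∑ y, if (nb y).length ≠ 2 then entry G nb α y s w r * through G s y v else 0) =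
      if (nb v).length = 2 ∧ pid v = w then 0 else (through G s (pathVert nb α w r) v : ℚ) := by
  have hst := h.start w hw
  have hseg : IsSeg G (pathVert nb α w) (len nb α w) := hst.isSeg hnb
  have ha : (nb (pathVert nb α w 0)).length ≠ 2 := hst.branch
  have hb : (nb (pathVert nb α w (len nb α w))).length ≠ 2 := (pathLen_spec hnb hst).2
  have hav := h.avoids hw hs
  have e₁ : (∑ y, if (nb y).length ≠ 2 then entry G nb α y s w r * through G s y v else 0) =
      (if G.dist s (pathVert nb α w r) = G.dist s (pathVert nb α w 0) + r then
        (through G s (pathVert nb α w 0) v : ℚ) else 0) +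
      (if G.dist s (pathVert nb α w r) = G.dist s (pathVert nb α w (len nb α w)) +
        (len nb α w - r) then (through G s (pathVert nb α w (len nb α w)) v : ℚ) else 0) := by
    have : ∀ y, (if (nb y).length ≠ 2 then entry G nb α y s w r * through G s y v else 0) =
        (if y = pathVert nb α w 0 then
          (if G.dist s (pathVert nb α w r) = G.dist s (pathVert nb α w 0) + r then
            (through G s (pathVert nb α w 0) v : ℚ) else 0) else 0) +
        (if y = pathVert nb α w (len nb α w) then
          (if G.dist s (pathVert nb α w r) = G.dist s (pathVert nb α w (len nb α w)) +
            (len nb α w - r) then (through G s (pathVert nb α w (len nb α w)) v : ℚ) else 0)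
          else 0) := by
      intro y
      by_cases hy : (nb y).length = 2
      · rw [if_neg (by simp [hy]), if_neg (by rintro rfl; exact ha hy),
          if_neg (by rintro rfl; exact hb hy), add_zero]
      · rw [if_pos hy, entry, add_mul]
        congr 1
        · by_cases hya : y = pathVert nb α w 0
          · subst hya; simp
          · simp [hya]
        · by_cases hya : y = pathVert nb α w (len nb α w)
          · subst hya; simp
          · simp [hya]
    rw [Finset.sum_congr rfl fun y _ => this y, Finset.sum_add_distrib, Finset.sum_ite_eq',
      Finset.sum_ite_eq']
    simp
  rw [e₁]
  by_cases hv : (nb v).length = 2 ∧ pid v = w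
  · rw [if_pos hv]
    obtain ⟨j, hj0, hj, rfl⟩ := (h.inPath_iff hw).mpr hv
    have z₁ := hseg.through_left_eq_zero hB.connected hav (IsStart.avoids ha) h0 hr hj0 hj
    have z₂ := hseg.through_right_eq_zero hB.connected hav (IsStart.avoids hb) h0 hr hj0 hj
    rw [pathVert] at z₁ z₂ ⊢
    split_ifs with h₁ h₂ h₂
    · simp [z₁ h₁, z₂ h₂]
    · simp [z₁ h₁]
    · simp [z₂ h₂]
    · simp
  · rw [if_neg hv, hseg.through_eq hB.connected hav (h.avoids hw hv) h0 hr]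
    push_cast
    rfl

/-- The weights count each pair once, except when `v` lies on the path of the second vertex. -/
theorem PathCover.sum_weight (hB : IsBiconnected G) (hnb : IsAdjLists G nb)
    (h : PathCover G nb ws α pid) (pen : Fin n → ℕ) {s v : Fin n} (hsv : s ≠ v) :
    (∑ y, if (nb y).length ≠ 2 then weight G nb pen ws α pid y s * through G s y v else 0) =
      ∑ t, if (nb s).length = 2 ∧ (nb t).length = 2 ∧ pid s ≠ pid t ∧
        ¬ ((nb v).length = 2 ∧ pid v = pid t) then gamma G pen s t v else 0 := by
  by_cases hs : (nb s).length = 2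
  swap
  · simp [weight, hs]
  have e₁ : (∑ t, if (nb s).length = 2 ∧ (nb t).length = 2 ∧ pid s ≠ pid t ∧
        ¬ ((nb v).length = 2 ∧ pid v = pid t) then gamma G pen s t v else 0) =
      ∑ w ∈ ws.toFinset, if w ≠ pid s then ∑ r ∈ Finset.Ioo 0 (len nb α w),
        (pen s : ℚ) * pen (pathVert nb α w r) / sigma G s (pathVert nb α w r) *
        (if (nb v).length = 2 ∧ pid v = w then 0 else
          (through G s (pathVert nb α w r) v : ℚ)) else 0 := by
    have : ∀ t, (if (nb s).length = 2 ∧ (nb t).length = 2 ∧ pid s ≠ pid t ∧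
        ¬ ((nb v).length = 2 ∧ pid v = pid t) then gamma G pen s t v else 0) =
        if (nb t).length = 2 then (if pid s ≠ pid t ∧
        ¬ ((nb v).length = 2 ∧ pid v = pid t) then gamma G pen s t v else 0) else 0 := by
      intro t
      simp [hs, ite_and]
    rw [Finset.sum_congr rfl fun t _ => this t, h.sum_two hB hnb]
    refine Finset.sum_congr rfl fun w hw => ?_
    rw [List.mem_toFinset] at hw
    have hpid : ∀ r ∈ Finset.Ioo 0 (len nb α w), pid (pathVert nb α w r) = w := fun r hr => by
      rw [Finset.mem_Ioo] at hr
      exact h.pid_eq hw ⟨r, hr.1, hr.2, rfl⟩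
    by_cases hws : w = pid s
    · subst hws
      rw [if_neg (by simp)]
      refine Finset.sum_eq_zero fun r hr => ?_
      rw [hpid r hr, if_neg (by simp)]
    · rw [if_pos hws]
      refine Finset.sum_congr rfl fun r hr => ?_
      rw [hpid r hr]
      by_cases hv : (nb v).length = 2 ∧ pid v = w
      · rw [if_neg (by simp [hv]), if_pos hv, mul_zero]
      · rw [if_pos ⟨Ne.symm hws, hv⟩, if_neg hv, gamma_eq hB.connected, if_neg]
        · ring
        · rintro (he | he)
          · exact hsv he.symm
          · rw [Finset.mem_Ioo] at hr
            exact hv ⟨he ▸ two_of_lt_pathLen hr.1 hr.2, he ▸ hpid r (Finset.mem_Ioo.mpr hr)⟩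
  rw [e₁]
  simp only [weight, if_pos hs]
  -- Moving the sum over `y` innermost lets `sum_entry` evaluate it for each target vertex
  -- separately.
  have e₂ : ∀ y, (if (nb y).length ≠ 2 then (∑ w ∈ ws.toFinset, if w ≠ pid s then
      share G nb pen α y s w else 0) * (through G s y v : ℚ) else 0) =
      ∑ w ∈ ws.toFinset, if w ≠ pid s then ∑ r ∈ Finset.Ioo 0 (len nb α w),
        (pen s : ℚ) * pen (pathVert nb α w r) / sigma G s (pathVert nb α w r) *
        (if (nb y).length ≠ 2 then entry G nb α y s w r * through G s y v else 0) else 0 := by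
    intro y
    by_cases hy : (nb y).length = 2
    · simp [hy]
    · simp only [if_pos (show (nb y).length ≠ 2 from hy), Finset.sum_mul]
      refine Finset.sum_congr rfl fun w _ => ?_
      split_ifs
      · rw [share, Finset.sum_mul]
        exact Finset.sum_congr rfl fun r _ => by ring
      · rw [zero_mul]
  rw [Finset.sum_congr rfl fun y _ => e₂ y, Finset.sum_comm]
  refine Finset.sum_congr rfl fun w hw => ?_
  rw [List.mem_toFinset] at hw
  by_cases hws : w = pid s
  · simp [hws]
  · simp only [if_pos (show w ≠ pid s from hws)]
    rw [Finset.sum_comm]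
    refine Finset.sum_congr rfl fun r hr => ?_
    rw [Finset.mem_Ioo] at hr
    rw [← Finset.mul_sum, h.sum_entry hB hnb hw (fun hc => hws hc.2.symm) hr.1 hr.2]

/-- The total weight of the shortest paths from `y` that pass through `v`, divided by the number of
shortest paths from `y` to `v`. -/
noncomputable def load (G : SimpleGraph (Fin n)) (nb : Fin n → List (Fin n)) (pen : Fin n → ℕ)
    (ws : List (Fin n)) (α pid : Fin n → Fin n) (y v : Fin n) : ℚ :=
  ∑ s, weight G nb pen ws α pid y s * onward G y v s

/-- The part of `load` that is due to the vertices on the path of `v`. -/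
noncomputable def ownLoad (G : SimpleGraph (Fin n)) (nb : Fin n → List (Fin n)) (pen : Fin n → ℕ)
    (ws : List (Fin n)) (α pid : Fin n → Fin n) (y v : Fin n) : ℚ :=
  ∑ s, if (nb s).length = 2 ∧ pid s = pid v then weight G nb pen ws α pid y s * onward G y v s else 0

/-- Linear in the weights, this is `onward_rec` summed over `s`; it determines the loads in order of
decreasing distance from `y`. -/
theorem load_rec (hG : G.Connected) (pen : Fin n → ℕ) (y v : Fin n) :
    load G nb pen ws α pid y v = weight G nb pen ws α pid y v +
      ∑ w, if G.Adj v w ∧ G.dist y w = G.dist y v + 1 then load G nb pen ws α pid y w else 0 := by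
  have e₁ : ∀ s, weight G nb pen ws α pid y s * (onward G y v s : ℚ) =
      (if v = s then weight G nb pen ws α pid y s else 0) +
      ∑ w, if G.Adj v w ∧ G.dist y w = G.dist y v + 1 then
        weight G nb pen ws α pid y s * onward G y w s else 0 := by
    intro s
    rw [onward_rec hG y v s]
    push_cast
    rw [mul_add, Finset.mul_sum]
    congr 1
    · simp
    · exact Finset.sum_congr rfl fun w _ => by split_ifs <;> simp
  rw [load, Finset.sum_congr rfl fun s _ => e₁ s, Finset.sum_add_distrib, Finset.sum_ite_eq,
    if_pos (Finset.mem_univ _), Finset.sum_comm]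
  congr 1
  refine Finset.sum_congr rfl fun w _ => ?_
  split_ifs
  · rfl
  · simp

/-- A neighbour of degree two has the same path as `v`. A branching neighbour is an end of that
path, and by `IsSeg.onward_eq_zero` nothing comes back from there, so it can be dropped from the
recursion. -/
theorem PathCover.ownLoad_rec (hB : IsBiconnected G) (hnb : IsAdjLists G nb)
    (h : PathCover G nb ws α pid) (pen : Fin n → ℕ) {y v : Fin n} (hy : (nb y).length ≠ 2)
    (hv : (nb v).length = 2) :
    ownLoad G nb pen ws α pid y v = weight G nb pen ws α pid y v +
      ∑ w, if G.Adj v w ∧ G.dist y w = G.dist y v + 1 ∧ (nb w).length = 2 then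
        ownLoad G nb pen ws α pid y w else 0 := by
  have hvw := (h.mem v hv).1
  have e₁ : ∀ s, (if (nb s).length = 2 ∧ pid s = pid v then
      weight G nb pen ws α pid y s * (onward G y v s : ℚ) else 0) =
      (if v = s then weight G nb pen ws α pid y s else 0) +
      ∑ w, if G.Adj v w ∧ G.dist y w = G.dist y v + 1 ∧ (nb w).length = 2 then
        (if (nb s).length = 2 ∧ pid s = pid w then
        weight G nb pen ws α pid y s * onward G y w s else 0) else 0 := by
    intro s
    have hpw : ∀ w, G.Adj v w → (nb w).length = 2 → pid w = pid v := fun w hw h2 =>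
      h.pid_eq hvw ((h.mem v hv).2.closed hnb (h.start _ hvw) hw h2)
    by_cases hs : (nb s).length = 2 ∧ pid s = pid v
    · rw [if_pos hs, onward_rec hB.connected y v s]
      push_cast
      rw [mul_add, Finset.mul_sum]
      congr 1
      · simp
      · refine Finset.sum_congr rfl fun w _ => ?_
        by_cases hA : G.Adj v w ∧ G.dist y w = G.dist y v + 1
        · rw [if_pos hA]
          by_cases h2 : (nb w).length = 2
          · rw [if_pos ⟨hA.1, hA.2, h2⟩, if_pos ⟨hs.1, hs.2.trans (hpw w hA.1 h2).symm⟩]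
          · rw [if_neg (by tauto)]
            obtain ⟨i, hi0, hi, hiv⟩ := (h.mem v hv).2
            obtain ⟨r, hr0, hr, hrs⟩ := (h.inPath_iff hvw).mpr hs
            have := ((h.start _ hvw).isSeg hnb).onward_eq_zero hB.connected
              (IsStart.avoids hy) hi0 hi hr0 hr (w := w) (by rw [hiv]; exact hA.1)
              (IsStart.avoids h2) (by rw [hiv]; exact hA.2)
            rw [hrs] at this
            simp [this]
        · rw [if_neg hA, if_neg (by tauto), mul_zero]
    · rw [if_neg hs, if_neg (by rintro rfl; exact hs ⟨hv, rfl⟩), zero_add]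
      symm
      refine Finset.sum_eq_zero fun w _ => ?_
      split_ifs with h₁ h₂
      · exact absurd ⟨h₂.1, h₂.2.trans (hpw w h₁.1 h₁.2.2)⟩ hs
      · rfl
      · rfl
  rw [ownLoad, Finset.sum_congr rfl fun s _ => e₁ s, Finset.sum_add_distrib, Finset.sum_ite_eq,
    if_pos (Finset.mem_univ _), Finset.sum_comm]
  congr 1
  refine Finset.sum_congr rfl fun w _ => ?_
  split_ifs
  · rfl
  · simp

/-- Subtracting the weight of `v` removes the term `s = v`, in accordance with the convention that γ
is zero when `v` is an endpoint. -/
theorem sigma_mul_load_sub (pen : Fin n → ℕ) (y v : Fin n) :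
    (sigma G y v : ℚ) * (load G nb pen ws α pid y v - weight G nb pen ws α pid y v) =
      ∑ s, if s ≠ v then weight G nb pen ws α pid y s * through G s y v else 0 := by
  have h₁ : weight G nb pen ws α pid y v =
      ∑ s, if s = v then weight G nb pen ws α pid y s * onward G y v s else 0 := by
    rw [Finset.sum_ite_eq', if_pos (Finset.mem_univ _)]
    simp [onward, sigma_self]
  rw [h₁, load, ← Finset.sum_sub_distrib, Finset.mul_sum]
  refine Finset.sum_congr rfl fun s _ => ?_
  by_cases hs : s = v
  · simp [hs]
  · rw [if_neg hs, if_pos hs, through_eq_onward]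
    push_cast
    ring

theorem sigma_mul_ownLoad_sub (pen : Fin n → ℕ) (y : Fin n) {v : Fin n}
    (hv : (nb v).length = 2) :
    (sigma G y v : ℚ) * (ownLoad G nb pen ws α pid y v - weight G nb pen ws α pid y v) =
      ∑ s, if s ≠ v ∧ pid s = pid v then
        weight G nb pen ws α pid y s * through G s y v else 0 := by
  have h₁ : weight G nb pen ws α pid y v =
      ∑ s, if s = v then weight G nb pen ws α pid y s * onward G y v s else 0 := by
    rw [Finset.sum_ite_eq', if_pos (Finset.mem_univ _)]
    simp [onward, sigma_self]
  rw [h₁, ownLoad, ← Finset.sum_sub_distrib, Finset.mul_sum]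
  refine Finset.sum_congr rfl fun s _ => ?_
  by_cases hs : s = v
  · subst hs; simp [hv]
  · by_cases hp : pid s = pid v
    · rw [if_neg hs, if_pos (c := s ≠ v ∧ pid s = pid v) ⟨hs, hp⟩, through_eq_onward]
      by_cases h2 : (nb s).length = 2
      · rw [if_pos ⟨h2, hp⟩]
        push_cast
        ring
      · simp [h2, weight]
    · simp [hs, hp]

/-- The loads yield the pairs with `v` not on the path of `t`. The own loads yield the pairs with
`v` on the path of `s`, where the exclusion in `sum_weight` is vacuous because the two paths differ.
Exchanging `s` and `t` turns the latter into exactly the pairs missing from the former. -/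
theorem PathCover.pairSum_eq_sum_load (hB : IsBiconnected G) (hnb : IsAdjLists G nb)
    (h : PathCover G nb ws α pid) (pen : Fin n → ℕ) (v : Fin n) :
    pairSum G pen v = ∑ y, if (nb y).length ≠ 2 then
      (sigma G y v : ℚ) * (load G nb pen ws α pid y v - weight G nb pen ws α pid y v +
        if (nb v).length = 2 then
          ownLoad G nb pen ws α pid y v - weight G nb pen ws α pid y v else 0) else 0 := by
  have hG := hB.connected
  have e₁ : (∑ y, if (nb y).length ≠ 2 then
      (sigma G y v : ℚ) * (load G nb pen ws α pid y v - weight G nb pen ws α pid y v) else 0) =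
      ∑ s, ∑ t, if (nb s).length = 2 ∧ (nb t).length = 2 ∧ pid s ≠ pid t ∧
        ¬ ((nb v).length = 2 ∧ pid v = pid t) then gamma G pen s t v else 0 := by
    simp only [sigma_mul_load_sub, ← Finset.sum_filter (fun y => (nb y).length ≠ 2)]
    rw [Finset.sum_comm]
    refine Finset.sum_congr rfl fun s _ => ?_
    by_cases hs : s = v
    · subst hs
      simp only [ne_eq, not_true_eq_false, if_false, Finset.sum_const_zero]
      symm
      refine Finset.sum_eq_zero fun t _ => ?_
      rw [gamma_eq hG]
      simp
    · rw [← h.sum_weight hB hnb pen hs, Finset.sum_filter]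
      simp [hs]
  have e₂ : (nb v).length = 2 → (∑ y, if (nb y).length ≠ 2 then
      (sigma G y v : ℚ) * (ownLoad G nb pen ws α pid y v - weight G nb pen ws α pid y v) else 0) =
      ∑ s, ∑ t, if (nb s).length = 2 ∧ (nb t).length = 2 ∧ pid s ≠ pid t ∧ pid s = pid v then
        gamma G pen s t v else 0 := by
    intro hv
    simp only [sigma_mul_ownLoad_sub pen _ hv, ← Finset.sum_filter (fun y => (nb y).length ≠ 2)]
    rw [Finset.sum_comm]
    refine Finset.sum_congr rfl fun s _ => ?_
    by_cases hs : s = v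
    · subst hs
      simp only [ne_eq, not_true_eq_false, false_and, if_false, Finset.sum_const_zero]
      symm
      refine Finset.sum_eq_zero fun t _ => ?_
      rw [gamma_eq hG]
      simp
    · by_cases hp : pid s = pid v
      · have h₁ := h.sum_weight hB hnb pen hs
        simp only [ne_eq, hs, not_false_eq_true, hp, and_self, if_true, and_true] at h₁ ⊢
        rw [Finset.sum_filter, h₁]
        refine Finset.sum_congr rfl fun t _ => ?_
        congr 1
        simp [hv]
      · simp [hp]
  rw [pairSum_eq hB hnb h.toPathSys h.mem]
  by_cases hv : (nb v).length = 2
  · simp only [hv, if_true, mul_add]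
    have : ∀ y, (if (nb y).length ≠ 2 then
        (sigma G y v : ℚ) * (load G nb pen ws α pid y v - weight G nb pen ws α pid y v) +
        (sigma G y v : ℚ) * (ownLoad G nb pen ws α pid y v - weight G nb pen ws α pid y v) else 0) =
        (if (nb y).length ≠ 2 then
        (sigma G y v : ℚ) * (load G nb pen ws α pid y v - weight G nb pen ws α pid y v) else 0) +
        (if (nb y).length ≠ 2 then
        (sigma G y v : ℚ) * (ownLoad G nb pen ws α pid y v - weight G nb pen ws α pid y v)
          else 0) := fun y => by split_ifs <;> simp
    rw [Finset.sum_congr rfl fun y _ => this y, Finset.sum_add_distrib, e₁, e₂ hv]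
    have hswap : (∑ s, ∑ t, if (nb s).length = 2 ∧ (nb t).length = 2 ∧ pid s ≠ pid t ∧
        pid s = pid v then gamma G pen s t v else 0) =
        ∑ s, ∑ t, if (nb s).length = 2 ∧ (nb t).length = 2 ∧ pid s ≠ pid t ∧
        pid v = pid t then gamma G pen s t v else 0 := by
      rw [Finset.sum_comm]
      refine Finset.sum_congr rfl fun s _ => Finset.sum_congr rfl fun t _ => ?_
      rw [gamma_comm hG]
      refine if_congr ?_ rfl rfl
      constructor
      · rintro ⟨a, b, c, d⟩; exact ⟨b, a, c.symm, d.symm⟩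
      · rintro ⟨a, b, c, d⟩; exact ⟨b, a, c.symm, d.symm⟩
    rw [hswap, ← Finset.sum_add_distrib]
    refine Finset.sum_congr rfl fun s _ => ?_
    rw [← Finset.sum_add_distrib]
    refine Finset.sum_congr rfl fun t _ => ?_
    by_cases hc : pid v = pid t <;> simp [hc, hv]
  · simp only [hv, if_false, add_zero]
    rw [e₁]
    simp [hv]

end Formula

end BetwCent

/-! ### The program, phase by phase, with its verification. -/

namespace RAM

infixr:60 "⨟" => Prog.seq

/-- The row of a two-dimensional array with `n` columns that belongs to the vertex in register `x`. -/
def IExp.cell (x : ℕ) (e : IExp) : IExp := .add (.arr 2 (.reg x)) e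

/-- The test whether the vertex in register `x` has degree two. -/
def BExp.isTwo (x : ℕ) : BExp :=
  .eq (.sub (.arr 0 (.add (.reg x) (.const 1))) (.arr 0 (.reg x))) (.const 2)

/-- `for w` in the adjacency list of the vertex in register `u` `do body`. -/
def Prog.forNbrs (j w u : ℕ) (body : Prog) : Prog :=
  .forSlice j w 1 (.arr 0 (.reg u)) (.arr 0 (.add (.reg u) (.const 1))) body

end RAM

namespace BetwCent

open RAM

/-! ### The input and the address tables -/

/-- Memory that contains the input together with a table of the multiples of `n` in index array `2`
and a table of halves in index array `3`. -/
structure Ctx {n : ℕ} (nb : Fin n → List (Fin n)) (pen : Fin n → ℕ) (S : State) : Prop where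
  card : S.ireg 0 = n
  off : ∀ v : Fin n, S.iarr 0 (v + 1) = S.iarr 0 v + (nb v).length
  adj : ∀ v : Fin n, ∀ k (hk : k < (nb v).length), S.iarr 1 (S.iarr 0 v + k) = ((nb v)[k] : ℕ)
  pen : ∀ v : Fin n, S.qarr 0 v = pen v
  row : ∀ v : Fin n, S.iarr 2 v = v * n
  half : ∀ m, m ≤ 2 * n → S.iarr 3 m = m / 2

section

variable {n : ℕ} {nb : Fin n → List (Fin n)} {pen : Fin n → ℕ} {S : State}

/-- The program leaves the input and the address tables alone. -/
def keepsCtx (p : Prog) : Bool :=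
  !p.writesIreg 0 && !p.writesIarr 0 && !p.writesIarr 1 && !p.writesIarr 2 && !p.writesIarr 3 &&
    !p.writesQarr 0

theorem Ctx.of_frame {p : Prog} {S' : State} (h : Ctx nb pen S) (hF : Frame p S S')
    (hp : keepsCtx p = true) : Ctx nb pen S' := by
  simp only [keepsCtx, Bool.and_eq_true, Bool.not_eq_true'] at hp
  obtain ⟨⟨⟨⟨⟨h0, h1⟩, h2⟩, h3⟩, h4⟩, h5⟩ := hp
  have e0 := hF.ireg 0 h0
  have e1 := hF.iarr 0 h1
  have e2 := hF.iarr 1 h2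
  have e3 := hF.iarr 2 h3
  have e4 := hF.iarr 3 h4
  have e5 := hF.qarr 0 h5
  constructor
  · rw [e0]; exact h.card
  · rw [e1]; exact h.off
  · rw [e1, e2]; exact h.adj
  · rw [e5]; exact h.pen
  · rw [e3]; exact h.row
  · rw [e4]; exact h.half

theorem Ctx.isTwo_eval (h : Ctx nb pen S) {x : ℕ} {v : Fin n} (hx : S.ireg x = v) :
    (BExp.isTwo x).eval S = decide ((nb v).length = 2) := by
  simp [BExp.isTwo, BExp.eval, IExp.eval, hx, h.off]

/-- Rows of length `n` do not overlap, so work in the row of one vertex leaves all other rows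
intact. -/
theorem cell_inj {v w : Fin n} {i j : ℕ} (hi : i < n) (hj : j < n) :
    (v : ℕ) * n + i = w * n + j ↔ v = w ∧ i = j := by
  constructor
  · intro h
    have h₁ : (v * n + i) / n = (v : ℕ) := by
      rw [mul_comm, Nat.mul_add_div (by omega), Nat.div_eq_of_lt hi, add_zero]
    have h₂ : (w * n + j) / n = (w : ℕ) := by
      rw [mul_comm, Nat.mul_add_div (by omega), Nat.div_eq_of_lt hj, add_zero]
    have h₃ : v = w := by
      rw [h, h₂] at h₁
      exact Fin.ext h₁.symm
    subst h₃
    exact ⟨rfl, by omega⟩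
  · rintro ⟨rfl, rfl⟩; rfl

@[simp] theorem cell_inj_fin {v w x y : Fin n} :
    (v : ℕ) * n + x = w * n + y ↔ v = w ∧ x = y := by
  rw [cell_inj x.2 y.2, Fin.val_inj]

theorem Ends.forNbrs {j w u : ℕ} {body : Prog} {c : ℕ} {Q : State → Prop} (h : Ctx nb pen S)
    (v : Fin n) (Inv : List (Fin n) → State → Prop) (cost : Fin n → ℕ)
    (hu : S.ireg u = v) (hk : keepsCtx body = true) (hbu : body.writesIreg u = false)
    (hj : body.writesIreg j = false) (hne : w ≠ j ∧ w ≠ u ∧ j ≠ u ∧ w ≠ 0 ∧ j ≠ 0)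
    (hInv : ∀ l' S x v, x = j ∨ x = w → Inv l' S → Inv l' (S.setI x v)) (h0 : Inv [] S)
    (hstep : ∀ l₁ (x : Fin n) l₂ S', nb v = l₁ ++ x :: l₂ → S'.ireg w = (x : ℕ) →
      S'.ireg u = (v : ℕ) → Ctx nb pen S' → Frame (Prog.forNbrs j w u body) S S' → Inv l₁ S' →
      Ends body S' (cost x) (Inv (l₁ ++ [x])))
    (hQ : ∀ S', Frame (Prog.forNbrs j w u body) S S' → Inv (nb v) S' → Q S')
    (hc : ((nb v).map (fun x => cost x + 14)).sum + 10 ≤ c) :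
    Ends (Prog.forNbrs j w u body) S c Q := by
  have hk' := hk
  simp only [keepsCtx, Bool.and_eq_true, Bool.not_eq_true'] at hk'
  obtain ⟨⟨⟨⟨⟨k0, k1⟩, k2⟩, k3⟩, k4⟩, k5⟩ := hk'
  have hku : (Prog.forNbrs j w u body).writesIreg u = false := by
    simp [Prog.forNbrs, Prog.forSlice, Prog.writesIreg, hbu, hne.2.1, hne.2.2.1]
  have hkc : keepsCtx (Prog.forNbrs j w u body) = true := by
    simp [keepsCtx, Prog.forNbrs, Prog.forSlice, Prog.writesIreg, Prog.writesIarr, Prog.writesQarr,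
      k0, k1, k2, k3, k4, k5, hne.2.2.2.1, hne.2.2.2.2]
  have hu' : ∀ S', Frame (Prog.forNbrs j w u body) S S' → S'.ireg u = v := fun S' hF =>
    (hF.ireg u hku).trans hu
  have hk0 : (Prog.forNbrs j w u body).writesIarr 0 = false := by
    simp [Prog.forNbrs, Prog.forSlice, Prog.writesIarr, k1]
  refine Ends.forSlice (nb v) Inv cost (b := S.iarr 0 v) (by simp [IExp.eval, hu]) ?_ k2
    (h.adj v) hj hne.1 hInv h0 ?_ hQ ?_
  · intro S' hF
    have := (hF.iarr 0 hk0)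
    simp [IExp.eval, hu' S' hF, this, h.off]
  · intro l₁ x l₂ S' hl hw hF hI
    exact hstep l₁ x l₂ S' hl hw (hu' S' hF) (h.of_frame hF hkc) hF hI
  · simpa [IExp.cost] using hc

/-- Fills the tables of the multiples of `n` and of the halves. -/
def tablesProg : Prog :=
  Prog.forTo 1 0 (.storeI 2 (.add (.reg 1) (.const 1)) (.add (.arr 2 (.reg 1)) (.reg 0)))⨟
  .setI 4 (.add (.reg 0) (.reg 0))⨟
  Prog.forTo 1 4 (.storeI 3 (.add (.reg 1) (.const 2)) (.add (.arr 3 (.reg 1)) (.const 1)))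

theorem getElem?_flatten {β : Type*} (L : List (List β)) (i k : ℕ) (hi : i < L.length)
    (hk : k < L[i].length) :
    L.flatten[((L.take i).map List.length).sum + k]? = some L[i][k] := by
  induction L generalizing i with
  | nil => simp at hi
  | cons l L ih =>
    cases i with
    | zero =>
      simp only [List.getElem_cons_zero] at hk
      simp [List.getElem?_append_left hk]
    | succ i =>
      simp only [List.take_succ_cons, List.map_cons, List.sum_cons, List.flatten_cons,
        List.getElem_cons_succ] at hk ⊢
      rw [List.getElem?_append_right (by omega)]
      have := ih i (by simpa using hi) hk
      rw [← this]
      congr 1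
      omega

theorem ends_tablesProg (nb : Fin n → List (Fin n)) (pen : Fin n → ℕ) :
    Ends tablesProg (inputState nb pen) (100 * n + 100) (Ctx nb pen) := by
  set S := inputState nb pen with hS
  have hn : S.ireg 0 = n := by simp [hS, inputState]
  refine Ends.seq (c₁ := 20 * n + 10) (c₂ := 60 * n + 60) ?_ (by omega)
  refine Ends.forTo (N := n) (fun i S' => ∀ k, k ≤ i → S'.iarr 2 k = k * n) (fun _ => 8) hn rfl rfl
    (by decide) (fun _ _ _ h => h) ?_ ?_ ?_ ?_
  · intro k hk
    simp [show k = 0 by omega, hS, inputState]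
  · intro i S' hi hx hF hI
    refine Ends.block rfl ?_ (by decide)
    intro k hk
    have h0 : S'.ireg 0 = n := (hF.ireg 0 rfl).trans hn
    simp only [Prog.run, IExp.eval, hx, h0, State.storeI_iarr, if_true]
    split_ifs with hki
    · rw [hI i le_rfl, hki]; ring
    · exact hI k (by omega)
  · intro S₁ hF₁ hI₁
    have h0 : S₁.ireg 0 = n := (hF₁.ireg 0 rfl).trans hn
    refine Ends.seq (c₁ := 4) (c₂ := 60 * n + 50) (Ends.block rfl ?_ (by decide)) (by omega)
    set S₂ := (Prog.setI 4 (.add (.reg 0) (.reg 0))).run S₁ with hS₂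
    have h4 : S₂.ireg 4 = 2 * n := by simp [hS₂, Prog.run, IExp.eval, h0, two_mul]
    have hz : ∀ i, S₂.iarr 3 i = 0 := fun i => by
      have := congrFun (hF₁.iarr 3 rfl) i
      simp [hS₂, Prog.run, this, hS, inputState]
    -- The table grows by (i + 2)/2 = i/2 + 1. Entries 0 and 1 are correct from the start because
    -- memory is initially zero, whence the bound `i + 1`.
    refine Ends.forTo (N := 2 * n) (fun i S' => ∀ k, k ≤ i + 1 → S'.iarr 3 k = k / 2) (fun _ => 8) h4
      rfl rfl (by decide) (fun _ _ _ h => h) ?_ ?_ ?_ ?_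
    · intro k hk
      rw [hz]; omega
    · intro i S' hi hx hF hI
      refine Ends.block rfl ?_ (by decide)
      intro k hk
      simp only [Prog.run, IExp.eval, hx, State.storeI_iarr, if_true]
      split_ifs with hki
      · rw [hI i (by omega), hki]; omega
      · exact hI k (by omega)
    · intro S₃ hF₃ hI₃
      have e0 : S₃.iarr 0 = S.iarr 0 := (hF₃.iarr 0 rfl).trans (hF₁.iarr 0 rfl)
      have e1 : S₃.iarr 1 = S.iarr 1 := (hF₃.iarr 1 rfl).trans (hF₁.iarr 1 rfl)
      have e2 : S₃.iarr 2 = S₁.iarr 2 := hF₃.iarr 2 rfl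
      have e3 : S₃.qarr 0 = S.qarr 0 := (hF₃.qarr 0 rfl).trans (hF₁.qarr 0 rfl)
      have e4 : S₃.ireg 0 = S₁.ireg 0 := hF₃.ireg 0 rfl
      have hoff : ∀ i, S.iarr 0 i = (((List.ofFn nb).take i).map List.length).sum := fun i => by
        simp [hS, inputState]
      refine ⟨by rw [e4, h0], fun v => ?_, fun v k hk => ?_, fun v => ?_, fun v => ?_,
        fun m hm => hI₃ m (by omega)⟩
      · rw [e0, hoff, hoff, List.take_add_one]
        simp
      · rw [e0, e1, hoff]
        have := getElem?_flatten (List.ofFn nb) v k (by simp) (by simpa using hk)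
        have hadj : ∀ i, S.iarr 1 i = (((List.ofFn nb).flatten[i]?).map Fin.val).getD 0 := fun i => by
          simp [hS, inputState]
        rw [hadj, this]
        simp
      · rw [e3]; simp [hS, inputState]
      · rw [e2, hI₁ v v.2.le]
    · simp; omega
  · simp; omega

end

end BetwCent

namespace BetwCent

open RAM

/-! ### Finding the paths -/

section Paths

variable {n : ℕ} {G : SimpleGraph (Fin n)} {nb : Fin n → List (Fin n)} {pen : Fin n → ℕ}
  {ws : List (Fin n)} {α : Fin n → Fin n} {S : State}

/-- One step along the path of the vertex in register `3`. -/
def stepProg : Prog :=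
  .storeI 8 (.reg 7) (.add (.reg 3) (.const 1))⨟
  .storeQ 2 (.cell 3 (.reg 8))
    (.add (.arr 2 (.cell 3 (.sub (.reg 8) (.const 1)))) (.arr 0 (.reg 7)))⨟
  .setI 9 (.arr 1 (.arr 0 (.reg 7)))⨟
  .ite (.eq (.reg 9) (.reg 6)) (.setI 9 (.arr 1 (.add (.arr 0 (.reg 7)) (.const 1)))) .skip⨟
  .setI 6 (.reg 7)⨟
  .setI 7 (.reg 9)⨟
  .setI 8 (.add (.reg 8) (.const 1))

/-- Records the path that starts with the vertices in registers `1` and `3`. -/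
def followProg : Prog :=
  (.storeI 4 (.reg 5) (.reg 3)⨟
    .setI 5 (.add (.reg 5) (.const 1))⨟
    .storeI 5 (.reg 3) (.reg 1)⨟
    .storeQ 2 (.cell 3 (.const 0)) (.const 0)⨟
    .setI 6 (.reg 1)⨟
    .setI 7 (.reg 3)⨟
    .setI 8 (.const 1))⨟
  .loop (.isTwo 7) stepProg⨟
  .storeI 6 (.reg 3) (.reg 7)⨟
  .storeI 7 (.reg 3) (.reg 8)

/-- Records all paths. -/
def pathsProg : Prog :=
  .forTo 1 0 (.ite (.isTwo 1) .skip
    (.forNbrs 2 3 1 (.ite (.and (.isTwo 3) (.eq (.arr 8 (.reg 3)) (.const 0))) followProg .skip)))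

/-- The sum of the weights of the first `r` vertices after `p 0`. -/
def prefixSum (pen : Fin n → ℕ) (p : ℕ → Fin n) (r : ℕ) : ℚ :=
  ∑ i ∈ Finset.range r, (pen (p (i + 1)) : ℚ)

/-- The memory contains the system of paths given by `ws` and `α`. -/
structure HoldsPaths (G : SimpleGraph (Fin n)) (nb : Fin n → List (Fin n)) (pen : Fin n → ℕ)
    (ws : List (Fin n)) (α : Fin n → Fin n) (S : State) : Prop where
  sys : PathSys G nb ws α
  count : S.ireg 5 = ws.length
  list : ∀ k (hk : k < ws.length), S.iarr 4 k = (ws[k] : ℕ)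
  first : ∀ w ∈ ws, S.iarr 5 w = α w
  last : ∀ w ∈ ws, S.iarr 6 w = pathVert nb α w (len nb α w)
  length : ∀ w ∈ ws, S.iarr 7 w = len nb α w
  name : ∀ v, ∀ w ∈ ws, InPath nb (α w) w v → S.iarr 8 v = w + 1
  unnamed : ∀ v : Fin n, (∀ w ∈ ws, ¬ InPath nb (α w) w v) → S.iarr 8 v = 0
  sums : ∀ w ∈ ws, ∀ r, r < len nb α w → S.qarr 2 (w * n + r) = prefixSum pen (pathVert nb α w) r

theorem nextVert_eq (hC : Ctx nb pen S) {u v : Fin n} (hv : (nb v).length = 2) :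
    (nextVert nb u v : ℕ) = if S.iarr 1 (S.iarr 0 v) = u then S.iarr 1 (S.iarr 0 v + 1)
      else S.iarr 1 (S.iarr 0 v) := by
  have h0 := hC.adj v 0 (by omega)
  have h1 := hC.adj v 1 (by omega)
  rw [add_zero] at h0
  rw [h0, h1, nextVert, List.getD_eq_getElem _ _ (by omega), List.getD_eq_getElem _ _ (by omega)]
  simp only [Fin.val_inj]
  split_ifs <;> rfl

/-- The state of the walk along the path `a`, `w` after `i - 1` steps. -/
structure OnPath (nb : Fin n → List (Fin n)) (pen : Fin n → ℕ) (a w : Fin n) (S₀ : State) (i : ℕ)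
    (S : State) : Prop where
  prev : S.ireg 6 = walkSeq nb a w (i - 1)
  cur : S.ireg 7 = walkSeq nb a w i
  pos : S.ireg 8 = i
  marked : ∀ r, 0 < r → r < i → S.iarr 8 (walkSeq nb a w r) = w + 1
  others : ∀ v : Fin n, (∀ r, 0 < r → r < i → walkSeq nb a w r ≠ v) → S.iarr 8 v = S₀.iarr 8 v
  sums : ∀ r, r < i → S.qarr 2 (w * n + r) = prefixSum pen (walkSeq nb a w) r
  rows : ∀ w' : Fin n, w' ≠ w → ∀ r, r < n → S.qarr 2 (w' * n + r) = S₀.qarr 2 (w' * n + r)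

theorem ends_stepProg (hnb : IsAdjLists G nb) (hC : Ctx nb pen S) {a w : Fin n}
    (hs : IsStart G nb a w) {S₀ : State} {i : ℕ} (h0 : 0 < i) (hi : i < pathLen nb a w)
    (hw : S.ireg 3 = w) (h : OnPath nb pen a w S₀ i S) :
    Ends stepProg S 100 (OnPath nb pen a w S₀ (i + 1)) := by
  have hin : i < n := hi.trans_le (pathLen_le hnb hs)
  have h2 := two_of_lt_pathLen h0 hi
  obtain ⟨j, rfl⟩ : ∃ j, i = j + 1 := ⟨i - 1, by omega⟩
  have hprev := h.prev
  have hnext := nextVert_eq hC h2 (u := walkSeq nb a w j)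
  rw [Nat.add_sub_cancel] at hprev
  refine Ends.block rfl ?_ (by decide)
  have hrow := hC.row w
  have hpen := hC.pen (walkSeq nb a w (j + 1))
  have hne : walkSeq nb a w (j + 1 + 1) = nextVert nb (walkSeq nb a w j) (walkSeq nb a w (j + 1)) :=
    rfl
  constructor
  · simp [stepProg, Prog.run, IExp.eval, BExp.eval, h.cur]
  · rw [hne, hnext]
    simp [stepProg, Prog.run, IExp.eval, BExp.eval, h.cur, hprev]
  · simp [stepProg, Prog.run, IExp.eval, BExp.eval, h.pos]
  · intro r hr0 hr
    by_cases hrj : walkSeq nb a w r = walkSeq nb a w (j + 1)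
    · simp [stepProg, Prog.run, IExp.eval, BExp.eval, h.cur, hw, hrj]
    · have := h.marked r hr0 (by
        rcases Nat.lt_succ_iff_lt_or_eq.mp hr with h | rfl
        · exact h
        · exact absurd rfl hrj)
      simp [stepProg, Prog.run, IExp.eval, BExp.eval, h.cur, this, Fin.val_inj, hrj]
  · intro v hv
    have h₁ := h.others v fun r hr0 hr => hv r hr0 (by omega)
    have h₂ : v ≠ walkSeq nb a w (j + 1) := (hv (j + 1) (by omega) (by omega)).symm
    simp [stepProg, Prog.run, IExp.eval, BExp.eval, h.cur, h₁, Fin.val_inj, h₂]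
  · intro r hr
    by_cases hrj : r = j + 1
    · subst hrj
      have hj : S.qarr 2 (w * n + j) = prefixSum pen (walkSeq nb a w) j := h.sums j (by omega)
      have hps : prefixSum pen (walkSeq nb a w) (j + 1) =
          prefixSum pen (walkSeq nb a w) j + pen (walkSeq nb a w (j + 1)) :=
        Finset.sum_range_succ _ _
      simp [stepProg, Prog.run, IExp.eval, BExp.eval, IExp.cell, QExp.eval, h.cur, h.pos, hw, hrow,
        hpen, hj, hps]
    · have := h.sums r (by omega)
      simp [stepProg, Prog.run, IExp.eval, BExp.eval, IExp.cell, QExp.eval, h.pos, hw, hrow, hrj,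
        this]
  · intro w' hne r hr
    have := h.rows w' hne r hr
    have hcell : ¬ ((w' : ℕ) * n + r = w * n + (j + 1)) := by
      rw [cell_inj hr hin]; tauto
    simp [stepProg, Prog.run, IExp.eval, BExp.eval, IExp.cell, QExp.eval, h.pos, hw, hrow, hcell,
      this]

/-- The walk takes at most `n` steps of constant time. Names are stored as `w + 1`, so that zero
means unmarked. -/
theorem ends_followProg (hnb : IsAdjLists G nb) (hC : Ctx nb pen S)
    (h : HoldsPaths G nb pen ws α S) {a w : Fin n} (hs : IsStart G nb a w)
    (hw : ∀ w' ∈ ws, ¬ InPath nb (α w') w' w) (ha : S.ireg 1 = a) (hw3 : S.ireg 3 = w) :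
    Ends followProg S (200 * n + 200)
      (HoldsPaths G nb pen (ws ++ [w]) (Function.update α w a)) := by
  have hl := one_lt_pathLen hnb hs
  have hln := pathLen_le hnb hs
  have hrow := hC.row w
  have hmem : w ∉ ws := fun hmem => hw w hmem ((h.sys.start w hmem).inPath hnb)
  refine Ends.seq (c₁ := 50) (c₂ := 200 * n + 120) (Ends.block rfl ?_ (by decide)) (by omega)
  set S₁ := Prog.run _ S with hS₁
  have hC₁ : Ctx nb pen S₁ := by
    obtain ⟨T, S', hE, -, rfl⟩ := Ends.block (Q := fun S' => S' = S₁) (S := S)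
      (p := (Prog.storeI 4 (.reg 5) (.reg 3)⨟ .setI 5 (.add (.reg 5) (.const 1))⨟
        .storeI 5 (.reg 3) (.reg 1)⨟ .storeQ 2 (.cell 3 (.const 0)) (.const 0)⨟
        .setI 6 (.reg 1)⨟ .setI 7 (.reg 3)⨟ .setI 8 (.const 1))) rfl rfl le_rfl
    exact hC.of_frame hE.frame rfl
  have hr3 : S₁.ireg 3 = w := by simp [hS₁, Prog.run, IExp.eval, hw3]
  have hr5 : S₁.ireg 5 = ws.length + 1 := by simp [hS₁, Prog.run, IExp.eval, h.count]
  have h4 : ∀ k, S₁.iarr 4 k = if k = ws.length then (w : ℕ) else S.iarr 4 k := fun k => by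
    simp [hS₁, Prog.run, IExp.eval, h.count, hw3]
  have h5 : ∀ v : Fin n, S₁.iarr 5 v = if v = w then (a : ℕ) else S.iarr 5 v := fun v => by
    simp [hS₁, Prog.run, IExp.eval, ha, hw3, Fin.val_inj]
  have h6 : S₁.iarr 6 = S.iarr 6 := by funext; simp [hS₁, Prog.run]
  have h7 : S₁.iarr 7 = S.iarr 7 := by funext; simp [hS₁, Prog.run]
  have h8 : S₁.iarr 8 = S.iarr 8 := by funext; simp [hS₁, Prog.run]
  have hon : OnPath nb pen a w S 1 S₁ := by
    refine ⟨?_, ?_, ?_, fun r h0 h1 => by omega, fun v _ => by rw [h8], fun r hr => ?_,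
      fun w' hne r hr => ?_⟩
    · simp [hS₁, Prog.run, IExp.eval, ha, walkSeq]
    · simp [hS₁, Prog.run, IExp.eval, hw3, walkSeq]
    · simp [hS₁, Prog.run, IExp.eval]
    · simp [hS₁, Prog.run, IExp.eval, IExp.cell, QExp.eval, hw3, hrow, show r = 0 by omega,
        prefixSum]
    · have hcell : ¬ ((w' : ℕ) * n + r = w * n + 0) := by
        rw [cell_inj hr (by omega)]; tauto
      rw [add_zero] at hcell
      simp [hS₁, Prog.run, IExp.eval, IExp.cell, QExp.eval, hw3, hrow, hcell]
  clear_value S₁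
  refine Ends.seq (c₁ := 150 * n + 100) (c₂ := 20) ?_ (by omega)
  refine Ends.loop (fun c S' => ∃ i, 0 < i ∧ i ≤ pathLen nb a w ∧ Frame stepProg S₁ S' ∧
    OnPath nb pen a w S i S' ∧ (pathLen nb a w - i) * 150 + 100 ≤ c) ?_
    ⟨1, one_pos, hl.le, .refl _ _, hon, ?_⟩
  · rintro c S' ⟨i, h0, hi, hF, hP, hc⟩
    have hC' := hC₁.of_frame hF rfl
    have h3' : S'.ireg 3 = w := (hF.ireg 3 rfl).trans hr3
    rw [hC'.isTwo_eval hP.cur]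
    rcases hi.eq_or_lt with rfl | hlt
    · refine .inl ⟨by simpa using (pathLen_spec hnb hs).2,
        by simp only [BExp.isTwo, BExp.cost, IExp.cost]; omega, ?_⟩
      refine Ends.block rfl ?_ (by decide)
      have hα : ∀ w' ∈ ws, Function.update α w a w' = α w' := fun w' hw' =>
        Function.update_of_ne (by rintro rfl; exact hmem hw') _ _
      have hwne : ∀ w' ∈ ws, w' ≠ w := by rintro w' hw' rfl; exact hmem hw'
      have e4 := hF.iarr 4 rfl
      have e5 := hF.iarr 5 rfl
      have e6 := hF.iarr 6 rfl
      have e7 := hF.iarr 7 rfl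
      have eα : Function.update α w a w = a := Function.update_self _ _ _
      have hsys := h.sys.append hnb hs hw
      simp only [Prog.run, IExp.eval, h3', hP.cur, hP.pos, State.storeI_ireg]
      refine ⟨hsys, ?_, ?_, ?_, ?_, ?_, ?_, ?_, ?_⟩
      · simp [hF.ireg 5 rfl, hr5]
      · intro k hk
        simp only [List.length_append, List.length_singleton] at hk
        simp only [State.storeI_iarr, e4, h4]
        by_cases hkl : k = ws.length
        · subst hkl; simp
        · rw [List.getElem_append_left (by omega)]
          simp [hkl, h.list k (by omega)]
      · intro w' hw'
        rcases List.mem_append.mp hw' with m | m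
        · simp [e5, h5, hwne w' m, h.first w' m]
        · simp only [List.mem_singleton] at m
          subst m
          simp [e5, h5]
      · intro w' hw'
        rcases List.mem_append.mp hw' with m | m
        · simp [e6, h6, Fin.val_inj, hwne w' m, h.last w' m, pathVert, len]
        · simp only [List.mem_singleton] at m
          subst m
          simp [pathVert, len]
      · intro w' hw'
        rcases List.mem_append.mp hw' with m | m
        · simp [e7, h7, Fin.val_inj, hwne w' m, h.length w' m, len]
        · simp only [List.mem_singleton] at m
          subst m
          simp [len]
      · intro v w' hw' hv
        simp only [State.storeI_iarr]
        rcases List.mem_append.mp hw' with m | m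
        · rw [hα w' m] at hv
          -- An inner vertex of an older path is not overwritten: if the new walk met it, the
          -- unmarked `w` would belong to the older path.
          have := hP.others v fun r hr0 hr he => hw w' m
            (InPath.start_inPath hnb hs (h.sys.start w' m) ⟨r, hr0, hr, he⟩ hv)
          simp [this, h.name v w' m hv]
        · simp only [List.mem_singleton] at m
          subst m
          rw [eα] at hv
          obtain ⟨r, hr0, hr, rfl⟩ := hv
          simp [hP.marked r hr0 hr]
      · intro v hv
        have h₁ := h.unnamed v fun w' m => by
          have := hv w' (List.mem_append_left _ m)
          rwa [hα w' m] at this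
        have h₂ := hv w (by simp)
        rw [eα] at h₂
        have := hP.others v fun r hr0 hr he => h₂ ⟨r, hr0, hr, he⟩
        simp [this, h₁]
      · intro w' hw' r hr
        simp only [State.storeI_qarr]
        rcases List.mem_append.mp hw' with m | m
        · simp only [len, pathVert, hα w' m] at hr ⊢
          rw [hP.rows w' (hwne w' m) r (hr.trans_le (pathLen_le hnb (h.sys.start w' m)))]
          exact h.sums w' m r hr
        · simp only [List.mem_singleton] at m
          subst m
          simp only [len, pathVert, eα] at hr ⊢
          exact hP.sums r hr
    · refine .inr ⟨by simpa using two_of_lt_pathLen h0 hlt, 100,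
        (pathLen nb a w - (i + 1)) * 150 + 100,
        by simp only [BExp.isTwo, BExp.cost, IExp.cost]; omega, ?_⟩
      exact (ends_stepProg hnb hC' hs h0 hlt h3' hP).frame.mono le_rfl fun S'' ⟨hF', hP'⟩ =>
        ⟨i + 1, by omega, hlt, hF.trans hF', hP', le_rfl⟩
  · omega

theorem HoldsPaths.setI (h : HoldsPaths G nb pen ws α S) {x v : ℕ} (hx : 5 ≠ x) :
    HoldsPaths G nb pen ws α (S.setI x v) :=
  ⟨h.sys, by simpa [hx] using h.count, h.list, h.first, h.last, h.length, h.name, h.unnamed, h.sums⟩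

/-- The time for recording all paths. -/
theorem ends_pathsProg (hnb : IsAdjLists G nb) (hC : Ctx nb pen S)
    (h : HoldsPaths G nb pen [] id S) :
    Ends pathsProg S (∑ i : Fin n, (if (nb i).length = 2 then 40
      else (nb i).length * (200 * n + 300) + 60) + 10) (fun S' => ∃ ws α,
        HoldsPaths G nb pen ws α S' ∧
        ∀ a w, IsStart G nb a w → ∃ w' ∈ ws, InPath nb (α w') w' w) := by
  refine Ends.forTo (N := n) (fun i S' => ∃ ws α, HoldsPaths G nb pen ws α S' ∧
      ∀ a w : Fin n, (a : ℕ) < i → IsStart G nb a w → ∃ w' ∈ ws, InPath nb (α w') w' w)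
    (fun i => if hi : i < n then (if (nb ⟨i, hi⟩).length = 2 then 30
      else (nb ⟨i, hi⟩).length * (200 * n + 300) + 50) else 0) hC.card rfl rfl (by decide)
    ?_ ⟨[], id, h, by simp⟩ ?_ ?_ ?_
  · rintro i S' v ⟨ws, α, h₁, h₂⟩
    exact ⟨ws, α, h₁.setI (by decide), h₂⟩
  · rintro i S₁ hi hx hF ⟨ws, α, h₁, h₂⟩
    have hC₁ := hC.of_frame hF rfl
    rw [dif_pos hi]
    refine Ends.ite (c₁ := 1) (c₂ := (nb ⟨i, hi⟩).length * (200 * n + 300) + 10) ?_ ?_ ?_ ?_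
    · intro hb
      rw [hC₁.isTwo_eval (v := ⟨i, hi⟩) hx] at hb
      refine Ends.block rfl ⟨ws, α, h₁, fun a w ha hs => ?_⟩ (by decide)
      rcases Nat.lt_succ_iff_lt_or_eq.mp ha with ha | ha
      · exact h₂ a w ha hs
      · have : a = ⟨i, hi⟩ := Fin.ext ha
        subst this
        exact absurd (by simpa using hb) hs.branch
    · intro hb
      rw [hC₁.isTwo_eval (v := ⟨i, hi⟩) hx] at hb
      simp only [decide_eq_false_iff_not] at hb
      refine Ends.forNbrs hC₁ ⟨i, hi⟩ (fun l S' => ∃ ws α, HoldsPaths G nb pen ws α S' ∧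
        (∀ a w : Fin n, (a : ℕ) < i → IsStart G nb a w → ∃ w' ∈ ws, InPath nb (α w') w' w) ∧
        ∀ w ∈ l, IsStart G nb ⟨i, hi⟩ w → ∃ w' ∈ ws, InPath nb (α w') w' w)
        (fun _ => 200 * n + 250) hx rfl rfl rfl (by decide) ?_ ⟨ws, α, h₁, h₂, by simp⟩ ?_ ?_ ?_
      · rintro l S' x v hx ⟨ws, α, h₁, h₂⟩
        exact ⟨ws, α, h₁.setI (by omega), h₂⟩
      · rintro l₁ w l₂ S' hl hw hu hC' hF' ⟨ws, α, h₁, h₂, h₃⟩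
        have hadj : G.Adj ⟨i, hi⟩ w := by
          rw [← (hnb _).2, hl]; simp
        have hev : (BExp.and (.isTwo 3) (.eq (.arr 8 (.reg 3)) (.const 0))).eval S' = true ↔
            (nb w).length = 2 ∧ S'.iarr 8 w = 0 := by
          rw [BExp.eval, hC'.isTwo_eval hw]
          simp [BExp.eval, IExp.eval, hw]
        refine Ends.ite (c₁ := 200 * n + 200) (c₂ := 1) ?_ ?_ ?_ ?_
        · intro hb'
          rw [hev] at hb'
          have hs : IsStart G nb ⟨i, hi⟩ w := ⟨hb, hadj, hb'.1⟩
          have hnot : ∀ w' ∈ ws, ¬ InPath nb (α w') w' w := fun w' hw' hin => by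
            have := h₁.name w w' hw' hin
            omega
          have hmem : w ∉ ws := fun hmem => hnot w hmem ((h₁.sys.start w hmem).inPath hnb)
          have hα : ∀ w' ∈ ws, Function.update α w ⟨i, hi⟩ w' = α w' := fun w' hw' =>
            Function.update_of_ne (by rintro rfl; exact hmem hw') _ _
          have hkeep : ∀ x, (∃ w' ∈ ws, InPath nb (α w') w' x) → ∃ w' ∈ ws ++ [w],
              InPath nb (Function.update α w ⟨i, hi⟩ w') w' x := by
            rintro x ⟨w', hw', hin⟩
            exact ⟨w', List.mem_append_left _ hw', by rwa [hα w' hw']⟩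
          refine (ends_followProg hnb hC' h₁ hs hnot hu hw).mono le_rfl fun S'' h₁' =>
            ⟨_, _, h₁', fun a x ha hs' => hkeep x (h₂ a x ha hs'), fun x hx hs' => ?_⟩
          rcases List.mem_append.mp hx with m | m
          · exact hkeep x (h₃ x m hs')
          · simp only [List.mem_singleton] at m
            subst m
            exact ⟨x, by simp, by rw [Function.update_self]; exact hs.inPath hnb⟩
        · intro hb'
          refine Ends.block rfl ⟨ws, α, h₁, h₂, fun x hx hs' => ?_⟩ le_rfl
          rcases List.mem_append.mp hx with m | m
          · exact h₃ x m hs'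
          · simp only [List.mem_singleton] at m
            subst m
            -- If `x` starts a path but is not covered, it is unmarked, so the test would have
            -- succeeded.
            by_contra hcon
            push Not at hcon
            have := hev.mpr ⟨hs'.two, h₁.unnamed x hcon⟩
            rw [this] at hb'
            exact absurd hb' (by decide)
        · intro; simp only [BExp.isTwo, BExp.cost, IExp.cost]; omega
        · intro; simp only [BExp.isTwo, BExp.cost, IExp.cost]; omega
      · rintro S' hF' ⟨ws, α, h₁, h₂, h₃⟩
        refine ⟨ws, α, h₁, fun a w ha hs => ?_⟩
        rcases Nat.lt_succ_iff_lt_or_eq.mp ha with ha | ha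
        · exact h₂ a w ha hs
        · have : a = ⟨i, hi⟩ := Fin.ext ha
          subst this
          exact h₃ w (((hnb _).2 w).mpr hs.adj) hs
      · simp only [List.map_const', List.sum_replicate, smul_eq_mul]
        exact Nat.add_le_add_right (Nat.mul_le_mul_left _ (by omega)) _
    · intro hb
      rw [hC₁.isTwo_eval (v := ⟨i, hi⟩) hx] at hb
      rw [if_pos (by simpa using hb)]
      simp only [BExp.isTwo, BExp.cost, IExp.cost]; omega
    · intro hb
      rw [hC₁.isTwo_eval (v := ⟨i, hi⟩) hx] at hb
      rw [if_neg (by simpa using hb)]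
      simp only [BExp.isTwo, BExp.cost, IExp.cost]; omega
  · rintro S' hF ⟨ws, α, h₁, h₂⟩
    exact ⟨ws, α, h₁, fun a w hs => h₂ a w a.2 hs⟩
  · rw [Finset.sum_range]
    have : ∑ i : Fin n, ((if hi : (i : ℕ) < n then (if (nb ⟨i, hi⟩).length = 2 then 30
        else (nb ⟨i, hi⟩).length * (200 * n + 300) + 50) else 0) + 8) ≤
        ∑ i : Fin n, (if (nb i).length = 2 then 40
        else (nb i).length * (200 * n + 300) + 60) := by
      refine Finset.sum_le_sum fun i _ => ?_
      rw [dif_pos i.2, Fin.eta]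
      split_ifs <;> omega
    omega

end Paths

end BetwCent

namespace BetwCent

open RAM

/-! ### Breadth-first search -/

section Bfs

variable {n : ℕ} {G : SimpleGraph (Fin n)} {nb : Fin n → List (Fin n)} {pen : Fin n → ℕ}
  {S : State} {x : Fin n}

/-- `q` is a possible queue of a breadth-first search from `x` of which the first `i` entries have
been processed. -/
structure IsBfs (G : SimpleGraph (Fin n)) (x : Fin n) (i : ℕ) (q : List (Fin n)) : Prop where
  nodup : q.Nodup
  source : x ∈ q
  le : i ≤ q.length
  sorted : q.Pairwise (fun u v => G.dist x u ≤ G.dist x v)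
  closed : ∀ u ∈ q.take i, ∀ w, G.Adj u w → w ∈ q
  near : ∀ hi : i < q.length, ∀ v ∈ q, G.dist x v ≤ G.dist x q[i] + 1

theorem IsBfs.init (x : Fin n) : IsBfs G x 0 [x] :=
  ⟨List.nodup_singleton _, by simp, by simp, by simp, by simp, by simp⟩

variable {i : ℕ} {q : List (Fin n)}

theorem IsBfs.mem_take (h : IsBfs G x i q) (hi : i < q.length) {z : Fin n} (hz : z ∈ q)
    (hd : G.dist x z < G.dist x q[i]) : z ∈ q.take i := by
  obtain ⟨k, hk, rfl⟩ := List.getElem_of_mem hz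
  have : k < i := by
    by_contra hcon
    rcases (show i ≤ k by omega).eq_or_lt with he | hlt
    · subst he; omega
    · have := List.pairwise_iff_getElem.mp h.sorted i k hi hk hlt
      omega
  exact List.mem_take_iff_getElem.mpr ⟨k, by omega, rfl⟩

/-- Induction on the distance: a predecessor of `z` is nearer than the head, so it stands before the
head in the sorted queue and its neighbours have already been added. Hence a newly found neighbour
of the head is exactly one step farther than the head. -/
theorem IsBfs.mem_of_dist_le (hG : G.Connected) (h : IsBfs G x i q) (hi : i < q.length) {z : Fin n}
    (hd : G.dist x z ≤ G.dist x q[i]) : z ∈ q := by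
  induction hm : G.dist x z generalizing z with
  | zero =>
    rw [hG.dist_eq_zero_iff] at hm
    exact hm ▸ h.source
  | succ m ih =>
    have hne : x ≠ z := by rintro rfl; simp at hm
    obtain ⟨u, hu, hdu⟩ := exists_adj_dist_add_one hG hne
    have := ih (z := u) (by omega) (by omega)
    exact h.closed u (h.mem_take hi this (by omega)) z hu.symm

theorem IsBfs.dist_eq (hG : G.Connected) (h : IsBfs G x i q) (hi : i < q.length) {w : Fin n}
    (hw : w ∉ q) (hadj : G.Adj q[i] w) : G.dist x w = G.dist x q[i] + 1 := by
  have h₁ := dist_le_dist_add_one hG hadj x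
  have h₂ : ¬ G.dist x w ≤ G.dist x q[i] := fun hle => hw (h.mem_of_dist_le hG hi hle)
  omega

theorem IsBfs.append (hG : G.Connected) (h : IsBfs G x i q) (hi : i < q.length) {w : Fin n}
    (hw : w ∉ q) (hadj : G.Adj q[i] w) : IsBfs G x i (q ++ [w]) := by
  have hd := h.dist_eq hG hi hw hadj
  refine ⟨?_, by simp [h.source], by simp; omega, ?_, ?_, ?_⟩
  · rw [List.nodup_append]
    refine ⟨h.nodup, List.nodup_singleton _, ?_⟩
    rintro a ha b hb rfl
    simp only [List.mem_singleton] at hb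
    exact hw (hb ▸ ha)
  · rw [List.pairwise_append]
    refine ⟨h.sorted, List.pairwise_singleton _ _, ?_⟩
    intro a ha b hb
    simp only [List.mem_singleton] at hb
    subst hb
    rw [hd]
    exact h.near hi a ha
  · intro u hu z hz
    rw [List.take_append_of_le_length hi.le] at hu
    exact List.mem_append_left _ (h.closed u hu z hz)
  · intro hi' v hv
    rw [List.getElem_append_left hi]
    rcases List.mem_append.mp hv with m | m
    · exact h.near hi v m
    · simp only [List.mem_singleton] at m
      subst m
      omega

theorem IsBfs.step (h : IsBfs G x i q) (hi : i < q.length)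
    (hall : ∀ w, G.Adj q[i] w → w ∈ q) : IsBfs G x (i + 1) q := by
  refine ⟨h.nodup, h.source, hi, h.sorted, ?_, ?_⟩
  · intro u hu w hw
    rw [List.take_add_one, List.mem_append, List.getElem?_eq_getElem hi] at hu
    rcases hu with hu | hu
    · exact h.closed u hu w hw
    · simp only [Option.toList_some, List.mem_singleton] at hu
      subst hu
      exact hall w hw
  · intro hi' v hv
    have h₁ := h.near hi v hv
    have h₂ := List.pairwise_iff_getElem.mp h.sorted i (i + 1) hi hi' (by omega)
    omega

theorem IsBfs.mem_of_eq (hG : G.Connected) (h : IsBfs G x i q) (hi : i = q.length) (v : Fin n) :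
    v ∈ q := by
  subst hi
  refine mem_of_reachable (P := fun v => v ∈ q) (fun u v hu huv => ?_)
    (hG.preconnected x v) h.source
  exact h.closed u (by simpa using hu) v huv

theorem length_eq_of_forall_mem (hq : q.Nodup) (h : ∀ v, v ∈ q) : q.length = n := by
  rw [← List.toFinset_card_of_nodup hq, show q.toFinset = Finset.univ by ext; simp [h]]
  simp

theorem IsBfs.lt_length (hG : G.Connected) (h : IsBfs G x i q) (hi : i < n) : i < q.length := by
  rcases h.le.eq_or_lt with he | hlt
  · have := length_eq_of_forall_mem h.nodup (h.mem_of_eq hG he)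
    omega
  · exact hlt

theorem IsBfs.forall_mem (hG : G.Connected) (h : IsBfs G x n q) (v : Fin n) : v ∈ q := by
  refine h.mem_of_eq hG (le_antisymm h.le ?_) v
  simpa using h.nodup.length_le_card

/-- Examines the neighbour in register `3` of the vertex in register `12`. -/
def visitProg : Prog :=
  .ite (.eq (.arr 9 (.cell 1 (.reg 3))) (.const 0))
    (.storeI 9 (.cell 1 (.reg 3)) (.add (.arr 9 (.cell 1 (.reg 12))) (.const 1))⨟
      .storeI 10 (.cell 1 (.reg 10)) (.reg 3)⨟
      .setI 10 (.add (.reg 10) (.const 1)))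
    .skip

/-- Breadth-first search from the vertex in register `1`. -/
def bfsProg : Prog :=
  (.storeI 9 (.cell 1 (.reg 1)) (.const 1)⨟
    .storeI 10 (.cell 1 (.const 0)) (.reg 1)⨟
    .setI 10 (.const 1))⨟
  .forTo 11 0 (.setI 12 (.arr 10 (.cell 1 (.reg 11)))⨟ .forNbrs 2 3 12 visitProg)

/-- The memory contains the queue `q` of a search from `x` and the distances of its entries. -/
structure HoldsQueue (G : SimpleGraph (Fin n)) (x : Fin n) (S₀ : State) (q : List (Fin n))
    (S : State) : Prop where
  tail : S.ireg 10 = q.length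
  queue : ∀ k (hk : k < q.length), S.iarr 10 (x * n + k) = (q[k] : ℕ)
  dist : ∀ v ∈ q, S.iarr 9 (x * n + v) = G.dist x v + 1
  fresh : ∀ v ∉ q, S.iarr 9 (x * n + v) = 0
  dist_rows : ∀ y : Fin n, y ≠ x → ∀ v : Fin n, S.iarr 9 (y * n + v) = S₀.iarr 9 (y * n + v)
  queue_rows : ∀ y : Fin n, y ≠ x → ∀ k, k < n → S.iarr 10 (y * n + k) = S₀.iarr 10 (y * n + k)

theorem HoldsQueue.setI {S₀ : State} (h : HoldsQueue G x S₀ q S) {y v : ℕ} (hy : 10 ≠ y) :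
    HoldsQueue G x S₀ q (S.setI y v) :=
  ⟨by simpa [hy] using h.tail, h.queue, h.dist, h.fresh, h.dist_rows, h.queue_rows⟩

/-- Distances are stored increased by one, so that zero means unvisited. A repetition-free queue has
at most `n` entries and thus stays within its row. -/
theorem ends_visitProg (hG : G.Connected) (hC : Ctx nb pen S) {S₀ : State}
    (hx : S.ireg 1 = x) (h : HoldsQueue G x S₀ q S) (hq : IsBfs G x i q) (hi : i < q.length)
    {w : Fin n} (hw : S.ireg 3 = w) (hu : S.ireg 12 = q[i]) (hadj : G.Adj q[i] w) :
    Ends visitProg S 60 (fun S' => ∃ r, HoldsQueue G x S₀ (q ++ r) S' ∧ IsBfs G x i (q ++ r) ∧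
      w ∈ q ++ r) := by
  refine Ends.block rfl ?_ (by decide)
  have hrow := hC.row x
  have hdu := h.dist q[i] (List.getElem_mem hi)
  by_cases hmem : w ∈ q
  · have hdw := h.dist w hmem
    have : visitProg.run S = S := by
      simp [visitProg, Prog.run, BExp.eval, IExp.eval, IExp.cell, hx, hw, hrow, hdw]
    rw [this]
    exact ⟨[], by simpa using h, by simpa using hq, by simpa using hmem⟩
  · have hdw := h.fresh w hmem
    have hd := hq.dist_eq hG hi hmem hadj
    have hlen : q.length < n := by
      have := (hq.append hG hi hmem hadj).nodup.length_le_card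
      simp at this
      omega
    refine ⟨[w], ?_, hq.append hG hi hmem hadj, by simp⟩
    have hrun : visitProg.run S = ((S.storeI 9 (x * n + w) (G.dist x w + 1)).storeI 10
        (x * n + q.length) w).setI 10 (q.length + 1) := by
      simp [visitProg, Prog.run, BExp.eval, IExp.eval, IExp.cell, hx, hw, hrow, hdw, hu, h.tail,
        hdu, hd]
    rw [hrun]
    refine ⟨by simp, ?_, ?_, ?_, ?_, ?_⟩
    · intro k hk
      simp only [List.length_append, List.length_singleton] at hk
      by_cases hkl : k = q.length
      · subst hkl; simp
      · rw [List.getElem_append_left (by omega)]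
        simp [hkl, h.queue k (by omega)]
    · intro v hv
      by_cases hvw : v = w
      · subst hvw; simp
      · have : v ∈ q := by simpa [hvw] using hv
        simp [hvw, h.dist v this, Fin.val_inj]
    · intro v hv
      simp only [List.mem_append, List.mem_singleton, not_or] at hv
      simp [hv.2, h.fresh v hv.1, Fin.val_inj]
    · intro y hy v
      simp [hy, h.dist_rows y hy v]
    · intro y hy k hk
      have : ¬ ((y : ℕ) * n + k = x * n + q.length) := by
        rw [cell_inj hk hlen]; tauto
      simp [this, h.queue_rows y hy k hk]

theorem ends_bfsProg (hG : G.Connected) (hnb : IsAdjLists G nb) (hC : Ctx nb pen S)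
    (hx : S.ireg 1 = x) (h0 : ∀ v : Fin n, S.iarr 9 (x * n + v) = 0) :
    Ends bfsProg S (∑ v, (80 * (nb v).length + 40) + 50)
      (fun S' => ∃ q, HoldsQueue G x S q S' ∧ IsBfs G x n q) := by
  have hrow := hC.row x
  refine Ends.seq (c₁ := 20) (c₂ := ∑ v, (80 * (nb v).length + 40) + 10)
    (Ends.block rfl ?_ (by decide)) (by omega)
  set S₁ := Prog.run _ S with hS₁
  have hrun : S₁ = ((S.storeI 9 (x * n + x) 1).storeI 10 (x * n) x).setI 10 1 := by
    simp [hS₁, Prog.run, IExp.eval, IExp.cell, hx, hrow]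
  have hC₁ : Ctx nb pen S₁ := by
    obtain ⟨T, S', hE, -, rfl⟩ := Ends.block (Q := fun S' => S' = S₁) (S := S)
      (p := (.storeI 9 (.cell 1 (.reg 1)) (.const 1)⨟
        .storeI 10 (.cell 1 (.const 0)) (.reg 1)⨟ .setI 10 (.const 1))) rfl rfl le_rfl
    exact hC.of_frame hE.frame rfl
  have hx₁ : S₁.ireg 1 = x := by simp [hrun, hx]
  have hH₁ : HoldsQueue G x S [x] S₁ := by
    rw [hrun]
    refine ⟨by simp, ?_, ?_, ?_, ?_, ?_⟩
    · intro k hk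
      have : k = 0 := by simpa using hk
      subst this; simp
    · intro v hv
      have : v = x := by simpa using hv
      subst this; simp
    · intro v hv
      have : v ≠ x := by simpa using hv
      simp [this, h0, Fin.val_inj]
    · intro y hy v
      simp [hy]
    · intro y hy k hk
      have : ¬ ((y : ℕ) * n + k = x * n + 0) := by
        rw [cell_inj hk (by omega)]; tauto
      rw [add_zero] at this
      simp [this]
  clear_value S₁
  -- The cost of an iteration depends on the vertex then dequeued, which is not known in advance.
  -- The budget is the total charge of the vertices not yet processed; each is paid for once.
  refine Ends.forTo_budget (c₀ := ∑ v, (80 * (nb v).length + 40)) (N := n)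
    (fun i c S' => ∃ q, HoldsQueue G x S q S' ∧ IsBfs G x i q ∧
      ∑ v ∈ Finset.univ \ (q.take i).toFinset, (80 * (nb v).length + 40) ≤ c)
    hC₁.card rfl rfl (by decide) ?_ ⟨[x], hH₁, IsBfs.init x, by simp⟩ ?_ ?_ (by omega)
  · rintro i c S' v ⟨q, h₁, h₂⟩
    exact ⟨q, h₁.setI (by decide), h₂⟩
  · rintro i c S₂ hi h11 hF ⟨q, hH, hq, hc⟩
    have hC₂ := hC₁.of_frame hF rfl
    have hx₂ : S₂.ireg 1 = x := (hF.ireg 1 rfl).trans hx₁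
    have hiq := hq.lt_length hG hi
    have hsplit : 80 * (nb q[i]).length + 40 +
        ∑ v ∈ Finset.univ \ (q.take (i + 1)).toFinset, (80 * (nb v).length + 40) =
        ∑ v ∈ Finset.univ \ (q.take i).toFinset, (80 * (nb v).length + 40) := by
      have hnot : q[i] ∉ q.take i := fun hm => by
        obtain ⟨k, hk, hkq⟩ := List.mem_take_iff_getElem.mp hm
        have := (List.Nodup.getElem_inj_iff hq.nodup).mp hkq
        omega
      rw [← Finset.sum_insert (s := Finset.univ \ (q.take (i + 1)).toFinset) (a := q[i])
        (f := fun v => 80 * (nb v).length + 40)]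
      · congr 1
        ext v
        rw [List.take_add_one, List.getElem?_eq_getElem hiq]
        simp only [Finset.mem_insert, Finset.mem_sdiff, Finset.mem_univ, true_and,
          List.mem_toFinset, List.mem_append, Option.toList_some, List.mem_singleton]
        by_cases hv : v = q[i]
        · subst hv; simp [hnot]
        · simp [hv]
      · simp only [Finset.mem_sdiff, List.mem_toFinset, Finset.mem_univ, true_and, not_not]
        exact List.mem_take_iff_getElem.mpr ⟨i, by omega, rfl⟩
    refine ⟨80 * (nb q[i]).length + 30,
      ∑ v ∈ Finset.univ \ (q.take (i + 1)).toFinset, (80 * (nb v).length + 40), by omega, ?_⟩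
    refine Ends.seq (c₁ := 10) (c₂ := 80 * (nb q[i]).length + 20)
      (Ends.block rfl ?_ (by decide)) (by omega)
    have hrun₂ : (Prog.setI 12 (.arr 10 (.cell 1 (.reg 11)))).run S₂ = S₂.setI 12 q[i] := by
      simp [Prog.run, IExp.eval, IExp.cell, hx₂, hC₂.row, h11, hH.queue i hiq]
    rw [hrun₂]
    have hC₃ : Ctx nb pen (S₂.setI 12 q[i]) :=
      hC₂.of_frame (frame_setI (p := .setI 12 (.const 0)) rfl S₂ _) rfl
    refine Ends.forNbrs hC₃ q[i] (fun l S' => ∃ r, HoldsQueue G x S (q ++ r) S' ∧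
      IsBfs G x i (q ++ r) ∧ ∀ w ∈ l, w ∈ q ++ r) (fun _ => 60) (by simp) rfl rfl rfl (by decide)
      ?_ ⟨[], by simpa using hH.setI (by decide), by simpa using hq, by simp⟩ ?_ ?_ ?_
    · rintro l S' y v hy ⟨r, h₁, h₂⟩
      exact ⟨r, h₁.setI (by omega), h₂⟩
    · rintro l₁ w l₂ S' hl hw hu hC' hF' ⟨r, h₁, h₂, h₃⟩
      have hadj : G.Adj q[i] w := by rw [← (hnb _).2, hl]; simp
      have hi' : i < (q ++ r).length := by simp; omega
      have hget : (q ++ r)[i] = q[i] := List.getElem_append_left hiq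
      have hx' : S'.ireg 1 = x := (hF'.ireg 1 rfl).trans (by simp [hx₂])
      refine (ends_visitProg hG hC' hx' h₁ h₂ hi' hw (by rw [hu, hget])
        (by rw [hget]; exact hadj)).mono le_rfl ?_
      rintro S'' ⟨r', h₁', h₂', h₃'⟩
      rw [List.append_assoc] at h₁' h₂' h₃'
      refine ⟨r ++ r', h₁', h₂', fun z hz => ?_⟩
      rcases List.mem_append.mp hz with m | m
      · have := h₃ z m
        simp only [List.mem_append] at this ⊢
        tauto
      · simp only [List.mem_singleton] at m
        subst m
        exact h₃'
    · rintro S' hF' ⟨r, h₁, h₂, h₃⟩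
      have hi' : i < (q ++ r).length := by simp; omega
      have hget : (q ++ r)[i] = q[i] := List.getElem_append_left hiq
      refine ⟨q ++ r, h₁, h₂.step hi' fun w hw => h₃ w ?_, ?_⟩
      · rw [hget] at hw
        exact ((hnb _).2 w).mpr hw
      · rw [List.take_append_of_le_length hiq]
    · simp only [List.map_const', List.sum_replicate, smul_eq_mul]
      omega
  · rintro c S' hF ⟨q, h₁, h₂, -⟩
    exact ⟨q, h₁, h₂⟩

/-! ### Counting shortest paths from one vertex -/

/-- Adds up the numbers of shortest paths of the predecessors of the vertex in register `12`. -/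
def countProg : Prog :=
  .ite (.eq (.reg 12) (.reg 1)) (.setQ 0 (.const 1)) (.setQ 0 (.const 0))⨟
  .forNbrs 2 3 12
    (.ite (.eq (.add (.arr 9 (.cell 1 (.reg 3))) (.const 1)) (.arr 9 (.cell 1 (.reg 12))))
      (.setQ 0 (.add (.reg 0) (.arr 3 (.cell 1 (.reg 3))))) .skip)⨟
  .storeQ 3 (.cell 1 (.reg 12)) (.reg 0)

/-- Counts the shortest paths from the vertex in register `1`. -/
def sigmaProg : Prog :=
  .forSlice 11 12 10 (.cell 1 (.const 0)) (.cell 1 (.reg 0)) countProg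

/-- `q` lists all vertices by increasing distance from `x`. -/
structure IsOrder (G : SimpleGraph (Fin n)) (x : Fin n) (q : List (Fin n)) : Prop where
  nodup : q.Nodup
  mem : ∀ v, v ∈ q
  sorted : q.Pairwise (fun u v => G.dist x u ≤ G.dist x v)

theorem IsOrder.mem_left {l₁ l₂ : List (Fin n)} {u w : Fin n} (h : IsOrder G x (l₁ ++ u :: l₂))
    (hd : G.dist x w < G.dist x u) : w ∈ l₁ := by
  have hm := h.mem w
  simp only [List.mem_append, List.mem_cons] at hm
  have hs := (List.pairwise_cons.mp (List.pairwise_append.mp h.sorted).2.1).1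
  rcases hm with hm | rfl | hm
  · exact hm
  · omega
  · have := hs w hm
    omega

theorem IsOrder.mem_right {l₁ l₂ : List (Fin n)} {u w : Fin n} (h : IsOrder G x (l₁ ++ u :: l₂))
    (hd : G.dist x u < G.dist x w) : w ∈ l₂ := by
  have hm := h.mem w
  simp only [List.mem_append, List.mem_cons] at hm
  have hs := (List.pairwise_append.mp h.sorted).2.2
  rcases hm with hm | rfl | hm
  · have := hs w hm u (by simp)
    omega
  · omega
  · exact hm

open scoped Classical in
theorem sum_nb (hnb : IsAdjLists G nb) {M : Type*} [AddCommMonoid M] (v : Fin n) (f : Fin n → M) :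
    ((nb v).map f).sum = ∑ w, if G.Adj v w then f w else 0 := by
  rw [← List.sum_toFinset _ (hnb v).1, ← Finset.sum_filter]
  refine Finset.sum_congr ?_ fun _ _ => rfl
  ext w
  simp [(hnb v).2]

-- Predecessors are nearer to `x`, so their counts are already in place. The accumulator starts at
-- one for the source, to which `sigma_rec` does not apply.
open scoped Classical in
theorem ends_countProg (hG : G.Connected) (hnb : IsAdjLists G nb) (hC : Ctx nb pen S)
    (hx : S.ireg 1 = x) (hd : ∀ v : Fin n, S.iarr 9 (x * n + v) = G.dist x v + 1) {u : Fin n}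
    (hu : S.ireg 12 = u)
    (hσ : ∀ w, G.dist x w < G.dist x u → S.qarr 3 (x * n + w) = sigma G x w) :
    Ends countProg S (60 * (nb u).length + 60)
      (fun S' => ∀ y v : Fin n, S'.qarr 3 (y * n + v) =
        if y = x ∧ v = u then (sigma G x u : ℚ) else S.qarr 3 (y * n + v)) := by
  have hrow := hC.row x
  refine Ends.seq (c₁ := 10) (c₂ := 60 * (nb u).length + 40) (Ends.block rfl ?_ (by decide))
    (by omega)
  set S₁ := Prog.run _ S with hS₁
  have hq₁ : S₁.qreg 0 = if u = x then 1 else 0 := by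
    simp [hS₁, Prog.run, BExp.eval, IExp.eval, QExp.eval, hx, hu, Fin.val_inj]
  have hF₁ : Frame (.setQ 0 (.const 0)) S S₁ := by
    rw [hS₁]
    simp only [Prog.run]
    split_ifs
    · have h := (Exec.setQ S 0 (.const 1)).frame
      exact ⟨fun y hy => h.ireg y hy, fun y hy => h.iarr y hy, fun y hy => h.qreg y hy,
        fun y hy => h.qarr y hy⟩
    · exact (Exec.setQ S 0 (.const 0)).frame
  clear_value S₁
  have hC₁ := hC.of_frame hF₁ rfl
  set f : Fin n → ℚ := fun w => if G.dist x w + 1 = G.dist x u then (sigma G x w : ℚ) else 0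
  refine Ends.seq (c₁ := 60 * (nb u).length + 20) (c₂ := 20) ?_ (by omega)
  refine Ends.forNbrs hC₁ u (fun l S' => S'.qreg 0 = (if u = x then 1 else 0) + (l.map f).sum)
    (fun _ => 40) ((hF₁.ireg 12 rfl).trans hu) rfl rfl rfl (by decide) (fun _ _ _ _ _ h => h)
    (by simpa using hq₁) ?_ ?_ ?_
  · intro l₁ w l₂ S' hl hw hu' hC' hF' hI
    refine Ends.block rfl ?_ (by decide)
    have hx' : S'.ireg 1 = x := (hF'.ireg 1 rfl).trans ((hF₁.ireg 1 rfl).trans hx)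
    have h9 : S'.iarr 9 = S.iarr 9 := (hF'.iarr 9 rfl).trans (hF₁.iarr 9 rfl)
    have h3 : S'.qarr 3 = S.qarr 3 := (hF'.qarr 3 rfl).trans (hF₁.qarr 3 rfl)
    by_cases hc : G.dist x w + 1 = G.dist x u
    · have := hσ w (by omega)
      simp [Prog.run, BExp.eval, IExp.eval, IExp.cell, QExp.eval, hx', hC'.row, hw, hu', h9, hd, hc,
        hI, h3, this, f, add_assoc]
    · simp [Prog.run, BExp.eval, IExp.eval, IExp.cell, hx', hC'.row, hw, hu', h9, hd, hc, hI, f]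
  · intro S' hF' hI
    refine Ends.block rfl ?_ (by decide)
    have hx' : S'.ireg 1 = x := (hF'.ireg 1 rfl).trans ((hF₁.ireg 1 rfl).trans hx)
    have hu' : S'.ireg 12 = u := (hF'.ireg 12 rfl).trans ((hF₁.ireg 12 rfl).trans hu)
    have h3 : S'.qarr 3 = S.qarr 3 := (hF'.qarr 3 rfl).trans (hF₁.qarr 3 rfl)
    have hC' := hC₁.of_frame hF' rfl
    have hsum : S'.qreg 0 = sigma G x u := by
      rw [hI, sum_nb hnb]
      by_cases hux : u = x
      · subst hux
        rw [Finset.sum_eq_zero]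
        · simp [sigma_self]
        · intro w _
          simp [f]
      · rw [if_neg hux, zero_add, sigma_rec hG (Ne.symm hux)]
        push_cast
        exact Finset.sum_congr rfl fun w _ => by simp [f, ite_and]
    intro y v
    simp [Prog.run, IExp.eval, IExp.cell, QExp.eval, hx', hu', hC'.row, hsum, h3]
  · simp only [List.map_const', List.sum_replicate, smul_eq_mul]
    omega

theorem ends_sigmaProg (hG : G.Connected) (hnb : IsAdjLists G nb) (hC : Ctx nb pen S)
    (hx : S.ireg 1 = x) (hq : IsOrder G x q)
    (hqueue : ∀ k (hk : k < q.length), S.iarr 10 (x * n + k) = (q[k] : ℕ))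
    (hd : ∀ v : Fin n, S.iarr 9 (x * n + v) = G.dist x v + 1) :
    Ends sigmaProg S (∑ v, (60 * (nb v).length + 80) + 20)
      (fun S' => (∀ v : Fin n, S'.qarr 3 (x * n + v) = sigma G x v) ∧
        ∀ y v : Fin n, y ≠ x → S'.qarr 3 (y * n + v) = S.qarr 3 (y * n + v)) := by
  have hlen := length_eq_of_forall_mem hq.nodup hq.mem
  refine Ends.forSlice (b := x * n) q (fun l S' => (∀ v ∈ l, S'.qarr 3 (x * n + v) = sigma G x v) ∧
      ∀ y v : Fin n, y ≠ x → S'.qarr 3 (y * n + v) = S.qarr 3 (y * n + v))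
    (fun u => 60 * (nb u).length + 60) ?_ ?_ rfl hqueue rfl (by decide) (fun _ _ _ _ _ h => h)
    (by simp) ?_ ?_ ?_
  · simp [IExp.cell, IExp.eval, hx, hC.row]
  · intro S' hF
    have hC' := hC.of_frame hF rfl
    have hx' : S'.ireg 1 = x := (hF.ireg 1 rfl).trans hx
    simp [IExp.cell, IExp.eval, hx', hC'.row, hC'.card, hlen]
  · rintro l₁ u l₂ S' hl hu hF ⟨h₁, h₂⟩
    have hC' := hC.of_frame hF rfl
    have hx' : S'.ireg 1 = x := (hF.ireg 1 rfl).trans hx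
    have h9 : S'.iarr 9 = S.iarr 9 := hF.iarr 9 rfl
    refine (ends_countProg hG hnb hC' hx' (by rw [h9]; exact hd) hu fun w hw => h₁ w ?_).mono
      le_rfl fun S'' h => ⟨fun v hv => ?_, fun y v hy => ?_⟩
    · rw [hl] at hq
      exact hq.mem_left hw
    · rw [h]
      by_cases hvu : v = u
      · subst hvu; simp
      · rw [if_neg (by tauto)]
        exact h₁ v (by simpa [hvu] using hv)
    · rw [h, if_neg (by tauto), h₂ y v hy]
  · rintro S' hF ⟨h₁, h₂⟩
    exact ⟨fun v => h₁ v (hq.mem v), h₂⟩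
  · rw [← List.sum_toFinset _ hq.nodup, show q.toFinset = Finset.univ by ext; simp [hq.mem]]
    have h := Finset.sum_le_sum (s := Finset.univ) (f := fun v : Fin n => 60 * (nb v).length + 74)
      (g := fun v => 60 * (nb v).length + 80) fun v _ => by omega
    simp only [IExp.cell, IExp.cost, add_assoc]
    exact Nat.add_le_add h (by decide)

/-- Breadth-first search and path counting from all vertices whose degree is not two. -/
def searchProg : Prog := .forTo 1 0 (.ite (.isTwo 1) .skip (bfsProg⨟ sigmaProg))

/-- The memory contains the results of the search from `x`. -/
def HoldsSearch (G : SimpleGraph (Fin n)) (x : Fin n) (S : State) : Prop :=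
  (∃ q, IsOrder G x q ∧ ∀ k (hk : k < q.length), S.iarr 10 (x * n + k) = (q[k] : ℕ)) ∧
  (∀ v : Fin n, S.iarr 9 (x * n + v) = G.dist x v + 1) ∧
  ∀ v : Fin n, S.qarr 3 (x * n + v) = sigma G x v

theorem ends_searchProg (hG : G.Connected) (hnb : IsAdjLists G nb) (hC : Ctx nb pen S)
    (h0 : ∀ i, S.iarr 9 i = 0) :
    Ends searchProg S (∑ x : Fin n, (if (nb x).length = 2 then 40
      else ∑ v, (140 * (nb v).length + 120) + 110) + 10)
      (fun S' => ∀ x, (nb x).length ≠ 2 → HoldsSearch G x S') := by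
  -- The second clause keeps the rows of later sources zero, so that each search finds all vertices
  -- unvisited.
  refine Ends.forTo (N := n) (fun i S' =>
      (∀ x : Fin n, (x : ℕ) < i → (nb x).length ≠ 2 → HoldsSearch G x S') ∧
      ∀ x v : Fin n, i ≤ x → S'.iarr 9 (x * n + v) = 0)
    (fun i => if hi : i < n then (if (nb ⟨i, hi⟩).length = 2 then 30
      else ∑ v, (140 * (nb v).length + 120) + 100) else 0) hC.card rfl rfl (by decide)
    (fun _ _ _ h => h) ⟨by simp, fun _ _ _ => h0 _⟩ ?_ ?_ ?_
  · rintro i S₁ hi h1 hF ⟨h₁, h₂⟩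
    have hC₁ := hC.of_frame hF rfl
    obtain ⟨x, rfl⟩ : ∃ x : Fin n, (x : ℕ) = i := ⟨⟨i, hi⟩, rfl⟩
    rw [dif_pos hi, Fin.eta]
    refine Ends.ite (c₁ := 1) (c₂ := ∑ v, (140 * (nb v).length + 120) + 80) ?_ ?_ ?_ ?_
    · intro hb
      rw [hC₁.isTwo_eval h1] at hb
      refine Ends.block rfl ⟨fun y hy h2 => ?_, fun y v hy => h₂ y v (by omega)⟩ le_rfl
      rcases Nat.lt_succ_iff_lt_or_eq.mp hy with hy | hy
      · exact h₁ y hy h2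
      · rw [Fin.ext hy] at h2
        exact absurd (by simpa using hb) h2
    · intro hb
      refine Ends.seq (c₁ := ∑ v, (80 * (nb v).length + 40) + 50)
        (c₂ := ∑ v, (60 * (nb v).length + 80) + 20) ?_ ?_
      · refine (ends_bfsProg hG hnb hC₁ h1 fun v => h₂ x v le_rfl).frame.mono le_rfl ?_
        rintro S₂ ⟨hF₂, q, hH, hq⟩
        have hC₂ := hC₁.of_frame hF₂ rfl
        have hx₂ : S₂.ireg 1 = x := (hF₂.ireg 1 rfl).trans h1
        have hord : IsOrder G x q := ⟨hq.nodup, hq.forall_mem hG, hq.sorted⟩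
        refine (ends_sigmaProg hG hnb hC₂ hx₂ hord hH.queue
          fun v => hH.dist v (hord.mem v)).frame.mono le_rfl ?_
        rintro S₃ ⟨hF₃, h₃, h₄⟩
        have e9 : S₃.iarr 9 = S₂.iarr 9 := hF₃.iarr 9 rfl
        have e10 : S₃.iarr 10 = S₂.iarr 10 := hF₃.iarr 10 rfl
        have e3 : S₂.qarr 3 = S₁.qarr 3 := hF₂.qarr 3 rfl
        refine ⟨fun y hy h2 => ?_, fun y v hy => ?_⟩
        · rcases Nat.lt_succ_iff_lt_or_eq.mp hy with hy | hy
          · have hne : y ≠ x := by rintro rfl; omega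
            obtain ⟨⟨q', hq', hqueue⟩, hd, hσ⟩ := h₁ y hy h2
            have hlen := length_eq_of_forall_mem hq'.nodup hq'.mem
            refine ⟨⟨q', hq', fun k hk => ?_⟩, fun v => ?_, fun v => ?_⟩
            · rw [e10, hH.queue_rows y hne k (by omega), hqueue k hk]
            · rw [e9, hH.dist_rows y hne, hd]
            · rw [h₄ y v hne, e3, hσ]
          · have : y = x := Fin.ext hy
            subst this
            exact ⟨⟨q, hord, by rw [e10]; exact hH.queue⟩,
              by rw [e9]; exact fun v => hH.dist v (hord.mem v), h₃⟩
        · have hne : y ≠ x := by rintro rfl; omega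
          rw [e9, hH.dist_rows y hne, h₂ y v (by omega)]
      · have : ∑ v, (140 * (nb v).length + 120) =
            ∑ v, (80 * (nb v).length + 40) + ∑ v, (60 * (nb v).length + 80) := by
          rw [← Finset.sum_add_distrib]
          exact Finset.sum_congr rfl fun v _ => by ring
        omega
    · intro hb
      rw [hC₁.isTwo_eval h1] at hb
      rw [if_pos (by simpa using hb)]
      simp only [BExp.isTwo, BExp.cost, IExp.cost]; omega
    · intro hb
      rw [hC₁.isTwo_eval h1] at hb
      rw [if_neg (by simpa using hb)]
      simp only [BExp.isTwo, BExp.cost, IExp.cost]; omega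
  · rintro S' hF ⟨h₁, h₂⟩ x hx
    exact h₁ x x.2 hx
  · rw [Finset.sum_range]
    refine Nat.add_le_add (Finset.sum_le_sum fun i _ => ?_) (by omega)
    rw [dif_pos i.2, Fin.eta]
    split_ifs <;> omega

end Bfs

end BetwCent

namespace BetwCent

open RAM

/-! ### Computing the weights -/

theorem sum_range_mul_cases (g : ℕ → ℚ) (c₁ c₂ c₃ : ℚ) {a b N : ℕ} (hab : a ≤ b) (hbN : b ≤ N) :
    ∑ i ∈ Finset.range N, g i * (if i < a then c₁ else if i < b then c₂ else c₃) =
      c₁ * ∑ i ∈ Finset.range a, g i +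
      c₂ * (∑ i ∈ Finset.range b, g i - ∑ i ∈ Finset.range a, g i) +
      c₃ * (∑ i ∈ Finset.range N, g i - ∑ i ∈ Finset.range b, g i) := by
  obtain ⟨d, rfl⟩ := Nat.exists_eq_add_of_le hab
  obtain ⟨e, rfl⟩ := Nat.exists_eq_add_of_le hbN
  simp only [Finset.sum_range_add]
  have h₁ : ∑ i ∈ Finset.range a, g i * (if i < a then c₁ else if i < a + d then c₂ else c₃) =
      c₁ * ∑ i ∈ Finset.range a, g i := by
    rw [Finset.mul_sum]
    refine Finset.sum_congr rfl fun i hi => ?_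
    rw [if_pos (Finset.mem_range.mp hi), mul_comm]
  have h₂ : ∑ i ∈ Finset.range d, g (a + i) *
      (if a + i < a then c₁ else if a + i < a + d then c₂ else c₃) =
      c₂ * ∑ i ∈ Finset.range d, g (a + i) := by
    rw [Finset.mul_sum]
    refine Finset.sum_congr rfl fun i hi => ?_
    have := Finset.mem_range.mp hi
    rw [if_neg (by omega), if_pos (by omega), mul_comm]
  have h₃ : ∑ i ∈ Finset.range e, g (a + d + i) *
      (if a + d + i < a then c₁ else if a + d + i < a + d then c₂ else c₃) =
      c₃ * ∑ i ∈ Finset.range e, g (a + d + i) := by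
    rw [Finset.mul_sum]
    refine Finset.sum_congr rfl fun i hi => ?_
    rw [if_neg (by omega), if_neg (by omega), mul_comm]
  rw [h₁, h₂, h₃]
  ring

section Weights

variable {n : ℕ} {G : SimpleGraph (Fin n)} {nb : Fin n → List (Fin n)} {pen : Fin n → ℕ}
  {ws : List (Fin n)} {α pid : Fin n → Fin n} {S : State}

/-- The number of inner vertices of a path of length `l` that are nearer to the first end, given the
distances `a` and `b` of the two ends. -/
def nearCount (l a b : ℕ) : ℕ := (l + b - a - 1) / 2

open scoped Classical in
/-- The share of a path in terms of prefix sums. -/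
theorem PathCover.share_eq (hB : IsBiconnected G) (hnb : IsAdjLists G nb)
    (h : PathCover G nb ws α pid) (pen : Fin n → ℕ) {w s : Fin n} (hw : w ∈ ws)
    (hs : ¬ ((nb s).length = 2 ∧ pid s = w)) (y : Fin n) {a b : Fin n} {l m₁ m₂ : ℕ}
    (ha : a = α w) (hb : b = pathVert nb α w l) (hl : l = len nb α w)
    (hm₁ : m₁ = nearCount l (G.dist a s) (G.dist b s))
    (hm₂ : m₂ = l - 1 - nearCount l (G.dist b s) (G.dist a s)) :
    share G nb pen α y s w =
      (if y = a then pen s * (prefixSum pen (pathVert nb α w) m₁ / sigma G a s +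
        (prefixSum pen (pathVert nb α w) m₂ - prefixSum pen (pathVert nb α w) m₁) /
          (sigma G a s + sigma G b s)) else 0) +
      (if y = b then pen s * ((prefixSum pen (pathVert nb α w) (l - 1) -
        prefixSum pen (pathVert nb α w) m₂) / sigma G b s +
        (prefixSum pen (pathVert nb α w) m₂ - prefixSum pen (pathVert nb α w) m₁) /
          (sigma G a s + sigma G b s)) else 0) := by
  have hG := hB.connected
  have hst := h.start w hw
  have hseg : IsSeg G (pathVert nb α w) l := hl ▸ hst.isSeg hnb
  have hav : Avoids (pathVert nb α w) l s := hl ▸ h.avoids hw hs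
  have hl1 : 1 < l := hl ▸ one_lt_pathLen hnb hst
  have ha' : a = pathVert nb α w 0 := ha
  rw [sigma_comm a s, sigma_comm b s]
  rw [G.dist_comm (u := a), G.dist_comm (u := b)] at hm₁ hm₂
  have t₁ := hseg.dist_le_left hG s le_rfl
  have t₂ := hseg.dist_le_right hG s (i := 0) (by omega)
  rw [← ha', ← hb] at t₁ t₂
  rw [nearCount] at hm₁ hm₂
  -- With r = i + 1: the first `m₁` inner vertices are entered at `a` only, since d(s,a) + r <
  -- d(s,b) + l − r means r ≤ (l + d(s,b) − d(s,a) − 1)/2. Those up to `m₂` are ties, where the path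
  -- counts of both ends add up; the rest are entered at `b` only.
  have e : share G nb pen α y s w = ∑ i ∈ Finset.range (l - 1), (pen (pathVert nb α w (i + 1)) : ℚ) *
      (if i < m₁ then (if y = a then (pen s : ℚ) / sigma G s a else 0) else if i < m₂ then
        ((if y = a then (pen s : ℚ) / (sigma G s a + sigma G s b) else 0) +
          (if y = b then (pen s : ℚ) / (sigma G s a + sigma G s b) else 0))
        else (if y = b then (pen s : ℚ) / sigma G s b else 0)) := by
    rw [share, ← hl, Finset.sum_bij' (t := Finset.range (l - 1)) (fun r _ => r - 1)
      (fun i _ => i + 1)]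
    · intro r hr; simp at hr ⊢; omega
    · intro r hr; simp at hr ⊢; omega
    · intro r hr; simp at hr ⊢; omega
    · intro r hr; simp
    · intro r hr
      rw [Finset.mem_Ioo] at hr
      rw [Nat.sub_add_cancel hr.1, entry, ← hl, ← hb, ← ha', hseg.sigma_eq hG hav hr.1 hr.2, ← ha',
        ← hb]
      have c := hseg.dist_cases hG hav hr.2.le
      have d₁ := hseg.dist_le_left hG s hr.2.le
      have d₂ := hseg.dist_le_right hG s hr.2.le
      rw [← ha', ← hb] at c
      rw [← ha'] at d₁
      rw [← hb] at d₂
      by_cases k₁ : r - 1 < m₁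
      · rw [if_pos k₁]
        have q₁ : G.dist s (pathVert nb α w r) = G.dist s a + r := by omega
        have q₂ : G.dist s (pathVert nb α w r) ≠ G.dist s b + (l - r) := by omega
        simp only [q₂, if_false, and_false, add_zero]
        simp only [q₁, if_true, and_true]
        split_ifs <;> ring
      · rw [if_neg k₁]
        by_cases k₂ : r - 1 < m₂
        · rw [if_pos k₂]
          have q₁ : G.dist s (pathVert nb α w r) = G.dist s a + r := by omega
          have q₂ : G.dist s (pathVert nb α w r) = G.dist s b + (l - r) := by omega
          rw [if_pos q₁, if_pos q₂]
          simp only [q₁, and_true]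
          simp only [← q₁, q₂, and_true]
          push_cast
          split_ifs <;> ring
        · rw [if_neg k₂]
          have q₁ : G.dist s (pathVert nb α w r) ≠ G.dist s a + r := by omega
          have q₂ : G.dist s (pathVert nb α w r) = G.dist s b + (l - r) := by omega
          simp only [q₁, if_false, and_false, zero_add]
          simp only [q₂, if_true, and_true]
          split_ifs <;> ring
  rw [e, sum_range_mul_cases _ _ _ _ (by omega) (by omega)]
  simp only [prefixSum]
  split_ifs <;> ring

/-- Adds the share of the path in register `14` to the weights of the vertex in register `18`. -/
def shareProg : Prog :=
  .setI 19 (.cell 15 (.reg 18))⨟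
  .setI 20 (.cell 16 (.reg 18))⨟
  .setI 21 (.arr 3 (.sub (.sub (.add (.reg 17) (.arr 9 (.reg 20))) (.arr 9 (.reg 19))) (.const 1)))⨟
  .setI 22 (.sub (.sub (.reg 17) (.const 1)) (.arr 3
    (.sub (.sub (.add (.reg 17) (.arr 9 (.reg 19))) (.arr 9 (.reg 20))) (.const 1))))⨟
  .setQ 0 (.arr 2 (.cell 14 (.reg 21)))⨟
  .setQ 1 (.arr 2 (.cell 14 (.reg 22)))⨟
  .setQ 2 (.div (.sub (.reg 1) (.reg 0)) (.add (.arr 3 (.reg 19)) (.arr 3 (.reg 20))))⨟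
  .storeQ 4 (.reg 19) (.add (.arr 4 (.reg 19)) (.mul (.arr 0 (.reg 18))
    (.add (.div (.reg 0) (.arr 3 (.reg 19))) (.reg 2))))⨟
  .storeQ 4 (.reg 20) (.add (.arr 4 (.reg 20)) (.mul (.arr 0 (.reg 18))
    (.add (.div (.sub (.arr 2 (.cell 14 (.sub (.reg 17) (.const 1)))) (.reg 1))
      (.arr 3 (.reg 20))) (.reg 2))))

/-- Every value read from memory is a variable here, so the evaluation involves no graph theory. The
second store reads its cell after the first store, so the increments add up even for coinciding
cells. -/
theorem run_shareProg {w a b l s rw ra rb da db m₁ m₂ : ℕ} {σa σb q₁ q₂ q₃ p : ℚ}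
    (hw : S.ireg 14 = w) (ha : S.ireg 15 = a) (hb : S.ireg 16 = b) (hl : S.ireg 17 = l)
    (hs : S.ireg 18 = s) (hrw : S.iarr 2 w = rw) (hra : S.iarr 2 a = ra) (hrb : S.iarr 2 b = rb)
    (hda : S.iarr 9 (ra + s) = da) (hdb : S.iarr 9 (rb + s) = db)
    (hm₁ : S.iarr 3 (l + db - da - 1) = m₁) (hm₂ : l - 1 - S.iarr 3 (l + da - db - 1) = m₂)
    (hσa : S.qarr 3 (ra + s) = σa) (hσb : S.qarr 3 (rb + s) = σb)
    (hq₁ : S.qarr 2 (rw + m₁) = q₁) (hq₂ : S.qarr 2 (rw + m₂) = q₂)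
    (hq₃ : S.qarr 2 (rw + (l - 1)) = q₃) (hp : S.qarr 0 s = p) (i : ℕ) :
    (shareProg.run S).qarr 4 i = S.qarr 4 i +
      ((if i = ra + s then p * (q₁ / σa + (q₂ - q₁) / (σa + σb)) else 0) +
      (if i = rb + s then p * ((q₃ - q₂) / σb + (q₂ - q₁) / (σa + σb)) else 0)) := by
  simp only [shareProg, Prog.run, IExp.eval, QExp.eval, IExp.cell, State.setI_ireg, State.setI_iarr,
    State.setI_qreg, State.setI_qarr, State.setQ_qreg, State.setQ_ireg, State.setQ_iarr,
    State.setQ_qarr, State.storeQ_qarr, State.storeQ_ireg, State.storeQ_iarr, State.storeQ_qreg,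
    hw, ha, hb, hl, hs, hrw, hra, hrb, hda, hdb, hm₁, hm₂, hσa, hσb, hq₁, hq₂, hq₃, hp,
    if_true, Nat.reduceEqDiff, if_false]
  by_cases h₁ : i = ra + s <;> by_cases h₂ : i = rb + s
  · subst h₁
    simp only [← h₂, if_true]
    ring
  · subst h₁
    simp only [if_true, if_neg h₂, add_zero]
  · subst h₂
    simp only [if_true, if_neg h₁, zero_add]
  · simp [h₁, h₂]

/-- The program leaves the record of the paths alone. -/
def keepsPaths (p : Prog) : Bool :=
  !p.writesIreg 5 && !p.writesIarr 4 && !p.writesIarr 5 && !p.writesIarr 6 && !p.writesIarr 7 &&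
    !p.writesIarr 8 && !p.writesQarr 2

theorem HoldsPaths.of_frame {p : Prog} {S' : State} (h : HoldsPaths G nb pen ws α S)
    (hF : Frame p S S') (hp : keepsPaths p = true) : HoldsPaths G nb pen ws α S' := by
  simp only [keepsPaths, Bool.and_eq_true, Bool.not_eq_true'] at hp
  obtain ⟨⟨⟨⟨⟨⟨h0, h1⟩, h2⟩, h3⟩, h4⟩, h5⟩, h6⟩ := hp
  have e0 := hF.ireg 5 h0
  have e1 := hF.iarr 4 h1
  have e2 := hF.iarr 5 h2
  have e3 := hF.iarr 6 h3
  have e4 := hF.iarr 7 h4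
  have e5 := hF.iarr 8 h5
  have e6 := hF.qarr 2 h6
  constructor
  · exact h.sys
  · rw [e0]; exact h.count
  · rw [e1]; exact h.list
  · rw [e2]; exact h.first
  · rw [e3]; exact h.last
  · rw [e4]; exact h.length
  · rw [e5]; exact h.name
  · rw [e5]; exact h.unnamed
  · rw [e6]; exact h.sums

/-- The program leaves the results of the searches alone. -/
def keepsSearch (p : Prog) : Bool :=
  !p.writesIarr 9 && !p.writesIarr 10 && !p.writesQarr 3

theorem HoldsSearch.of_frame {p : Prog} {S' : State} {x : Fin n} (h : HoldsSearch G x S)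
    (hF : Frame p S S') (hp : keepsSearch p = true) : HoldsSearch G x S' := by
  simp only [keepsSearch, Bool.and_eq_true, Bool.not_eq_true'] at hp
  obtain ⟨⟨h0, h1⟩, h2⟩ := hp
  have e0 := hF.iarr 9 h0
  have e1 := hF.iarr 10 h1
  have e2 := hF.qarr 3 h2
  rw [HoldsSearch, e0, e1, e2]
  exact h

theorem ends_shareProg (hB : IsBiconnected G) (hnb : IsAdjLists G nb)
    (h : PathCover G nb ws α pid) (hC : Ctx nb pen S) (hP : HoldsPaths G nb pen ws α S)
    (hS : ∀ x, (nb x).length ≠ 2 → HoldsSearch G x S) {w s : Fin n} (hw : w ∈ ws)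
    (hs : ¬ ((nb s).length = 2 ∧ pid s = w))
    (h14 : S.ireg 14 = w) (h15 : S.ireg 15 = α w)
    (h16 : S.ireg 16 = pathVert nb α w (len nb α w)) (h17 : S.ireg 17 = len nb α w)
    (h18 : S.ireg 18 = s) :
    Ends shareProg S 120 (fun S' => ∀ y v : Fin n, S'.qarr 4 (y * n + v) =
      S.qarr 4 (y * n + v) + if v = s then share G nb pen α y s w else 0) := by
  refine Ends.block rfl (fun y v => ?_) (by decide)
  have hG := hB.connected
  have hst := h.start w hw
  have hseg : IsSeg G (pathVert nb α w) (len nb α w) := hst.isSeg hnb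
  have hav : Avoids (pathVert nb α w) (len nb α w) s := h.avoids hw hs
  have hl1 : 1 < len nb α w := one_lt_pathLen hnb hst
  have hln : len nb α w ≤ n := pathLen_le hnb hst
  obtain ⟨-, hda, hσa⟩ := hS (α w) hst.branch
  obtain ⟨-, hdb, hσb⟩ := hS (pathVert nb α w (len nb α w)) (pathLen_spec hnb hst).2
  have t₁ := hseg.dist_le_left hG s le_rfl
  have t₂ := hseg.dist_le_right hG s (i := 0) (by omega)
  have ha0 : pathVert nb α w 0 = α w := rfl
  rw [ha0, G.dist_comm (u := s), G.dist_comm (u := s)] at t₁ t₂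
  set b := pathVert nb α w (len nb α w) with hb
  set l := len nb α w with hl
  -- The stored distances are shifted by one, and the shifts cancel. The distances of the two ends
  -- differ by at most `l`, so the index is at most `2 * n` and the table of halves applies.
  have hm₁ : S.iarr 3 (l + (G.dist b s + 1) - (G.dist (α w) s + 1) - 1) =
      nearCount l (G.dist (α w) s) (G.dist b s) := by
    rw [hC.half _ (by omega), nearCount]
    congr 2
    omega
  have hm₂ : l - 1 - S.iarr 3 (l + (G.dist (α w) s + 1) - (G.dist b s + 1) - 1) =
      l - 1 - nearCount l (G.dist b s) (G.dist (α w) s) := by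
    rw [hC.half _ (by omega), nearCount]
    congr 3
    omega
  have hlt : nearCount l (G.dist (α w) s) (G.dist b s) < l := by rw [nearCount]; omega
  rw [run_shareProg h14 h15 h16 h17 h18 (hC.row w) (hC.row (α w)) (hC.row b) (hda s) (hdb s) hm₁ hm₂
    (hσa s) (hσb s) (hP.sums w hw _ hlt) (hP.sums w hw _ (by omega)) (hP.sums w hw _ (by omega))
    (hC.pen s)]
  congr 1
  simp only [cell_inj_fin]
  by_cases hv : v = s
  · rw [if_pos hv, h.share_eq hB hnb pen hw hs y rfl hb hl rfl rfl]
    simp [hv]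
  · simp [hv]

/-- Adds the shares of the path in register `14` to all weights. -/
def pathWeightProg : Prog :=
  (.setI 15 (.arr 5 (.reg 14))⨟ .setI 16 (.arr 6 (.reg 14))⨟ .setI 17 (.arr 7 (.reg 14)))⨟
  .forTo 18 0 (.ite (.and (.isTwo 18) (.not (.eq (.arr 8 (.reg 18)) (.add (.reg 14) (.const 1)))))
    shareProg .skip)

theorem ends_pathWeightProg (hB : IsBiconnected G) (hnb : IsAdjLists G nb)
    (h : PathCover G nb ws α pid) (hC : Ctx nb pen S) (hP : HoldsPaths G nb pen ws α S)
    (hS : ∀ x, (nb x).length ≠ 2 → HoldsSearch G x S) {w : Fin n} (hw : w ∈ ws)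
    (h14 : S.ireg 14 = w) :
    Ends pathWeightProg S (200 * n + 30) (fun S' => ∀ y v : Fin n, S'.qarr 4 (y * n + v) =
      S.qarr 4 (y * n + v) +
        if (nb v).length = 2 ∧ w ≠ pid v then share G nb pen α y v w else 0) := by
  refine Ends.seq (c₁ := 20) (c₂ := 200 * n + 10) (Ends.block rfl ?_ (by decide)) (by omega)
  set S₁ := Prog.run _ S with hS₁
  have hF₁ : Frame pathWeightProg S S₁ := by
    rw [hS₁]
    exact Frame.seq_left (((Exec.setI S _ _).seq ((Exec.setI _ _ _).seq (Exec.setI _ _ _))).frame)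
  have h15 : S₁.ireg 15 = α w := by simp [hS₁, Prog.run, IExp.eval, h14, hP.first w hw]
  have h16 : S₁.ireg 16 = pathVert nb α w (len nb α w) := by
    simp [hS₁, Prog.run, IExp.eval, h14, hP.last w hw]
  have h17 : S₁.ireg 17 = len nb α w := by simp [hS₁, Prog.run, IExp.eval, h14, hP.length w hw]
  have h14' : S₁.ireg 14 = w := (hF₁.ireg 14 rfl).trans h14
  have hC₁ := hC.of_frame hF₁ rfl
  have hP₁ := hP.of_frame hF₁ rfl
  have hS₁' := fun x hx => (hS x hx).of_frame hF₁ rfl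
  have e4 : S₁.qarr 4 = S.qarr 4 := by simp [hS₁, Prog.run]
  rw [← e4]
  clear_value S₁
  refine Ends.forTo (N := n) (fun i S' => ∀ y v : Fin n, S'.qarr 4 (y * n + v) =
      S₁.qarr 4 (y * n + v) + if (v : ℕ) < i then
        (if (nb v).length = 2 ∧ w ≠ pid v then share G nb pen α y v w else 0) else 0)
    (fun _ => 180) hC₁.card rfl rfl (by decide) (fun _ _ _ h => h) (by simp) ?_ ?_ ?_
  · intro i S' hi hx hF hI
    obtain ⟨s, rfl⟩ : ∃ s : Fin n, (s : ℕ) = i := ⟨⟨i, hi⟩, rfl⟩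
    have hC' := hC₁.of_frame hF rfl
    have hP' := hP₁.of_frame hF rfl
    have hsplit : ∀ f : Fin n → ℚ, ∀ v : Fin n, (if (v : ℕ) < s + 1 then f v else 0) =
        (if (v : ℕ) < s then f v else 0) + if v = s then f v else 0 := by
      intro f v
      rcases lt_trichotomy v s with hv | rfl | hv
      · rw [if_pos (by omega), if_pos (by omega), if_neg (by omega), add_zero]
      · simp
      · rw [if_neg (by omega), if_neg (by omega), if_neg (by omega), add_zero]
    have hcond : (BExp.and (.isTwo 18) (.not (.eq (.arr 8 (.reg 18))
        (.add (.reg 14) (.const 1))))).eval S' = decide ((nb s).length = 2 ∧ w ≠ pid s) := by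
      rw [BExp.eval, hC'.isTwo_eval hx]
      by_cases h2 : (nb s).length = 2
      · have hn := hP'.name s (pid s) (h.mem s h2).1 (h.mem s h2).2
        simp [BExp.eval, IExp.eval, hx, hn, (hF.ireg 14 rfl).trans h14', h2, Fin.val_inj, eq_comm]
      · simp [h2]
    refine Ends.ite (c₁ := 120) (c₂ := 1) ?_ ?_ (fun _ => by decide) (fun _ => by decide)
    · intro hb
      rw [hcond, decide_eq_true_eq] at hb
      refine (ends_shareProg hB hnb h hC' hP' (fun x hx => (hS₁' x hx).of_frame hF rfl) hw
        (fun hc => hb.2 hc.2.symm) ((hF.ireg 14 rfl).trans h14') ((hF.ireg 15 rfl).trans h15)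
        ((hF.ireg 16 rfl).trans h16) ((hF.ireg 17 rfl).trans h17) hx).mono le_rfl ?_
      intro S'' hS'' y v
      rw [hS'', hI, add_assoc,
        hsplit (fun v => if (nb v).length = 2 ∧ w ≠ pid v then share G nb pen α y v w else 0)]
      congr 2
      by_cases hv : v = s
      · subst hv; simp [hb]
      · simp [hv]
    · intro hb
      rw [hcond, decide_eq_false_iff_not] at hb
      refine Ends.block rfl (fun y v => ?_) le_rfl
      rw [Prog.run, hI,
        hsplit (fun v => if (nb v).length = 2 ∧ w ≠ pid v then share G nb pen α y v w else 0)]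
      congr 1
      by_cases hv : v = s
      · subst hv; rw [if_pos rfl, if_neg hb, add_zero]
      · simp [hv]
  · intro S' _ hI y v
    rw [hI, if_pos v.2]
  · simp
    omega

/-- Computes the weights. -/
def weightProg : Prog := .forSlice 13 14 4 (.const 0) (.reg 5) pathWeightProg

/-- Each path and each vertex meet once, in constant time. If all degrees are two there need not be
a cover, so a cover is assumed only in the presence of a branching vertex; any listed path supplies
one. -/
theorem ends_weightProg (hB : IsBiconnected G) (hnb : IsAdjLists G nb)
    (h : ∀ x, (nb x).length ≠ 2 → PathCover G nb ws α pid) (hC : Ctx nb pen S) (hP : HoldsPaths G nb pen ws α S)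
    (hS : ∀ x, (nb x).length ≠ 2 → HoldsSearch G x S) (h0 : ∀ i, S.qarr 4 i = 0) :
    Ends weightProg S (ws.length * (200 * n + 50) + 10) (fun S' => ∀ y v : Fin n,
      S'.qarr 4 (y * n + v) = weight G nb pen ws α pid y v) := by
  refine Ends.forSlice ws (fun l S' => ∀ y v : Fin n, S'.qarr 4 (y * n + v) =
      if (nb v).length = 2 then
        (l.map fun w => if w ≠ pid v then share G nb pen α y v w else 0).sum else 0)
    (fun _ => 200 * n + 30) (b := 0) rfl ?_ rfl (by simpa using hP.list) rfl (by decide)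
    (fun _ _ _ _ _ h => h) (by simp [h0]) ?_ ?_ ?_
  · intro S' hF
    simpa [IExp.eval] using (hP.of_frame hF rfl).count
  · intro l₁ w l₂ S' hl h14 hF hI
    have hw : w ∈ ws := by simp [hl]
    refine (ends_pathWeightProg hB hnb (h _ (hP.sys.start w hw).branch) (hC.of_frame hF rfl) (hP.of_frame hF rfl)
      (fun x hx => (hS x hx).of_frame hF rfl) hw h14).mono le_rfl ?_
    intro S'' hS'' y v
    rw [hS'', hI]
    by_cases h2 : (nb v).length = 2
    · simp [h2]
    · simp [h2]
  · intro S' _ hI y v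
    rw [hI, weight, List.sum_toFinset _ hP.sys.nodup]
  · simp [IExp.cost]
    nlinarith

end Weights

end BetwCent

namespace BetwCent

open RAM

/-! ### Accumulating the loads -/

section Loads

variable {n : ℕ} {G : SimpleGraph (Fin n)} {nb : Fin n → List (Fin n)} {pen : Fin n → ℕ}
  {ws : List (Fin n)} {α pid : Fin n → Fin n} {S : State}

/-- The contribution of the shortest paths from `y` to the value of `v`. -/
noncomputable def gain (G : SimpleGraph (Fin n)) (nb : Fin n → List (Fin n)) (pen : Fin n → ℕ)
    (ws : List (Fin n)) (α pid : Fin n → Fin n) (y v : Fin n) : ℚ :=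
  sigma G y v * (load G nb pen ws α pid y v - weight G nb pen ws α pid y v +
    if (nb v).length = 2 then
      ownLoad G nb pen ws α pid y v - weight G nb pen ws α pid y v else 0)

/-- Adds up the loads of the successors of the vertex in register `12`. -/
def sumProg : Prog :=
  (.setQ 0 (.const 0)⨟ .setQ 1 (.const 0))⨟
  .forNbrs 2 3 12
    (.ite (.eq (.arr 9 (.cell 1 (.reg 3))) (.add (.arr 9 (.cell 1 (.reg 12))) (.const 1)))
      (.setQ 0 (.add (.reg 0) (.arr 5 (.cell 1 (.reg 3))))⨟
        .ite (.and (.isTwo 12) (.isTwo 3)) (.setQ 1 (.add (.reg 1) (.arr 6 (.cell 1 (.reg 3)))))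
          .skip)
      .skip)

/-- Computes the loads of the vertex in register `12`. -/
def loadProg : Prog :=
  sumProg⨟
  .storeQ 5 (.cell 1 (.reg 12)) (.add (.arr 4 (.cell 1 (.reg 12))) (.reg 0))⨟
  .storeQ 6 (.cell 1 (.reg 12)) (.add (.arr 4 (.cell 1 (.reg 12))) (.reg 1))⨟
  .storeQ 1 (.reg 12) (.add (.arr 1 (.reg 12))
    (.mul (.arr 3 (.cell 1 (.reg 12))) (.add (.reg 0) (.reg 1))))

/-- Successors of `u` are farther from `x`, so in the backward sweep their loads are final. Own
loads are passed on only between vertices of degree two, as `ownLoad_rec` prescribes. -/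
theorem ends_sumProg (hB : IsBiconnected G) (hnb : IsAdjLists G nb)
    (h : PathCover G nb ws α pid) (hC : Ctx nb pen S) {x u : Fin n} (hx : S.ireg 1 = x)
    (hx2 : (nb x).length ≠ 2) (hd : ∀ v : Fin n, S.iarr 9 (x * n + v) = G.dist x v + 1)
    (hu : S.ireg 12 = u)
    (h5 : ∀ w, G.dist x u < G.dist x w → S.qarr 5 (x * n + w) = load G nb pen ws α pid x w)
    (h6 : ∀ w, G.dist x u < G.dist x w → (nb w).length = 2 →
      S.qarr 6 (x * n + w) = ownLoad G nb pen ws α pid x w) :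
    Ends sumProg S (90 * (nb u).length + 20) (fun S' =>
      S'.qreg 0 = load G nb pen ws α pid x u - weight G nb pen ws α pid x u ∧
      S'.qreg 1 = if (nb u).length = 2 then
        ownLoad G nb pen ws α pid x u - weight G nb pen ws α pid x u else 0) := by
  classical
  refine Ends.seq (c₁ := 10) (c₂ := 90 * (nb u).length + 10) (Ends.block rfl ?_ (by decide))
    (by omega)
  set S₁ := Prog.run _ S with hS₁
  have hF₁ : Frame sumProg S S₁ := by
    rw [hS₁]
    exact Frame.seq_left (((Exec.setQ S _ _).seq (Exec.setQ _ _ _)).frame)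
  have q0 : S₁.qreg 0 = 0 := by simp [hS₁, Prog.run, QExp.eval]
  have q1 : S₁.qreg 1 = 0 := by simp [hS₁, Prog.run, QExp.eval]
  have hC₁ := hC.of_frame hF₁ rfl
  clear_value S₁
  set f : Fin n → ℚ := fun w => if G.dist x w = G.dist x u + 1 then
    load G nb pen ws α pid x w else 0 with hf
  set g : Fin n → ℚ := fun w => if G.dist x w = G.dist x u + 1 ∧ (nb u).length = 2 ∧
    (nb w).length = 2 then ownLoad G nb pen ws α pid x w else 0 with hg
  refine Ends.forNbrs hC₁ u (fun l S' => S'.qreg 0 = (l.map f).sum ∧ S'.qreg 1 = (l.map g).sum)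
    (fun _ => 70) ((hF₁.ireg 12 rfl).trans hu) rfl rfl rfl (by decide) (fun _ _ _ _ _ h => h)
    (by simp [q0, q1]) ?_ ?_ ?_
  · rintro l₁ w l₂ S' hl hw hu' hC' hF' ⟨i₁, i₂⟩
    refine Ends.block rfl ?_ (by decide)
    have hx' : S'.ireg 1 = x := (hF'.ireg 1 rfl).trans ((hF₁.ireg 1 rfl).trans hx)
    have e9 : S'.iarr 9 = S.iarr 9 := (hF'.iarr 9 rfl).trans (hF₁.iarr 9 rfl)
    have e5 : S'.qarr 5 = S.qarr 5 := (hF'.qarr 5 rfl).trans (hF₁.qarr 5 rfl)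
    have e6 : S'.qarr 6 = S.qarr 6 := (hF'.qarr 6 rfl).trans (hF₁.qarr 6 rfl)
    have t₁ := hC'.isTwo_eval hu'
    have t₂ := hC'.isTwo_eval hw
    have hrow' := hC'.row x
    by_cases hdw : G.dist x w = G.dist x u + 1
    · have hev : (BExp.eq (.arr 9 (.cell 1 (.reg 3)))
          (.add (.arr 9 (.cell 1 (.reg 12))) (.const 1))).eval S' = true := by
        simp [BExp.eval, IExp.eval, IExp.cell, hx', hrow', hw, hu', e9, hd, hdw]
      have hq : (QExp.arr 5 (.cell 1 (.reg 3))).eval S' = load G nb pen ws α pid x w := by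
        simp [QExp.eval, IExp.eval, IExp.cell, hx', hrow', hw, e5, h5 w (by omega)]
      set S₂ := S'.setQ 0 ((QExp.add (.reg 0) (.arr 5 (.cell 1 (.reg 3)))).eval S') with hS₂
      have z0 : S₂.qreg 0 = S'.qreg 0 + load G nb pen ws α pid x w := by
        rw [← hq]; simp [hS₂, QExp.eval]
      have z1 : S₂.qreg 1 = S'.qreg 1 := by simp [hS₂]
      have hev₂ : (BExp.and (.isTwo 12) (.isTwo 3)).eval S₂ =
          decide ((nb u).length = 2 ∧ (nb w).length = 2) := by
        rw [Bool.decide_and, ← t₁, ← t₂]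
        rfl
      simp only [Prog.run, hev, if_true, ← hS₂, hev₂, decide_eq_true_eq]
      by_cases hc : (nb u).length = 2 ∧ (nb w).length = 2
      · have hq6 : (QExp.arr 6 (.cell 1 (.reg 3))).eval S₂ = ownLoad G nb pen ws α pid x w := by
          simp [hS₂, QExp.eval, IExp.eval, IExp.cell, hx', hrow', hw, e6, h6 w (by omega) hc.2]
        simp only [hc, and_self, if_true]
        constructor
        · simp [z0, i₁, f, hdw]
        · rw [QExp.eval, hq6]
          simp [QExp.eval, z1, i₂, g, hdw, hc]
      · simp only [hc, if_false]
        refine ⟨by simp [z0, i₁, f, hdw], ?_⟩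
        rw [z1, i₂]
        simp only [List.map_append, List.map_cons, List.map_nil, List.sum_append, List.sum_cons,
          List.sum_nil, add_zero, hg]
        rw [if_neg (by tauto), add_zero]
    · have hev : (BExp.eq (.arr 9 (.cell 1 (.reg 3)))
          (.add (.arr 9 (.cell 1 (.reg 12))) (.const 1))).eval S' = false := by
        simp [BExp.eval, IExp.eval, IExp.cell, hx', hrow', hw, hu', e9, hd, hdw]
      simp [Prog.run, hev, i₁, i₂, f, g, hdw]
  · rintro S' - ⟨i₁, i₂⟩
    rw [i₁, i₂, sum_nb hnb, sum_nb hnb]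
    constructor
    · rw [load_rec hB.connected, add_sub_cancel_left]
      exact Finset.sum_congr rfl fun w _ => by simp [f, ite_and]
    · by_cases h2 : (nb u).length = 2
      · rw [if_pos h2, h.ownLoad_rec hB hnb pen hx2 h2, add_sub_cancel_left]
        exact Finset.sum_congr rfl fun w _ => by simp [g, ite_and, h2]
      · simp [g, h2]
  · simp only [List.map_const', List.sum_replicate, smul_eq_mul]
    omega

theorem ends_loadProg (hB : IsBiconnected G) (hnb : IsAdjLists G nb)
    (h : PathCover G nb ws α pid) (hC : Ctx nb pen S) {x u : Fin n} (hx : S.ireg 1 = x)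
    (hx2 : (nb x).length ≠ 2) (hS : HoldsSearch G x S)
    (h4 : ∀ v : Fin n, S.qarr 4 (x * n + v) = weight G nb pen ws α pid x v)
    (hu : S.ireg 12 = u)
    (h5 : ∀ w, G.dist x u < G.dist x w → S.qarr 5 (x * n + w) = load G nb pen ws α pid x w)
    (h6 : ∀ w, G.dist x u < G.dist x w → (nb w).length = 2 →
      S.qarr 6 (x * n + w) = ownLoad G nb pen ws α pid x w) :
    Ends loadProg S (90 * (nb u).length + 80) (fun S' =>
      (∀ v : Fin n, S'.qarr 5 (x * n + v) =
        if v = u then load G nb pen ws α pid x u else S.qarr 5 (x * n + v)) ∧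
      (∀ v : Fin n, (nb v).length = 2 → S'.qarr 6 (x * n + v) =
        if v = u then ownLoad G nb pen ws α pid x u else S.qarr 6 (x * n + v)) ∧
      ∀ v : Fin n, S'.qarr 1 v =
        S.qarr 1 v + if v = u then gain G nb pen ws α pid x u else 0) := by
  refine Ends.seq (c₁ := 90 * (nb u).length + 20) (c₂ := 60) ?_ (by omega)
  refine (ends_sumProg hB hnb h hC hx hx2 hS.2.1 hu h5 h6).frame.mono le_rfl ?_
  rintro S₁ ⟨hF, q0, q1⟩
  refine Ends.block rfl ?_ (by decide)
  have hrow := (hC.of_frame hF rfl).row x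
  have hx' : S₁.ireg 1 = x := (hF.ireg 1 rfl).trans hx
  have hu' : S₁.ireg 12 = u := (hF.ireg 12 rfl).trans hu
  have e1 : S₁.qarr 1 = S.qarr 1 := hF.qarr 1 rfl
  have e3 : S₁.qarr 3 = S.qarr 3 := hF.qarr 3 rfl
  have e4 : S₁.qarr 4 = S.qarr 4 := hF.qarr 4 rfl
  have e5 : S₁.qarr 5 = S.qarr 5 := hF.qarr 5 rfl
  have e6 : S₁.qarr 6 = S.qarr 6 := hF.qarr 6 rfl
  refine ⟨fun v => ?_, fun v h2 => ?_, fun v => ?_⟩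
  · simp [Prog.run, IExp.eval, QExp.eval, IExp.cell, hx', hu', hrow, e4, e5, h4, q0, Fin.val_inj]
  · by_cases hv : v = u
    · subst hv
      simp [Prog.run, IExp.eval, QExp.eval, IExp.cell, hx', hu', hrow, e4, h4, q1, h2]
    · simp [Prog.run, IExp.eval, QExp.eval, IExp.cell, hx', hu', hrow, e6, hv, Fin.val_inj]
  · by_cases hv : v = u
    · subst hv
      simp [Prog.run, IExp.eval, QExp.eval, IExp.cell, hx', hu', hrow, e1, e3, hS.2.2, q0, q1, gain]
    · simp [Prog.run, IExp.eval, QExp.eval, IExp.cell, hx', hu', e1, hv, Fin.val_inj]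

/-- Accumulates the contributions of the shortest paths from the vertex in register `1`. -/
def sweepProg : Prog := .forSliceRev 11 12 10 (.cell 1 (.const 0)) (.cell 1 (.reg 0)) loadProg

theorem ends_sweepProg (hB : IsBiconnected G) (hnb : IsAdjLists G nb)
    (h : PathCover G nb ws α pid) (hC : Ctx nb pen S) {x : Fin n} (hx : S.ireg 1 = x)
    (hx2 : (nb x).length ≠ 2) (hS : HoldsSearch G x S)
    (h4 : ∀ v : Fin n, S.qarr 4 (x * n + v) = weight G nb pen ws α pid x v) :
    Ends sweepProg S (∑ v, (90 * (nb v).length + 100) + 20) (fun S' =>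
      ∀ v : Fin n, S'.qarr 1 v = S.qarr 1 v + gain G nb pen ws α pid x v) := by
  obtain ⟨q, hq, hqueue⟩ := hS.1
  have hlen := length_eq_of_forall_mem hq.nodup hq.mem
  refine Ends.forSliceRev q (b := x * n) (fun l S' =>
      (∀ v ∈ l, S'.qarr 5 (x * n + v) = load G nb pen ws α pid x v) ∧
      (∀ v ∈ l, (nb v).length = 2 → S'.qarr 6 (x * n + v) = ownLoad G nb pen ws α pid x v) ∧
      ∀ v : Fin n, S'.qarr 1 v = S.qarr 1 v + if v ∈ l then gain G nb pen ws α pid x v else 0)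
    (fun u => 90 * (nb u).length + 80) ?_ ?_ rfl hqueue rfl (by decide) (fun _ _ _ _ _ h => h)
    (by simp) ?_ ?_ ?_
  · intro S' hF
    have hC' := hC.of_frame hF rfl
    have hx' : S'.ireg 1 = x := (hF.ireg 1 rfl).trans hx
    simp [IExp.cell, IExp.eval, hx', hC'.row]
  · simp [IExp.cell, IExp.eval, hx, hC.row, hC.card, hlen]
  · rintro l₁ u l₂ S' hl hu hF ⟨i₁, i₂, i₃⟩
    rw [hl] at hq
    have e4 : S'.qarr 4 = S.qarr 4 := hF.qarr 4 rfl
    refine (ends_loadProg hB hnb h (hC.of_frame hF rfl) ((hF.ireg 1 rfl).trans hx) hx2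
      (hS.of_frame hF rfl) (by rw [e4]; exact h4) hu (fun w hw => i₁ w (hq.mem_right hw))
      (fun w hw => i₂ w (hq.mem_right hw))).mono le_rfl ?_
    rintro S'' ⟨j₁, j₂, j₃⟩
    have hul : u ∉ l₂ := by
      have := (List.nodup_append.mp hq.nodup).2.1
      exact (List.nodup_cons.mp this).1
    refine ⟨fun v hv => ?_, fun v hv h2 => ?_, fun v => ?_⟩
    · rw [j₁]
      by_cases hvu : v = u
      · subst hvu; simp
      · rw [if_neg hvu]
        exact i₁ v (by simpa [hvu] using hv)
    · rw [j₂ v h2]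
      by_cases hvu : v = u
      · subst hvu; simp
      · rw [if_neg hvu]
        exact i₂ v (by simpa [hvu] using hv) h2
    · rw [j₃, i₃, add_assoc]
      by_cases hvu : v = u
      · subst hvu; simp [hul]
      · simp [hvu]
  · rintro S' - ⟨-, -, i₃⟩ v
    rw [i₃, if_pos (hq.mem v)]
  · rw [← List.sum_toFinset _ hq.nodup, show q.toFinset = Finset.univ by ext; simp [hq.mem]]
    have h := Finset.sum_le_sum (s := Finset.univ) (f := fun v : Fin n => 90 * (nb v).length + 94)
      (g := fun v => 90 * (nb v).length + 100) fun v _ => by omega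
    simp only [IExp.cell, IExp.cost, add_assoc]
    exact Nat.add_le_add h (by decide)

/-- Accumulates the contributions of the shortest paths from all vertices whose degree is not two. -/
def accumulateProg : Prog := .forTo 1 0 (.ite (.isTwo 1) .skip sweepProg)

theorem ends_accumulateProg (hB : IsBiconnected G) (hnb : IsAdjLists G nb)
    (h : ∀ x, (nb x).length ≠ 2 → PathCover G nb ws α pid) (hC : Ctx nb pen S)
    (hS : ∀ x, (nb x).length ≠ 2 → HoldsSearch G x S)
    (h4 : ∀ y v : Fin n, S.qarr 4 (y * n + v) = weight G nb pen ws α pid y v)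
    (h0 : ∀ i, S.qarr 1 i = 0) :
    Ends accumulateProg S (∑ x : Fin n, (if (nb x).length = 2 then 40
      else ∑ v, (90 * (nb v).length + 100) + 60) + 10) (fun S' => ∀ v : Fin n,
        S'.qarr 1 v = ∑ y, if (nb y).length ≠ 2 then gain G nb pen ws α pid y v else 0) := by
  refine Ends.forTo (N := n) (fun i S' => ∀ v : Fin n, S'.qarr 1 v =
      ∑ y : Fin n, if (y : ℕ) < i then
        (if (nb y).length ≠ 2 then gain G nb pen ws α pid y v else 0) else 0)
    (fun i => if hi : i < n then (if (nb ⟨i, hi⟩).length = 2 then 30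
      else ∑ v, (90 * (nb v).length + 100) + 50) else 0) hC.card rfl rfl (by decide)
    (fun _ _ _ h => h) (by simp [h0]) ?_ ?_ ?_
  · intro i S₁ hi h1 hF hI
    have hC₁ := hC.of_frame hF rfl
    obtain ⟨x, rfl⟩ : ∃ x : Fin n, (x : ℕ) = i := ⟨⟨i, hi⟩, rfl⟩
    rw [dif_pos hi, Fin.eta]
    have e4 : S₁.qarr 4 = S.qarr 4 := hF.qarr 4 rfl
    have hsplit : ∀ f : Fin n → ℚ, (∑ y : Fin n, if (y : ℕ) < x + 1 then f y else 0) =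
        (∑ y : Fin n, if (y : ℕ) < x then f y else 0) + f x := by
      intro f
      have : ∀ y : Fin n, (if (y : ℕ) < x + 1 then f y else 0) =
          (if (y : ℕ) < x then f y else 0) + if y = x then f y else 0 := by
        intro y
        rcases lt_trichotomy y x with hv | rfl | hv
        · rw [if_pos (by omega), if_pos (by omega), if_neg (by omega), add_zero]
        · simp
        · rw [if_neg (by omega), if_neg (by omega), if_neg (by omega), add_zero]
      rw [Finset.sum_congr rfl fun y _ => this y, Finset.sum_add_distrib, Finset.sum_ite_eq',
        if_pos (Finset.mem_univ _)]
    have hb' := hC₁.isTwo_eval h1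
    refine Ends.ite (c₁ := 1) (c₂ := ∑ v, (90 * (nb v).length + 100) + 20) ?_ ?_ ?_ ?_
    · intro hb
      rw [hb', decide_eq_true_eq] at hb
      refine Ends.block rfl (fun v => ?_) le_rfl
      rw [Prog.run, hI, hsplit (fun y => if (nb y).length ≠ 2 then gain G nb pen ws α pid y v else 0)]
      simp [hb]
    · intro hb
      rw [hb', decide_eq_false_iff_not] at hb
      refine (ends_sweepProg hB hnb (h x hb) hC₁ h1 hb ((hS x hb).of_frame hF rfl)
        (by rw [e4]; exact h4 x)).mono le_rfl fun S₂ hS₂ v => ?_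
      rw [hS₂, hI, hsplit (fun y => if (nb y).length ≠ 2 then gain G nb pen ws α pid y v else 0)]
      simp [hb]
    · intro hb
      rw [hb', decide_eq_true_eq] at hb
      rw [if_pos hb]
      simp only [BExp.isTwo, BExp.cost, IExp.cost]; omega
    · intro hb
      rw [hb', decide_eq_false_iff_not] at hb
      rw [if_neg hb]
      simp only [BExp.isTwo, BExp.cost, IExp.cost]; omega
  · intro S' _ hI v
    rw [hI]
    exact Finset.sum_congr rfl fun y _ => if_pos y.2
  · rw [Finset.sum_range]
    refine Nat.add_le_add (Finset.sum_le_sum fun i _ => ?_) (by omega)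
    rw [dif_pos i.2, Fin.eta]
    split_ifs <;> omega

end Loads

end BetwCent

/-! ### Degree sums in terms of the feedback edge number, and the final assembly. -/

namespace BetwCent

open RAM

/-! ### The running time -/

section Time

variable {n : ℕ} {G : SimpleGraph (Fin n)} {nb : Fin n → List (Fin n)} {pen : Fin n → ℕ}
  {ws : List (Fin n)} {α pid : Fin n → Fin n} {S : State}

/-- The forest left by a minimum feedback edge set extends to a spanning tree. The tree and the
deleted edges cover all edges, of which there are therefore at most n − 1 + k. -/
theorem sum_length_le (hG : G.Connected) (hnb : IsAdjLists G nb) :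
    ∑ v, (nb v).length + 2 ≤ 2 * (n + feedbackEdgeNumber G) := by
  classical
  have hmem : feedbackEdgeNumber G ∈ {k | ∃ F : Finset (Sym2 (Fin n)), (F : Set _) ⊆ G.edgeSet ∧
      F.card = k ∧ (G.deleteEdges (F : Set (Sym2 (Fin n)))).IsAcyclic} :=
    -- The infimum is attained, since deleting all edges certainly leaves a forest.
    Nat.sInf_mem ⟨_, G.edgeFinset, by simp, rfl, by simp⟩
  obtain ⟨F, hF, hk, hac⟩ := hmem
  obtain ⟨T, hT, hTG, hTt⟩ :=
    hG.exists_isTree_le_of_le_of_isAcyclic (G.deleteEdges_le _) hac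
  have hc := hTt.card_edgeFinset
  rw [Fintype.card_fin] at hc
  have hsub : G.edgeFinset ⊆ T.edgeFinset ∪ F := by
    intro e he
    rw [SimpleGraph.mem_edgeFinset] at he
    rw [Finset.mem_union, SimpleGraph.mem_edgeFinset]
    by_cases heF : e ∈ F
    · exact Or.inr heF
    · left
      apply SimpleGraph.edgeSet_mono hT
      rw [SimpleGraph.edgeSet_deleteEdges]
      exact ⟨he, heF⟩
  have h₁ := (Finset.card_le_card hsub).trans (Finset.card_union_le _ _)
  have h₂ := G.sum_degrees_eq_twice_card_edges
  simp only [degree_eq_length hnb] at h₂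
  omega

theorem sum_sub_two_le (hB : IsBiconnected G) (hnb : IsAdjLists G nb) :
    ∑ v, ((nb v).length - 2) + 2 ≤ 2 * feedbackEdgeNumber G := by
  have h₁ := sum_length_le hB.connected hnb
  have h₂ : ∑ v, (nb v).length = ∑ v, ((nb v).length - 2) + 2 * n := by
    have : ∑ v : Fin n, 2 = 2 * n := by simp [mul_comm]
    rw [← this, ← Finset.sum_add_distrib]
    exact Finset.sum_congr rfl fun v _ => by have := two_le_length hB hnb v; omega
  omega

theorem sum_ite_two_le (hB : IsBiconnected G) (hnb : IsAdjLists G nb) (a b : ℕ) :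
    ∑ v, (if (nb v).length = 2 then a else b) ≤
      a * n + b * min n (2 * feedbackEdgeNumber G) := by
  have h₁ := sum_sub_two_le hB hnb
  have h₂ : ∀ v, (if (nb v).length = 2 then a else b) ≤
      a + b * (if (nb v).length = 2 then 0 else 1) := fun v => by split_ifs <;> simp
  refine (Finset.sum_le_sum fun v _ => h₂ v).trans ?_
  rw [Finset.sum_add_distrib, ← Finset.mul_sum]
  refine Nat.add_le_add (by simp [mul_comm]) (Nat.mul_le_mul_left _ (le_min ?_ ?_))
  · refine (Finset.sum_le_sum (g := fun _ => 1) fun v _ => by split_ifs <;> simp).trans (by simp)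
  · refine (Finset.sum_le_sum (g := fun v => (nb v).length - 2) fun v _ => ?_).trans (by omega)
    have := two_le_length hB hnb v
    split_ifs <;> omega

theorem sum_branch_length_le (hB : IsBiconnected G) (hnb : IsAdjLists G nb) :
    ∑ v, (if (nb v).length = 2 then 0 else (nb v).length) ≤ 6 * feedbackEdgeNumber G := by
  have h₁ := sum_sub_two_le hB hnb
  -- A degree d ≥ 3 satisfies d ≤ 3(d − 2).
  refine (Finset.sum_le_sum (g := fun v => 3 * ((nb v).length - 2)) fun v _ => ?_).trans ?_
  · have := two_le_length hB hnb v
    split_ifs <;> omega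
  · rw [← Finset.mul_sum]
    omega

theorem PathSys.length_le (hB : IsBiconnected G) (hnb : IsAdjLists G nb) (h : PathSys G nb ws α) :
    ws.length ≤ 6 * feedbackEdgeNumber G := by
  rw [← List.toFinset_card_of_nodup h.nodup]
  have hsub : ws.toFinset ⊆
      (Finset.univ.filter fun a => ¬ (nb a).length = 2).biUnion fun a => (nb a).toFinset := by
    intro w hw
    have hst := h.start w (List.mem_toFinset.mp hw)
    simp only [Finset.mem_biUnion, Finset.mem_filter, Finset.mem_univ, true_and, List.mem_toFinset]
    exact ⟨α w, hst.branch, ((hnb _).2 w).mpr hst.adj⟩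
  refine (Finset.card_le_card hsub).trans (Finset.card_biUnion_le.trans ?_)
  rw [Finset.sum_filter]
  refine (Finset.sum_le_sum fun v _ => ?_).trans (sum_branch_length_le hB hnb)
  by_cases hv : (nb v).length = 2
  · simp [hv]
  · simpa [hv] using List.toFinset_card_le _

theorem sum_affine_length (nb : Fin n → List (Fin n)) (a b : ℕ) :
    ∑ v, (a * (nb v).length + b) = a * ∑ v, (nb v).length + b * n := by
  rw [Finset.sum_add_distrib, ← Finset.mul_sum]
  simp [mul_comm]

/-- The time of a phase that spends linear time on each vertex whose degree is not two. -/
theorem sum_linear_le (hB : IsBiconnected G) (hnb : IsAdjLists G nb) (a b c d : ℕ) :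
    ∑ x : Fin n, (if (nb x).length = 2 then a else ∑ v, (b * (nb v).length + c) + d) ≤
      (a + 6 * b + 2 * c + 2 * d) * (feedbackEdgeNumber G * n) := by
  have hn : 1 ≤ n := by have := hB.three_le_card; simp at this; omega
  have hk : 1 ≤ feedbackEdgeNumber G := by have := sum_sub_two_le hB hnb; omega
  have h₁ := sum_length_le hB.connected hnb
  refine (sum_ite_two_le hB hnb _ _).trans ?_
  rw [sum_affine_length]
  set k := feedbackEdgeNumber G
  set D := ∑ v, (nb v).length
  set m := min n (2 * k)
  have hmn : m ≤ n := min_le_left _ _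
  have hmk : m ≤ 2 * k := min_le_right _ _
  -- `D` is at most 2n + 2k. The bound `m ≤ 2 * k` serves the term with n and `m ≤ n` the term with
  -- k; this keeps dense graphs within O(kn).
  have e₁ : D * m ≤ 6 * (k * n) := by
    have : D * m ≤ (2 * (n + k)) * m := Nat.mul_le_mul_right _ (by omega)
    have : n * m ≤ n * (2 * k) := Nat.mul_le_mul_left _ hmk
    have : k * m ≤ k * n := Nat.mul_le_mul_left _ hmn
    nlinarith
  have e₂ : n * m ≤ 2 * (k * n) := by nlinarith
  have e₃ : m ≤ 2 * (k * n) := by nlinarith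
  have e₄ : n ≤ k * n := by nlinarith
  have f₁ := Nat.mul_le_mul_left b e₁
  have f₂ := Nat.mul_le_mul_left c e₂
  have f₃ := Nat.mul_le_mul_left d e₃
  have f₄ := Nat.mul_le_mul_left a e₄
  nlinarith

/-- Every adjacency entry of a branching vertex is charged for one walk of O(n) steps, and there are
at most 6k such entries. -/
theorem sum_paths_le (hB : IsBiconnected G) (hnb : IsAdjLists G nb) :
    ∑ i : Fin n, (if (nb i).length = 2 then 40 else (nb i).length * (200 * n + 300) + 60) ≤
      3500 * (feedbackEdgeNumber G * n) := by
  have hn : 1 ≤ n := by have := hB.three_le_card; simp at this; omega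
  have hk : 1 ≤ feedbackEdgeNumber G := by have := sum_sub_two_le hB hnb; omega
  have h₁ : ∀ i : Fin n, (if (nb i).length = 2 then 40
      else (nb i).length * (200 * n + 300) + 60) ≤
      (if (nb i).length = 2 then 0 else (nb i).length) * (200 * n + 300) + 60 := fun i => by
    split_ifs <;> omega
  refine (Finset.sum_le_sum fun i _ => h₁ i).trans ?_
  rw [Finset.sum_add_distrib, ← Finset.sum_mul]
  have h₂ := Nat.mul_le_mul_right (200 * n + 300) (sum_branch_length_le hB hnb)
  simp only [Finset.sum_const, Finset.card_univ, Fintype.card_fin, smul_eq_mul]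
  nlinarith

end Time

/-! ### The algorithm -/

/-- The whole algorithm. -/
def mainProg : Prog := tablesProg⨟ pathsProg⨟ searchProg⨟ weightProg⨟ accumulateProg

section Main

variable {n : ℕ} {G : SimpleGraph (Fin n)} {nb : Fin n → List (Fin n)} {pen : Fin n → ℕ}

theorem ends_mainProg (hB : IsBiconnected G) (hnb : IsAdjLists G nb) :
    Ends mainProg (inputState nb pen) (20000 * (feedbackEdgeNumber G * n))
      (fun S => ∀ v : Fin n, S.qarr 1 v = pairSum G pen v) := by
  have hn : 1 ≤ n := by have := hB.three_le_card; simp at this; omega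
  have hk : 1 ≤ feedbackEdgeNumber G := by have := sum_sub_two_le hB hnb; omega
  set N := feedbackEdgeNumber G * n with hN
  have hnN : n ≤ N := by nlinarith
  have hkN : feedbackEdgeNumber G ≤ N := by nlinarith
  refine Ends.seq (c₁ := 200 * N) (c₂ := 19800 * N) ?_ (by omega)
  refine (ends_tablesProg nb pen).frame.mono (by omega) ?_
  rintro S₁ ⟨F₁, hC₁⟩
  have hP₀ : HoldsPaths G nb pen [] id S₁ := by
    constructor <;> try simp
    · exact PathSys.nil _
    · rw [F₁.ireg 5 rfl]; simp [inputState]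
    · intro v
      rw [F₁.iarr 8 rfl]; simp [inputState]
  refine Ends.seq (c₁ := 3510 * N) (c₂ := 16000 * N) ?_ (by omega)
  refine (ends_pathsProg hnb hC₁ hP₀).frame.mono
    (by have := sum_paths_le hB hnb; omega) ?_
  rintro S₂ ⟨F₂, ws, α, hP₂, hall⟩
  have hC₂ := hC₁.of_frame F₂ rfl
  -- Reachability from some branching vertex gives the cover. If there is none, the claim is vacuous
  -- and any `pid` will do.
  obtain ⟨pid, hcov⟩ : ∃ pid, ∀ x, (nb x).length ≠ 2 → PathCover G nb ws α pid := by
    by_cases hx : ∃ x, (nb x).length ≠ 2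
    · obtain ⟨x, hx⟩ := hx
      have : ∀ v, ∃ w, (nb v).length = 2 → w ∈ ws ∧ InPath nb (α w) w v := by
        intro v
        by_cases hv : (nb v).length = 2
        · obtain ⟨w, hw, hwv⟩ := hP₂.sys.cover hB hnb hall hx hv
          exact ⟨w, fun _ => ⟨hw, hwv⟩⟩
        · exact ⟨v, fun h => absurd h hv⟩
      choose pid hpid using this
      exact ⟨pid, fun _ _ => ⟨hP₂.sys, hpid⟩⟩
    · exact ⟨id, fun x h => absurd ⟨x, h⟩ hx⟩
  refine Ends.seq (c₁ := 2000 * N) (c₂ := 14000 * N) ?_ (by omega)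
  refine (ends_searchProg hB.connected hnb hC₂ fun i => ?_).frame.mono
    (by have := sum_linear_le hB hnb 40 140 120 110; omega) ?_
  · rw [F₂.iarr 9 rfl, F₁.iarr 9 rfl]; simp [inputState]
  rintro S₃ ⟨F₃, hS₃⟩
  have hC₃ := hC₂.of_frame F₃ rfl
  have hP₃ := hP₂.of_frame F₃ rfl
  refine Ends.seq (c₁ := 2000 * N) (c₂ := 12000 * N) ?_ (by omega)
  refine (ends_weightProg hB hnb hcov hC₃ hP₃ hS₃ fun i => ?_).frame.mono ?_ ?_
  · rw [F₃.qarr 4 rfl, F₂.qarr 4 rfl, F₁.qarr 4 rfl]; simp [inputState]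
  · have := Nat.mul_le_mul_right (200 * n + 50) (hP₂.sys.length_le hB hnb)
    nlinarith
  rintro S₄ ⟨F₄, hW⟩
  refine (ends_accumulateProg hB hnb hcov (hC₃.of_frame F₄ rfl)
    (fun x hx => (hS₃ x hx).of_frame F₄ rfl) hW fun i => ?_).mono
    (by have := sum_linear_le hB hnb 40 90 100 60; omega) ?_
  · rw [F₄.qarr 1 rfl, F₃.qarr 1 rfl, F₂.qarr 1 rfl, F₁.qarr 1 rfl]; simp [inputState]
  intro S₅ h v
  rw [h]
  by_cases hx : ∃ x, (nb x).length ≠ 2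
  · obtain ⟨x, hx⟩ := hx
    exact ((hcov x hx).pairSum_eq_sum_load hB hnb pen v).symm
  -- All degrees are two: there are no maximal induced paths, and the accumulated sum over branching
  -- vertices is empty as well.
  · push Not at hx
    rw [pairSum_eq_zero hnb hx]
    simp [hx]

end Main

end BetwCent

theorem mainTheorem2 :
    ∃ (prog : RAM.Prog) (C : ℕ),
      ∀ (n : ℕ) (G : SimpleGraph (Fin n)) (pen : Fin n → ℕ) (nb : Fin n → List (Fin n)),
        BetwCent.IsBiconnected G → BetwCent.IsAdjLists G nb →
        ∃ (T : ℕ) (S : RAM.State),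
          RAM.Exec prog (BetwCent.inputState nb pen) T S ∧
          T ≤ C * (BetwCent.feedbackEdgeNumber G * n) ∧
          ∀ v : Fin n, S.qarr 1 v = BetwCent.pairSum G pen v :=
  ⟨BetwCent.mainProg, 20000, fun _ _ _ _ hB hnb => BetwCent.ends_mainProg hB hnb⟩
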